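/- Notation. $\mathbb{D}=\{|z|<1\}$, $\overline{\mathbb{D}}=\{|z|\le 1\}$, $\mathbb{T}=\{|z|=1\}$, $\mathbb{N}=\{0,1,2,\dots\}$, $\mathbb{Z}_+=\{1,2,\dots\}$. A set $J\subset\mathbb{Z}^2$ is a \emph{diagram} if $J+\mathbb{N}^2\subset J$; it is \emph{simple} if it is a translate of $\mathbb{Z}^2$, $\mathbb{Z}_+^2$, $\mathbb{Z}_+\times\mathbb{Z}$ or $\mathbb{Z}\times\mathbb{Z}_+$. For a diagram $J$ let $H_J=\{f\in L^2(\mathbb{T}^2):\hat f_{i,j}=0\text{ for }(i,j)\notin J\}$, and let $M_w,M_z\in\mathcal{B}(H_J)$ be the multiplications by the two coordinate functions, $M_w:w^iz^j\mapsto w^{i+1}z^j$, $M_z:w^iz^j\mapsto w^iz^{j+1}$. An isometry $V$ on $H$ is a \emph{unilateral shift} if its unitary subspace $\bigcap_n V^nH$ is $\{0\}$, and has \emph{non-trivial Wold decomposition} if $\{0\}\ne\bigcap_nV^nH\neq H$. For commuting $T_1,T_2\in\mathcal{B}(H)$ put $\Gamma_3(T_1,T_2)=\{(\mu,\lambda)\in\mathbb{C}^2:\operatorname{ran}(\mu-T_1)+\operatorname{ran}(\lambda-T_2)\ne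 H\}$. For $j\in\mathbb{Z}$ let $M_j=\inf\{i:(i,j)\in J\}\in\mathbb{Z}\cup\{\pm\infty\}$ (with $\inf\emptyset=\infty$); this sequence is non-increasing in $j$. Let $a,b\in\mathbb{Z}$ be any rows with $M_a\neq-\infty$ and $M_b\ne\infty$. If some $M_j=\infty$, put $\rho_-=\delta_-=\infty$; otherwise $$\rho_-=\lim_{n\to\infty}\sup_{j\le a}\frac{M_{j-n}-M_j}{n},\qquad \delta_-=\lim_{n\to\infty}\inf_{j\le a}\frac{M_{j-n}-M_j}{n}.$$ If some $M_j=-\infty$, put $\rho_+=\delta_+=\infty$; otherwise $$\rho_+=\lim_{n\to\infty}\sup_{j\ge b}\frac{M_j-M_{j+n}}{n},\qquad \delta_+=\lim_{n\to\infty}\inf_{j\ge b}\frac{M_j-M_{j+n}}{n}.$$ These limits exist in $[0,\infty]$. For $x\in[0,1)$ put $x^\infty=0$; inequalities with the symbol $0^0$ or $1^\infty$ are regarded as satisfied. \textbf{Theorem.} Let $J$ be a non-empty non-simple diagram. Then each of $M_w$, $M_z$ either is a unilateral shift or has non-trivial Wold decomposition, and: \begin{itemize} \item if both $M_w,M_z$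 have non-trivial Wold decompositions, then $$\Gamma_3(M_w,M_z)\cup\{(0,0)\}\cup\mathbb{T}^2=(\mathbb{T}\times\overline{\mathbb{D}})\cup(\overline{\mathbb{D}}\times\mathbb{T})\cup\{(0,0)\};$$ \item if $M_z$ has non-trivial Wold decomposition and $M_w$ is a unilateral shift, then $$\Gamma_3(M_w,M_z)\cup\mathbb{T}^2=\{(\mu,\lambda)\in\overline{\mathbb{D}}^2:|\mu|^{\rho_+}\le|\lambda|\le|\mu|^{\delta_+}\}\cup(\overline{\mathbb{D}}\times\mathbb{T});$$ \item if $M_w$ has non-trivial Wold decomposition and $M_z$ is a unilateral shift, then $$\Gamma_3(M_w,M_z)\cup\mathbb{T}^2=\{(\mu,\lambda)\in\overline{\mathbb{D}}^2:|\mu|^{\rho_-}\le|\lambda|\le|\mu|^{\delta_-}\}\cup(\mathbb{T}\times\overline{\mathbb{D}});$$ \item if $M_w,M_z$ are unilateral shifts, then $$\Gamma_3(M_w,M_z)\cup\mathbb{T}^2=\{(\mu,\lambda)\in\overline{\mathbb{D}}^2:|\mu|^{\rho_-}\le|\lambda|\le|\mu|^{\delta_-}\text{ or }|\mu|^{\delta_-}\le|\lambda|\le|\mu|^{\rho_+}\text{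 or }|\mu|^{\rho_+}\le|\lambda|\le|\mu|^{\delta_+}\}.$$ \end{itemize} -/

import Mathlib

open MeasureTheory Filter Topology
open scoped ENNReal

noncomputable section

namespace DiagramPair

/-! ### Diagrams -/

/-- A diagram is a set `J ⊆ ℤ²` with `J + ℕ² ⊆ J`. -/
def IsDiagram (J : Set (ℤ × ℤ)) : Prop :=
  ∀ p ∈ J, ∀ k l : ℕ, (p.1 + (k : ℤ), p.2 + (l : ℤ)) ∈ J

/-- Translation equivalence of subsets of `ℤ²`: `J₁ = v + J₂` for some `v ∈ ℤ²`. -/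
def TranslationEquiv (J₁ J₂ : Set (ℤ × ℤ)) : Prop :=
  ∃ v : ℤ × ℤ, J₁ = (fun p => v + p) '' J₂

/-- A diagram is simple if it is a translate of the plane, of the quadrant `ℤ₊²`,
or of one of the half-planes `ℤ₊ × ℤ`, `ℤ × ℤ₊`, where `ℤ₊ = {1, 2, …}`. -/
def IsSimple (J : Set (ℤ × ℤ)) : Prop :=
  TranslationEquiv J Set.univ ∨
  TranslationEquiv J {p | 1 ≤ p.1 ∧ 1 ≤ p.2} ∨
  TranslationEquiv J {p | 1 ≤ p.1} ∨
  TranslationEquiv J {p | 1 ≤ p.2}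

/-- `M_j = inf {i : (i, j) ∈ J}`, as an extended real: `⊤` if row `j` of `J` is empty,
`⊥` if row `j` is not bounded below. -/
def rowInf (J : Set (ℤ × ℤ)) (j : ℤ) : EReal :=
  ⨅ i ∈ {i : ℤ | (i, j) ∈ J}, ((i : ℝ) : EReal)

/-! ### The parameters of a diagram

The lower parameters are computed from the rows `j ≤ a`, where `a` is a row with `M_a ≠ -∞`; the
upper parameters are computed from the rows `j ≥ b`, where `b` is a row with `M_b ≠ ∞`.
(Translating the diagram moves `a` to `0` and `b` to `-1`.)  For such `a` and `b` the sequences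
below converge, see `tendsto_rhoMinus` and the lemmas that follow it, so that `limsup` is
the limit. -/

/-- `ρ₋`: equal to `∞` if some `M_j = ∞`, otherwise
`lim_n sup_{j ≤ a} (M_{j-n} - M_j) / n`. -/
def rhoMinus (J : Set (ℤ × ℤ)) (a : ℤ) : EReal :=
  open Classical in
  if ∃ j, rowInf J j = ⊤ then ⊤ else
    limsup (fun n : ℕ => ⨆ j ≤ a, (rowInf J (j - n) - rowInf J j) / (n : EReal)) atTop

/-- `δ₋`: equal to `∞` if some `M_j = ∞`, otherwise
`lim_n inf_{j ≤ a} (M_{j-n} - M_j) / n`. -/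
def deltaMinus (J : Set (ℤ × ℤ)) (a : ℤ) : EReal :=
  open Classical in
  if ∃ j, rowInf J j = ⊤ then ⊤ else
    limsup (fun n : ℕ => ⨅ j ≤ a, (rowInf J (j - n) - rowInf J j) / (n : EReal)) atTop

/-- `ρ₊`: equal to `∞` if some `M_j = -∞`, otherwise
`lim_n sup_{j ≥ b} (M_j - M_{j+n}) / n`. -/
def rhoPlus (J : Set (ℤ × ℤ)) (b : ℤ) : EReal :=
  open Classical in
  if ∃ j, rowInf J j = ⊥ then ⊤ else
    limsup (fun n : ℕ => ⨆ j ≥ b, (rowInf J j - rowInf J (j + n)) / (n : EReal)) atTop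

/-- `δ₊`: equal to `∞` if some `M_j = -∞`, otherwise
`lim_n inf_{j ≥ b} (M_j - M_{j+n}) / n`. -/
def deltaPlus (J : Set (ℤ × ℤ)) (b : ℤ) : EReal :=
  open Classical in
  if ∃ j, rowInf J j = ⊥ then ⊤ else
    limsup (fun n : ℕ => ⨅ j ≥ b, (rowInf J j - rowInf J (j + n)) / (n : EReal)) atTop

/-! #### Convergence of the sequences that define the parameters -/

lemma monotone_step_le {g : ℕ → ℝ} {c : ℝ} {k : ℕ} (h : ∀ i, g (i + k) - g i ≤ c) (t i : ℕ) :
    g (i + k * t) - g i ≤ t * c := by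
  induction t with
  | zero => simp
  | succ t ih =>
    have h1 := h (i + k * t)
    have e : i + k * (t + 1) = i + k * t + k := by ring
    rw [e]
    push_cast
    linarith

lemma monotone_le_step {g : ℕ → ℝ} {c : ℝ} {k : ℕ} (h : ∀ i, c ≤ g (i + k) - g i) (t i : ℕ) :
    t * c ≤ g (i + k * t) - g i := by
  induction t with
  | zero => simp
  | succ t ih =>
    have h1 := h (i + k * t)
    have e : i + k * (t + 1) = i + k * t + k := by ring
    rw [e]
    push_cast
    linarith

lemma tendsto_sup_slope {g : ℕ → ℝ} (hg : Monotone g) {u : ℕ → EReal}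
    (hu : ∀ n, u n = ⨆ i : ℕ, (((g (i + n) - g i) / n : ℝ) : EReal)) :
    Tendsto u atTop (𝓝 (limsup u atTop)) := by
  have key : ∀ k : ℕ, 1 ≤ k → limsup u atTop ≤ u k := by
    intro k hk
    have hk0 : (0 : ℝ) < k := by exact_mod_cast hk
    refine EReal.le_of_forall_lt_iff_le.1 fun c hc => ?_
    have h1 : ∀ i, g (i + k) - g i ≤ c * k := by
      intro i
      have h2 : (((g (i + k) - g i) / k : ℝ) : EReal) ≤ (c : EReal) :=
        (le_iSup (fun i : ℕ => (((g (i + k) - g i) / k : ℝ) : EReal)) i).trans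
          ((hu k).symm.le.trans hc.le)
      exact (div_le_iff₀ hk0).1 (EReal.coe_le_coe_iff.1 h2)
    have hck : 0 ≤ c * k := le_trans (sub_nonneg.2 (hg (Nat.le_add_right 0 k))) (h1 0)
    have h3 : ∀ n : ℕ, 1 ≤ n → u n ≤ ((c + c * k / n : ℝ) : EReal) := by
      intro n hn
      have hn0 : (0 : ℝ) < n := by exact_mod_cast hn
      rw [hu n]
      refine iSup_le fun i => EReal.coe_le_coe_iff.2 ?_
      rw [div_le_iff₀ hn0]
      have h4 := monotone_step_le h1 (n / k + 1) i
      have h5 : n ≤ k * (n / k + 1) := (Nat.lt_mul_div_succ n hk).le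
      have h6 : g (i + n) ≤ g (i + k * (n / k + 1)) := hg (by omega)
      have h7 : ((n / k : ℕ) : ℝ) * k ≤ n := by exact_mod_cast Nat.div_mul_le_self n k
      have hc0 : 0 ≤ c := nonneg_of_mul_nonneg_left hck hk0
      have h8 : c * (((n / k : ℕ) : ℝ) * k) ≤ c * n := mul_le_mul_of_nonneg_left h7 hc0
      have h9 : (c + c * k / n) * n = c * n + c * k := by field_simp
      push_cast at h4
      rw [h9]
      nlinarith
    have h4 : Tendsto (fun n : ℕ => ((c + c * k / n : ℝ) : EReal)) atTop (𝓝 (c : EReal)) := by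
      refine (continuous_coe_real_ereal.tendsto c).comp ?_
      simpa using (tendsto_const_div_atTop_nhds_zero_nat (c * k)).const_add c
    calc limsup u atTop ≤ limsup (fun n : ℕ => ((c + c * k / n : ℝ) : EReal)) atTop :=
          limsup_le_limsup (eventually_atTop.2 ⟨1, h3⟩)
      _ = c := h4.limsup_eq
  exact tendsto_of_le_liminf_of_limsup_le
    (le_liminf_of_le (h := eventually_atTop.2 ⟨1, key⟩)) le_rfl

lemma tendsto_inf_slope {g : ℕ → ℝ} (hg : Monotone g) {u : ℕ → EReal}
    (hu : ∀ n, u n = ⨅ i : ℕ, (((g (i + n) - g i) / n : ℝ) : EReal)) :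
    Tendsto u atTop (𝓝 (limsup u atTop)) := by
  have key : ∀ k : ℕ, 1 ≤ k → u k ≤ liminf u atTop := by
    intro k hk
    have hk0 : (0 : ℝ) < k := by exact_mod_cast hk
    refine EReal.ge_of_forall_gt_iff_ge.1 fun c hc => ?_
    have h1 : ∀ i, c * k ≤ g (i + k) - g i := by
      intro i
      have h2 : (c : EReal) ≤ (((g (i + k) - g i) / k : ℝ) : EReal) :=
        (hc.le.trans (hu k).le).trans
          (iInf_le (fun i : ℕ => (((g (i + k) - g i) / k : ℝ) : EReal)) i)
      exact (le_div_iff₀ hk0).1 (EReal.coe_le_coe_iff.1 h2)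
    have h3 : ∀ n : ℕ, 1 ≤ n → ((c - |c| * k / n : ℝ) : EReal) ≤ u n := by
      intro n hn
      have hn0 : (0 : ℝ) < n := by exact_mod_cast hn
      rw [hu n]
      refine le_iInf fun i => EReal.coe_le_coe_iff.2 ?_
      rw [le_div_iff₀ hn0]
      have h4 := monotone_le_step h1 (n / k) i
      have h6 : g (i + k * (n / k)) ≤ g (i + n) :=
        hg (by have := Nat.mul_div_le n k; omega)
      have h7 : ((k : ℝ) * ((n / k : ℕ) : ℝ)) + ((n % k : ℕ) : ℝ) = n := by
        exact_mod_cast Nat.div_add_mod n k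
      have h8 : ((n % k : ℕ) : ℝ) ≤ k := by exact_mod_cast (Nat.mod_lt n hk).le
      have h8' : (0 : ℝ) ≤ ((n % k : ℕ) : ℝ) := Nat.cast_nonneg _
      have h10 : c * ((n % k : ℕ) : ℝ) ≤ |c| * k :=
        mul_le_mul (le_abs_self c) h8 h8' (abs_nonneg c)
      have h9 : (c - |c| * k / n) * n = c * n - |c| * k := by field_simp
      have h11 : c * n = c * k * ((n / k : ℕ) : ℝ) + c * ((n % k : ℕ) : ℝ) := by
        rw [← h7]; ring
      rw [h9, h11]
      linarith
    have h4 : Tendsto (fun n : ℕ => ((c - |c| * k / n : ℝ) : EReal)) atTop (𝓝 (c : EReal)) := by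
      refine (continuous_coe_real_ereal.tendsto c).comp ?_
      simpa using (tendsto_const_div_atTop_nhds_zero_nat (|c| * k)).const_sub c
    calc (c : EReal) = liminf (fun n : ℕ => ((c - |c| * k / n : ℝ) : EReal)) atTop :=
          h4.liminf_eq.symm
      _ ≤ liminf u atTop := liminf_le_liminf (eventually_atTop.2 ⟨1, h3⟩)
  have h1 : limsup u atTop ≤ liminf u atTop :=
    limsup_le_of_le (h := eventually_atTop.2 ⟨1, key⟩)
  exact tendsto_of_le_liminf_of_limsup_le h1 le_rfl

lemma rowInf_antitone {J : Set (ℤ × ℤ)} (hJ : IsDiagram J) : Antitone (rowInf J) := by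
  intro j j' h
  refine le_iInf₂ fun i hi => iInf₂_le i ?_
  obtain ⟨l, hl⟩ := Int.eq_ofNat_of_zero_le (sub_nonneg.2 h)
  have := hJ _ hi 0 l
  have e : j + (l : ℤ) = j' := by omega
  simpa [e] using this

lemma lower_slope {J : Set (ℤ × ℤ)} (hJ : IsDiagram J) {a : ℤ}
    (ha : rowInf J a ≠ ⊥) (h : ¬ ∃ j, rowInf J j = ⊤) :
    ∃ g : ℕ → ℝ, Monotone g ∧ ∀ i : ℕ, rowInf J (a - i) = (g i : EReal) := by
  have hr : ∀ i : ℕ, rowInf J (a - i) = ((rowInf J (a - i)).toReal : EReal) := fun i =>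
    (EReal.coe_toReal (fun e => h ⟨_, e⟩) fun e => ha <| le_bot_iff.1 <| e ▸
      rowInf_antitone hJ (by omega)).symm
  refine ⟨fun i => (rowInf J (a - i)).toReal, fun i i' hii => ?_, hr⟩
  rw [← EReal.coe_le_coe_iff, ← hr, ← hr]
  exact rowInf_antitone hJ (by omega)

lemma upper_slope {J : Set (ℤ × ℤ)} (hJ : IsDiagram J) {b : ℤ}
    (hb : rowInf J b ≠ ⊤) (h : ¬ ∃ j, rowInf J j = ⊥) :
    ∃ g : ℕ → ℝ, Monotone g ∧ ∀ i : ℕ, rowInf J (b + i) = ((- g i : ℝ) : EReal) := by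
  have hr : ∀ i : ℕ, rowInf J (b + i) = ((rowInf J (b + i)).toReal : EReal) := fun i =>
    (EReal.coe_toReal (fun e => hb <| top_le_iff.1 <| e ▸
      rowInf_antitone hJ (by omega)) fun e => h ⟨_, e⟩).symm
  refine ⟨fun i => -(rowInf J (b + i)).toReal, fun i i' hii => ?_, fun i => by simpa using hr i⟩
  rw [neg_le_neg_iff, ← EReal.coe_le_coe_iff, ← hr, ← hr]
  exact rowInf_antitone hJ (by omega)

lemma lower_quot {J : Set (ℤ × ℤ)} {a : ℤ} {g : ℕ → ℝ}
    (hg : ∀ i : ℕ, rowInf J (a - i) = (g i : EReal)) (n i : ℕ) :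
    (rowInf J (a - i - n) - rowInf J (a - i)) / (n : EReal) =
      (((g (i + n) - g i) / n : ℝ) : EReal) := by
  have h := hg (i + n)
  push_cast at h
  rw [sub_sub, h, hg i, EReal.coe_div, EReal.coe_sub]
  rfl

lemma upper_quot {J : Set (ℤ × ℤ)} {b : ℤ} {g : ℕ → ℝ}
    (hg : ∀ i : ℕ, rowInf J (b + i) = ((- g i : ℝ) : EReal)) (n i : ℕ) :
    (rowInf J (b + i) - rowInf J (b + i + n)) / (n : EReal) =
      (((g (i + n) - g i) / n : ℝ) : EReal) := by
  have h := hg (i + n)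
  push_cast at h
  rw [add_assoc, h, hg i, ← EReal.coe_neg, ← EReal.coe_sub, neg_sub_neg, EReal.coe_div]
  rfl

/-- The sequence in `rhoMinus` converges. -/
lemma tendsto_rhoMinus {J : Set (ℤ × ℤ)} (hJ : IsDiagram J) {a : ℤ}
    (ha : rowInf J a ≠ ⊥) (h : ¬ ∃ j, rowInf J j = ⊤) :
    Tendsto (fun n : ℕ => ⨆ j ≤ a, (rowInf J (j - n) - rowInf J j) / (n : EReal)) atTop
      (𝓝 (rhoMinus J a)) := by
  obtain ⟨g, hm, hg⟩ := lower_slope hJ ha h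
  rw [rhoMinus, if_neg h]
  refine tendsto_sup_slope hm fun n => ?_
  simp_rw [← lower_quot hg]
  refine le_antisymm (iSup₂_le fun j hj => ?_) (iSup_le fun i => ?_)
  · obtain ⟨i, rfl⟩ : ∃ i : ℕ, j = a - i := ⟨(a - j).toNat, by omega⟩
    exact le_iSup (fun i : ℕ => (rowInf J (a - i - n) - rowInf J (a - i)) / (n : EReal)) i
  · exact le_iSup₂ (f := fun j (_ : j ≤ a) => (rowInf J (j - n) - rowInf J j) / (n : EReal))
      (a - i) (by omega)

/-- The sequence in `deltaMinus` converges. -/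
lemma tendsto_deltaMinus {J : Set (ℤ × ℤ)} (hJ : IsDiagram J) {a : ℤ}
    (ha : rowInf J a ≠ ⊥) (h : ¬ ∃ j, rowInf J j = ⊤) :
    Tendsto (fun n : ℕ => ⨅ j ≤ a, (rowInf J (j - n) - rowInf J j) / (n : EReal)) atTop
      (𝓝 (deltaMinus J a)) := by
  obtain ⟨g, hm, hg⟩ := lower_slope hJ ha h
  rw [deltaMinus, if_neg h]
  refine tendsto_inf_slope hm fun n => ?_
  simp_rw [← lower_quot hg]
  refine le_antisymm (le_iInf fun i => ?_) (le_iInf₂ fun j hj => ?_)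
  · exact iInf₂_le (f := fun j (_ : j ≤ a) => (rowInf J (j - n) - rowInf J j) / (n : EReal))
      (a - i) (by omega)
  · obtain ⟨i, rfl⟩ : ∃ i : ℕ, j = a - i := ⟨(a - j).toNat, by omega⟩
    exact iInf_le (fun i : ℕ => (rowInf J (a - i - n) - rowInf J (a - i)) / (n : EReal)) i

/-- The sequence in `rhoPlus` converges. -/
lemma tendsto_rhoPlus {J : Set (ℤ × ℤ)} (hJ : IsDiagram J) {b : ℤ}
    (hb : rowInf J b ≠ ⊤) (h : ¬ ∃ j, rowInf J j = ⊥) :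
    Tendsto (fun n : ℕ => ⨆ j ≥ b, (rowInf J j - rowInf J (j + n)) / (n : EReal)) atTop
      (𝓝 (rhoPlus J b)) := by
  obtain ⟨g, hm, hg⟩ := upper_slope hJ hb h
  rw [rhoPlus, if_neg h]
  refine tendsto_sup_slope hm fun n => ?_
  simp_rw [← upper_quot hg]
  refine le_antisymm (iSup₂_le fun j hj => ?_) (iSup_le fun i => ?_)
  · obtain ⟨i, rfl⟩ : ∃ i : ℕ, j = b + i := ⟨(j - b).toNat, by omega⟩
    exact le_iSup (fun i : ℕ => (rowInf J (b + i) - rowInf J (b + i + n)) / (n : EReal)) i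
  · exact le_iSup₂ (f := fun j (_ : j ≥ b) => (rowInf J j - rowInf J (j + n)) / (n : EReal))
      (b + i) (by omega)

/-- The sequence in `deltaPlus` converges. -/
lemma tendsto_deltaPlus {J : Set (ℤ × ℤ)} (hJ : IsDiagram J) {b : ℤ}
    (hb : rowInf J b ≠ ⊤) (h : ¬ ∃ j, rowInf J j = ⊥) :
    Tendsto (fun n : ℕ => ⨅ j ≥ b, (rowInf J j - rowInf J (j + n)) / (n : EReal)) atTop
      (𝓝 (deltaPlus J b)) := by
  obtain ⟨g, hm, hg⟩ := upper_slope hJ hb h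
  rw [deltaPlus, if_neg h]
  refine tendsto_inf_slope hm fun n => ?_
  simp_rw [← upper_quot hg]
  refine le_antisymm (le_iInf fun i => ?_) (le_iInf₂ fun j hj => ?_)
  · exact iInf₂_le (f := fun j (_ : j ≥ b) => (rowInf J j - rowInf J (j + n)) / (n : EReal))
      (b + i) (by omega)
  · obtain ⟨i, rfl⟩ : ∃ i : ℕ, j = b + i := ⟨(j - b).toNat, by omega⟩
    exact iInf_le (fun i : ℕ => (rowInf J (b + i) - rowInf J (b + i + n)) / (n : EReal)) i

/-! ### The space `H_J` and the pair `(M_w, M_z)` -/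

/-- The normalized Haar measure on the two-dimensional torus. -/
abbrev torusMeasure : Measure (UnitAddTorus (Fin 2)) :=
  Measure.pi fun _ => AddCircle.haarAddCircle

/-- The Hilbert space `L²(𝕋²)`. -/
abbrev L2Torus : Type := Lp ℂ 2 torusMeasure

/-- The Fourier coefficient of `f ∈ L²(𝕋²)` with index `(i, j)`. -/
def coeffAt (f : L2Torus) (p : ℤ × ℤ) : ℂ :=
  UnitAddTorus.mFourierCoeff f ![p.1, p.2]

lemma coeffAt_eq_repr (f : L2Torus) (p : ℤ × ℤ) :
    coeffAt f p = UnitAddTorus.mFourierBasis.repr f ![p.1, p.2] :=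
  (UnitAddTorus.mFourierBasis_repr f _).symm

/-- `H_J`: the functions in `L²(𝕋²)` whose Fourier coefficients vanish outside `J`. -/
def HJ (J : Set (ℤ × ℤ)) : Submodule ℂ L2Torus where
  carrier := {f | ∀ p ∉ J, coeffAt f p = 0}
  zero_mem' := by
    intro p _
    rw [coeffAt_eq_repr]
    erw [map_zero]
    rfl
  add_mem' := by
    intro f g hf hg p hp
    have h1 := hf p hp
    have h2 := hg p hp
    rw [coeffAt_eq_repr] at h1 h2 ⊢
    erw [map_add]
    erw [lp.coeFn_add, Pi.add_apply, h1, h2, add_zero]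
  smul_mem' := by
    intro c f hf p hp
    have h1 := hf p hp
    rw [coeffAt_eq_repr] at h1 ⊢
    erw [map_smul]
    erw [lp.coeFn_smul, Pi.smul_apply, h1, smul_zero]

/-- Multiplication by the monomial `w^i z^j`, `(i, j) = p`, on `L²(𝕋²)`. -/
def mulMonomial (p : ℤ × ℤ) : L2Torus →L[ℂ] L2Torus :=
  (ContinuousLinearMap.mul ℂ ℂ).holderL torusMeasure ∞ 2 2
    (ContinuousMap.toLp ∞ torusMeasure ℂ (UnitAddTorus.mFourier ![p.1, p.2]))

lemma mulMonomial_coeFn (p : ℤ × ℤ) (f : L2Torus) :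
    (mulMonomial p f : L2Torus) =ᵐ[torusMeasure]
      fun x => UnitAddTorus.mFourier ![p.1, p.2] x * f x := by
  have h1 := ContinuousLinearMap.coeFn_holder (r := 2) (ContinuousLinearMap.mul ℂ ℂ)
    (ContinuousMap.toLp ∞ torusMeasure ℂ (UnitAddTorus.mFourier ![p.1, p.2])) f
  have h2 := ContinuousMap.coeFn_toLp (p := ∞) (𝕜 := ℂ) torusMeasure
    (UnitAddTorus.mFourier ![p.1, p.2])
  filter_upwards [h1, h2] with x hx1 hx2
  rw [← hx2]
  exact hx1

lemma coeffAt_mulMonomial (p q : ℤ × ℤ) (f : L2Torus) :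
    coeffAt (mulMonomial p f) q = coeffAt f (q - p) := by
  refine integral_congr_ae ?_
  filter_upwards [mulMonomial_coeFn p f] with x hx
  simp only [smul_eq_mul]
  rw [hx, ← mul_assoc, ← UnitAddTorus.mFourier_add]
  congr 3
  ext i
  fin_cases i <;> simp <;> ring

lemma mulMonomial_mem {J : Set (ℤ × ℤ)} (hJ : IsDiagram J) (k l : ℕ) (f : L2Torus)
    (hf : f ∈ HJ J) : mulMonomial ((k : ℤ), (l : ℤ)) f ∈ HJ J := by
  intro p hp
  rw [coeffAt_mulMonomial]
  refine hf _ fun h => hp ?_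
  simpa using hJ _ h k l

/-- `M_w ∈ B(H_J)`: multiplication by the first coordinate function. -/
def Mw {J : Set (ℤ × ℤ)} (hJ : IsDiagram J) : HJ J →L[ℂ] HJ J :=
  ((mulMonomial (1, 0)).comp (HJ J).subtypeL).codRestrict (HJ J)
    fun f => by simpa using mulMonomial_mem hJ 1 0 f f.2

/-- `M_z ∈ B(H_J)`: multiplication by the second coordinate function. -/
def Mz {J : Set (ℤ × ℤ)} (hJ : IsDiagram J) : HJ J →L[ℂ] HJ J :=
  ((mulMonomial (0, 1)).comp (HJ J).subtypeL).codRestrict (HJ J)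
    fun f => by simpa using mulMonomial_mem hJ 0 1 f f.2

/-! ### Operator notions -/

section Operators

variable {H : Type*} [NormedAddCommGroup H] [InnerProductSpace ℂ H]

/-- The unitary subspace `⋂ₙ V^n H` in the Wold decomposition of an isometry `V`. -/
def woldUnitary (V : H →L[ℂ] H) : Submodule ℂ H := ⨅ n : ℕ, (V ^ n).range

/-- A unilateral shift (of any multiplicity): an isometry without unitary part. -/
def IsUnilateralShift (V : H →L[ℂ] H) : Prop :=
  Isometry V ∧ woldUnitary V = ⊥

/-- An isometry with non-trivial Wold decomposition: neither the unitary part nor the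
unilateral shift part vanishes. -/
def HasNontrivialWold (V : H →L[ℂ] H) : Prop :=
  Isometry V ∧ woldUnitary V ≠ ⊥ ∧ woldUnitary V ≠ ⊤

/-- `Γ₃(T₁, T₂)`: the pairs `(μ, λ)` with `ran (μ - T₁) + ran (λ - T₂) ≠ H`. -/
def Gamma3 (T₁ T₂ : H →L[ℂ] H) : Set (ℂ × ℂ) :=
  {p | (p.1 • ContinuousLinearMap.id ℂ H - T₁).range ⊔
    (p.2 • ContinuousLinearMap.id ℂ H - T₂).range ≠ ⊤}

end Operators

/-! ### Inequalities between powers with extended exponents -/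

/-- `a ^ q` for `a ∈ [0, 1]`, `q ∈ [0, ∞]`, with `a ^ ∞ = 0` for `a < 1`.
(The values of `0 ^ 0` and `1 ^ ∞` play no role, see `Indeterminate`.) -/
def extPow (a : ℝ) (q : EReal) : ℝ :=
  open Classical in
  if q = ⊤ then (if a < 1 then 0 else 1) else a ^ q.toReal

/-- The symbols `0 ^ 0` and `1 ^ ∞`. -/
def Indeterminate (a : ℝ) (q : EReal) : Prop :=
  (a = 0 ∧ q = 0) ∨ (a = 1 ∧ q = ⊤)

/-- `a ^ q ≤ b ≤ a ^ p`, where an inequality with the symbol `0 ^ 0` or `1 ^ ∞` is regarded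
as satisfied. -/
def PowBetween (a : ℝ) (q : EReal) (b : ℝ) (p : EReal) : Prop :=
  (Indeterminate a q ∨ extPow a q ≤ b) ∧ (Indeterminate a p ∨ b ≤ extPow a p)

/-- `{(μ, λ) ∈ 𝔻̄² : |μ| ^ q ≤ |λ| ≤ |μ| ^ p}`. -/
def annularSet (q p : EReal) : Set (ℂ × ℂ) :=
  {x | ‖x.1‖ ≤ 1 ∧ ‖x.2‖ ≤ 1 ∧ PowBetween ‖x.1‖ q ‖x.2‖ p}

/-- The unit circle `𝕋`. -/
def circ : Set ℂ := Metric.sphere 0 1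

/-- The closed unit disc `𝔻̄`. -/
def disc : Set ℂ := Metric.closedBall 0 1

end DiagramPair

end

noncomputable section

namespace DiagramPair

/-! Let `|μ| < 1`. Then `μ - T₁` is bounded below, so `ran (μ - T₁) + ran (λ - T₂) = H` exactly when
`(λ - T₂)†` is bounded below on `ker (μ - T₁)†`. A vector of this kernel is geometric with ratio
`conj μ` on each row with finite `M_j` and vanishes on full rows (`eq_geomExt`). It is therefore
given by the sequence `c` of its first coefficients, and `T₂†` becomes the weighted backward shift
`(S c)_j = (conj μ)^(M_j - M_{j+1}) c_{j+1}` (`leading_adjoint_snd`). The question is whether `conj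
λ - S` is bounded below on `ℓ²` of the finite rows.

For `μ ≠ 0` and `|λ| = |μ|^t` the formal solution of `S c = conj λ c` has `|c_j| = |μ|^(t j + M_j)`:
it grows upwards where the boundary descends with slope above `t` and decays where the slope is
below `t`. If it grows exponentially on an upper part of the rows and decays on the complementary
lower part, a high power of `S` has weights small against `λ` above and large below, which gives the
bound (`notMem_Gamma3_of_weights`, `notMem_Gamma3_of_slopes`). Conversely, truncating the formal
solution to a window leaves a defect only at the two ends, so the mass of every window is controlled
by its end rows (`window_bound_of_notMem_Gamma3`, `MassBound`). This excludes long level stretches,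
and forces a steep descent to continue geometrically downwards and a steep ascent upwards. Three
patterns survive: growth throughout, decay throughout, or decay below and growth above; this is
`notMem_Gamma3_iff`. Decay at both ends would give an approximate eigenvector.

The other strata use the same two criteria. For `|λ| = 1` or `λ = 0` the answer depends on long
vertical or horizontal pieces of the boundary, which are then expressed by the parameters;
exchanging the coordinates treats `|μ| = 1` and `μ = 0`. At the origin a corner of `J` decides.
Points of the torus `𝕋²` are adjoined on both sides and need no analysis. -/

/-! ### Sums of ranges and adjoints -/

section Ranges

open ContinuousLinearMap
open scoped InnerProductSpace

variable {H : Type*} [NormedAddCommGroup H] [InnerProductSpace ℂ H] [CompleteSpace H]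

/-- If `A` is bounded below and `B†` is bounded below on `ker A†`, then `ran A + ran B = H`. -/
theorem range_sup_range_eq_top_of_adjoint_bound (A B : H →L[ℂ] H) {a e : ℝ} (ha : 0 < a)
    (hA : ∀ x, a * ‖x‖ ≤ ‖A x‖) (he : 0 < e)
    (hB : ∀ x, adjoint A x = 0 → e * ‖x‖ ≤ ‖adjoint B x‖) :
    A.range ⊔ B.range = ⊤ := by
  have hcl : IsClosed (A.range : Set H) := by
    have h1 : AntilipschitzWith a.toNNReal⁻¹ A :=
      AddMonoidHomClass.antilipschitz_of_bound A fun x => by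
        have := hA x
        rw [NNReal.coe_inv, Real.coe_toNNReal _ ha.le, inv_mul_eq_div, le_div_iff₀ ha]
        simpa [mul_comm] using this
    exact h1.isClosed_range A.uniformContinuous
  set K : Submodule ℂ H := A.rangeᗮ with hK
  have hKK : Kᗮ = A.range := by
    rw [hK, Submodule.orthogonal_orthogonal_eq_closure]
    exact hcl.submodule_topologicalClosure_eq
  set P : H →L[ℂ] H := K.starProjection with hP
  -- On `K = (ran A)ᗮ` this is the compression of `B B†`, on `Kᗮ` the identity. The lower bound for
  -- `B†` on `K` makes it coercive, hence invertible.
  set f : H →L[ℂ] H := P ∘L B ∘L adjoint B ∘L P + (1 - P) with hf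
  have hPK : ∀ x, adjoint A (P x) = 0 := fun x => by
    have h1 : P x ∈ K := Submodule.starProjection_apply_mem K x
    rw [hK, ContinuousLinearMap.orthogonal_range] at h1
    simpa using h1
  have hsub : ∀ x, x - P x ∈ A.range := fun x => by
    rw [← hKK]
    exact Submodule.sub_starProjection_mem_orthogonal (K := K) x
  set c : ℝ := min 1 (e ^ 2) with hc
  have hc0 : 0 < c := lt_min one_pos (by positivity)
  have hunit : IsUnit f := by
    refine isUnit_of_forall_le_norm_inner_map f (c := ⟨c, hc0.le⟩) hc0 fun x => ?_
    have h1 : inner ℂ (f x) x = ((‖adjoint B (P x)‖ ^ 2 + ‖x - P x‖ ^ 2 : ℝ) : ℂ) := by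
      have h2 : inner ℂ (P (B (adjoint B (P x)))) x = ((‖adjoint B (P x)‖ ^ 2 : ℝ) : ℂ) := by
        rw [hP, Submodule.inner_starProjection_left_eq_right, ← hP,
          ← ContinuousLinearMap.adjoint_inner_right, inner_self_eq_norm_sq_to_K]
        norm_cast
      have h3 : inner ℂ (x - P x) x = ((‖x - P x‖ ^ 2 : ℝ) : ℂ) := by
        have h4 : inner ℂ (x - P x) (P x) = 0 :=
          Submodule.starProjection_inner_eq_zero (K := K) x _ (Submodule.starProjection_apply_mem K x)
        have h5 : inner ℂ (x - P x) x = inner ℂ (x - P x) (x - P x) := by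
          rw [inner_sub_right, h4, sub_zero]
        rw [h5, inner_self_eq_norm_sq_to_K]
        norm_cast
      have : f x = P (B (adjoint B (P x))) + (x - P x) := by simp [hf]
      rw [this, inner_add_left, h2, h3]
      push_cast
      rfl
    rw [h1, Complex.norm_real, Real.norm_of_nonneg (by positivity)]
    have h6 : ‖x‖ ^ 2 = ‖P x‖ ^ 2 + ‖x - P x‖ ^ 2 := by
      have h4 : inner ℂ (x - P x) (P x) = 0 :=
        Submodule.starProjection_inner_eq_zero (K := K) x _ (Submodule.starProjection_apply_mem K x)
      have h7 := norm_add_sq_eq_norm_sq_add_norm_sq_of_inner_eq_zero (x - P x) (P x) h4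
      rw [sub_add_cancel] at h7
      rw [pow_two, h7]
      ring
    have h8 := hB (P x) (hPK x)
    have h9 : e ^ 2 * ‖P x‖ ^ 2 ≤ ‖adjoint B (P x)‖ ^ 2 := by
      rw [← mul_pow]
      exact pow_le_pow_left₀ (by positivity) h8 2
    have h10 : c * ‖P x‖ ^ 2 ≤ e ^ 2 * ‖P x‖ ^ 2 :=
      mul_le_mul_of_nonneg_right (min_le_right _ _) (by positivity)
    have h11 : c * ‖x - P x‖ ^ 2 ≤ 1 * ‖x - P x‖ ^ 2 :=
      mul_le_mul_of_nonneg_right (min_le_left _ _) (by positivity)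
    show ‖x‖ ^ 2 * c ≤ _
    rw [h6]
    linarith
  rw [eq_top_iff]
  intro y _
  obtain ⟨x, rfl⟩ := (ContinuousLinearMap.isUnit_iff_bijective.1 hunit).2 y
  -- Both terms of the form `y - P y` lie in `Kᗮ = ran A`; the last term lies in `ran B`.
  have h1 : f x = ((x - P x) - (B (adjoint B (P x)) - P (B (adjoint B (P x))))) +
      B (adjoint B (P x)) := by
    simp [hf]
    abel
  rw [h1]
  exact Submodule.add_mem_sup (Submodule.sub_mem _ (hsub _) (hsub _)) ⟨_, rfl⟩

/-- If `ran A + ran B = H`, then `B†` is bounded below on `ker A†`. -/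
theorem exists_adjoint_bound_of_range_sup_range_eq_top (A B : H →L[ℂ] H)
    (h : A.range ⊔ B.range = ⊤) :
    ∃ C > 0, ∀ x, adjoint A x = 0 → ‖x‖ ≤ C * ‖adjoint B x‖ := by
  -- The hypothesis is surjectivity of `(u, v) ↦ A u + B v`; the open mapping theorem then supplies
  -- preimages of controlled norm.
  have hs : Function.Surjective (A.coprod B) := by
    intro y
    have hy : y ∈ A.range ⊔ B.range := h ▸ Submodule.mem_top
    obtain ⟨_, ⟨u, rfl⟩, _, ⟨v, rfl⟩, rfl⟩ := Submodule.mem_sup.1 hy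
    exact ⟨(u, v), by simp⟩
  obtain ⟨C, hC, hb⟩ := ContinuousLinearMap.exists_preimage_norm_le (A.coprod B) hs
  refine ⟨C, hC, fun x hx => ?_⟩
  obtain ⟨⟨u, v⟩, h1, h2⟩ := hb x
  by_cases h0 : ‖x‖ = 0
  · rw [h0]; positivity
  have h3 : ‖v‖ ≤ C * ‖x‖ := (norm_snd_le (u, v)).trans h2
  have h4 : inner ℂ x x = inner ℂ (adjoint B x) v := by
    have h5 : A u + B v = x := by simpa using h1
    calc inner ℂ x x = inner ℂ x (A u + B v) := by rw [h5]
      _ = _ := by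
        rw [inner_add_right, ← ContinuousLinearMap.adjoint_inner_left, hx, inner_zero_left,
          zero_add, ← ContinuousLinearMap.adjoint_inner_left]
  have h5 : ‖x‖ * ‖x‖ ≤ ‖adjoint B x‖ * ‖v‖ := by
    have := norm_inner_le_norm (𝕜 := ℂ) (adjoint B x) v
    rw [← h4, inner_self_eq_norm_sq_to_K] at this
    simpa [pow_two] using this
  have h6 : ‖x‖ * ‖x‖ ≤ (C * ‖adjoint B x‖) * ‖x‖ := by
    calc _ ≤ _ := h5
      _ ≤ ‖adjoint B x‖ * (C * ‖x‖) := by gcongr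
      _ = _ := by ring
  exact le_of_mul_le_mul_right h6 (lt_of_le_of_ne (norm_nonneg _) (Ne.symm h0))

end Ranges

/-! ### Coordinate models of the pair of shifts -/

section Model

open ContinuousLinearMap ComplexConjugate

variable {J : Set (ℤ × ℤ)} {H : Type*} [NormedAddCommGroup H] [InnerProductSpace ℂ H]

/-- `coef` identifies `H` with `ℓ²(J)` in such a way that `T₁` and `T₂` are the two coordinate
shifts. -/
structure IsShiftModel (J : Set (ℤ × ℤ)) (coef : H →ₗ[ℂ] (ℤ × ℤ → ℂ)) (T₁ T₂ : H →L[ℂ] H) :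
    Prop where
  hasSum_inner (x y : H) : HasSum (fun p => conj (coef x p) * coef y p) (inner ℂ x y)
  coef_of_notMem (x : H) {p : ℤ × ℤ} (hp : p ∉ J) : coef x p = 0
  exists_coef_eq (c : ℤ × ℤ → ℂ) (hc : ∀ p ∉ J, c p = 0) (hs : Summable fun p => ‖c p‖ ^ 2) :
    ∃ x, coef x = c
  coef_fst (x : H) (p : ℤ × ℤ) : coef (T₁ x) p = coef x (p.1 - 1, p.2)
  coef_snd (x : H) (p : ℤ × ℤ) : coef (T₂ x) p = coef x (p.1, p.2 - 1)

namespace IsShiftModel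

variable {coef : H →ₗ[ℂ] (ℤ × ℤ → ℂ)} {T₁ T₂ : H →L[ℂ] H}

/-- Exchanging the two coordinates of a model. -/
theorem swap (h : IsShiftModel J coef T₁ T₂) :
    IsShiftModel (Prod.swap ⁻¹' J) ((LinearMap.funLeft ℂ ℂ Prod.swap).comp coef) T₂ T₁ where
  hasSum_inner x y := by
    have := (Equiv.prodComm ℤ ℤ).hasSum_iff.2 (h.hasSum_inner x y)
    exact this
  coef_of_notMem x p hp := h.coef_of_notMem x hp
  exists_coef_eq c hc hs := by
    obtain ⟨x, hx⟩ := h.exists_coef_eq (c ∘ Prod.swap) (fun p hp => hc _ (by simpa using hp))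
      ((Equiv.prodComm ℤ ℤ).summable_iff.2 hs)
    refine ⟨x, ?_⟩
    ext p
    simp [LinearMap.funLeft_apply, hx]
  coef_fst x p := h.coef_snd x p.swap
  coef_snd x p := h.coef_fst x p.swap

theorem hasSum_norm_sq (h : IsShiftModel J coef T₁ T₂) (x : H) :
    HasSum (fun p => ‖coef x p‖ ^ 2) (‖x‖ ^ 2) := by
  have h1 := Complex.hasSum_re (h.hasSum_inner x x)
  have h2 : (inner ℂ x x).re = ‖x‖ ^ 2 := inner_self_eq_norm_sq (𝕜 := ℂ) x
  rw [h2] at h1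
  have h3 : (fun p => ‖coef x p‖ ^ 2) = fun p => (conj (coef x p) * coef x p).re := by
    ext p
    rw [← Complex.normSq_eq_conj_mul_self, Complex.ofReal_re, Complex.normSq_eq_norm_sq]
  rw [h3]
  exact h1

theorem coef_injective (h : IsShiftModel J coef T₁ T₂) : Function.Injective coef := by
  rw [injective_iff_map_eq_zero]
  intro x hx
  have h1 := h.hasSum_norm_sq x
  simp only [hx, Pi.zero_apply, norm_zero, ne_eq, OfNat.ofNat_ne_zero, not_false_eq_true, zero_pow] at h1
  have := h1.unique hasSum_zero
  simpa using this

theorem isometry_fst (h : IsShiftModel J coef T₁ T₂) : Isometry T₁ := by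
  refine AddMonoidHomClass.isometry_of_norm T₁ fun x => ?_
  have h1 := h.hasSum_norm_sq (T₁ x)
  have h2 : HasSum (fun p => ‖coef (T₁ x) p‖ ^ 2) (‖x‖ ^ 2) := by
    have := ((Equiv.subRight (1 : ℤ)).prodCongr (Equiv.refl ℤ)).hasSum_iff.2 (h.hasSum_norm_sq x)
    simp only [h.coef_fst]
    exact this
  have h3 := h1.unique h2
  exact (sq_eq_sq₀ (norm_nonneg _) (norm_nonneg _)).1 h3

theorem coef_fst_pow (h : IsShiftModel J coef T₁ T₂) (n : ℕ) (x : H) (p : ℤ × ℤ) :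
    coef ((T₁ ^ n) x) p = coef x (p.1 - n, p.2) := by
  induction n generalizing x p with
  | zero => simp
  | succ n ih =>
    have e : p.1 - (n : ℤ) - 1 = p.1 - ((n + 1 : ℕ) : ℤ) := by push_cast; ring
    rw [pow_succ, mul_apply_eq_comp, ih, h.coef_fst, e]

/-- The vector with coordinate `1` at `p` and `0` elsewhere. -/
theorem exists_single (h : IsShiftModel J coef T₁ T₂) {p : ℤ × ℤ} (hp : p ∈ J) :
    ∃ x, coef x = Pi.single p 1 := by
  refine h.exists_coef_eq _ (fun q hq => Pi.single_eq_of_ne (by rintro rfl; exact hq hp) _) ?_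
  refine summable_of_ne_finset_zero (s := {p}) fun q hq => ?_
  simp [Pi.single_eq_of_ne (show q ≠ p by simpa using hq)]

theorem inner_single (h : IsShiftModel J coef T₁ T₂) {p : ℤ × ℤ} {x : H}
    (hx : coef x = Pi.single p 1) (y : H) : inner ℂ x y = coef y p := by
  refine (h.hasSum_inner x y).unique ?_
  have := hasSum_single (f := fun q => conj (coef x q) * coef y q) p (fun q hq => by
    simp [hx, Pi.single_eq_of_ne hq])
  simpa [hx] using this

variable [CompleteSpace H]

/-- Pair with the unit vector at `p`, which `T₁ ^ n` carries to the unit vector at `p + (n, 0)`.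
Outside `J` the left side is `0` and the formula may fail. -/
theorem coef_adjoint_fst_pow (h : IsShiftModel J coef T₁ T₂) (n : ℕ) (x : H)
    {p : ℤ × ℤ} (hp : p ∈ J) : coef (adjoint (T₁ ^ n) x) p = coef x (p.1 + n, p.2) := by
  obtain ⟨e, he⟩ := h.exists_single hp
  rw [← h.inner_single he, ContinuousLinearMap.adjoint_inner_right]
  refine h.inner_single (p := (p.1 + n, p.2)) ?_ x
  ext q
  rw [h.coef_fst_pow, he]
  simp only [Pi.single_apply, Prod.ext_iff]
  refine if_congr ?_ rfl rfl
  constructor <;> rintro ⟨h1, h2⟩ <;> exact ⟨by omega, h2⟩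

theorem coef_adjoint_snd_pow (h : IsShiftModel J coef T₁ T₂) (n : ℕ) (x : H)
    {p : ℤ × ℤ} (hp : p ∈ J) : coef (adjoint (T₂ ^ n) x) p = coef x (p.1, p.2 + n) :=
  h.swap.coef_adjoint_fst_pow n x (p := p.swap) hp

/-- The recursion runs along rows and only starts at points of `J`, so on a row with finite `M_j`
the first coefficient is free. -/
theorem adjoint_fst_eq_zero_iff (h : IsShiftModel J coef T₁ T₂) (μ : ℂ) (x : H) :
    adjoint (μ • ContinuousLinearMap.id ℂ H - T₁) x = 0 ↔
      ∀ p ∈ J, coef x (p.1 + 1, p.2) = conj μ * coef x p := by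
  have e : adjoint (μ • ContinuousLinearMap.id ℂ H - T₁) x = conj μ • x - adjoint T₁ x := by
    rw [map_sub, map_smulₛₗ, ContinuousLinearMap.adjoint_id]
    rfl
  have e' : ∀ p ∈ J, coef (conj μ • x - adjoint T₁ x) p =
      conj μ * coef x p - coef x (p.1 + 1, p.2) := fun p hp => by
    have := h.coef_adjoint_fst_pow 1 x hp
    rw [pow_one, Nat.cast_one] at this
    rw [map_sub, map_smul, Pi.sub_apply, this]
    rfl
  rw [e]
  constructor
  · intro h0 p hp
    have := e' p hp
    rw [h0, map_zero, Pi.zero_apply] at this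
    exact (sub_eq_zero.1 this.symm).symm
  · intro h0
    refine h.coef_injective ?_
    ext p
    rw [map_zero]
    by_cases hp : p ∈ J
    · rw [e' p hp, h0 p hp, sub_self]; rfl
    · exact h.coef_of_notMem _ hp

theorem coef_adjoint_snd_sub (h : IsShiftModel J coef T₁ T₂) (l : ℂ) (n : ℕ)
    (x : H) {p : ℤ × ℤ} (hp : p ∈ J) :
    coef (adjoint (l • ContinuousLinearMap.id ℂ H - T₂ ^ n) x) p =
      conj l * coef x p - coef x (p.1, p.2 + n) := by
  have e : adjoint (l • ContinuousLinearMap.id ℂ H - T₂ ^ n) x =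
      conj l • x - adjoint (T₂ ^ n) x := by
    rw [map_sub, map_smulₛₗ, ContinuousLinearMap.adjoint_id]
    rfl
  rw [e, map_sub, map_smul, Pi.sub_apply, h.coef_adjoint_snd_pow n x hp]
  rfl

end IsShiftModel

end Model

/-! ### Rows of a diagram -/

section Rows

variable {J : Set (ℤ × ℤ)}

/-- Row `j` is neither empty nor full; equivalently, `M_j` is finite. -/
def IsFin (J : Set (ℤ × ℤ)) (j : ℤ) : Prop := (∃ i, (i, j) ∈ J) ∧ ∃ i, (i, j) ∉ J

/-- The first element `M_j` of a finite row. -/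
def edge (J : Set (ℤ × ℤ)) (j : ℤ) : ℤ := sInf {i | (i, j) ∈ J}

theorem IsDiagram.mem_of_le (hJ : IsDiagram J) {i j i' j' : ℤ} (h : (i, j) ∈ J) (hi : i ≤ i')
    (hj : j ≤ j') : (i', j') ∈ J := by
  have := hJ _ h (i' - i).toNat (j' - j).toNat
  rwa [Int.toNat_of_nonneg (by omega), Int.toNat_of_nonneg (by omega), add_sub_cancel,
    add_sub_cancel] at this

theorem IsDiagram.swap (hJ : IsDiagram J) : IsDiagram (Prod.swap ⁻¹' J) :=
  fun _ hp k l => hJ _ hp l k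

theorem IsFin.mem_iff (hJ : IsDiagram J) {j : ℤ} (hj : IsFin J j) (i : ℤ) :
    (i, j) ∈ J ↔ edge J j ≤ i := by
  obtain ⟨⟨i₁, h1⟩, i₂, h2⟩ := hj
  have hb : BddBelow {i | (i, j) ∈ J} :=
    ⟨i₂, fun i hi => not_lt.1 fun hlt => h2 (hJ.mem_of_le hi hlt.le le_rfl)⟩
  exact ⟨fun hi => csInf_le hb hi, fun hi => hJ.mem_of_le (Int.csInf_mem ⟨i₁, h1⟩ hb) hi le_rfl⟩

theorem IsFin.edge_mem (hJ : IsDiagram J) {j : ℤ} (hj : IsFin J j) : (edge J j, j) ∈ J :=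
  (hj.mem_iff hJ _).2 le_rfl

theorem IsFin.edge_le (hJ : IsDiagram J) {j k : ℤ} (hj : IsFin J j) (hk : IsFin J k)
    (h : j ≤ k) : edge J k ≤ edge J j :=
  (hk.mem_iff hJ _).1 (hJ.mem_of_le (hj.edge_mem hJ) le_rfl h)

theorem IsFin.of_between (hJ : IsDiagram J) {j k l : ℤ} (hj : IsFin J j) (hl : IsFin J l)
    (h1 : j ≤ k) (h2 : k ≤ l) : IsFin J k := by
  obtain ⟨i, hi⟩ := hl.2
  exact ⟨⟨_, hJ.mem_of_le (hj.edge_mem hJ) le_rfl h1⟩, i, fun h => hi (hJ.mem_of_le h le_rfl h2)⟩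

end Rows

/-! ### Eigenvectors of the adjoint of the first shift, and the weighted shift on their first
coefficients -/

section Leading

open ContinuousLinearMap ComplexConjugate

variable {J : Set (ℤ × ℤ)} {H : Type*} [NormedAddCommGroup H] [InnerProductSpace ℂ H]

open Classical in
/-- The function on `J` that is geometric with ratio `r` on every finite row, with first
coefficients `c`. -/
def geomExt (J : Set (ℤ × ℤ)) (r : ℂ) (c : ℤ → ℂ) (p : ℤ × ℤ) : ℂ :=
  if IsFin J p.2 ∧ edge J p.2 ≤ p.1 then r ^ (p.1 - edge J p.2).toNat * c p.2 else 0

theorem hasSum_geometric_row (m : ℤ) {r : ℝ} (hr0 : 0 ≤ r) (hr : r < 1) (b : ℝ) :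
    HasSum (fun i : ℤ => if m ≤ i then r ^ (i - m).toNat * b else 0) ((1 - r)⁻¹ * b) := by
  have hinj : Function.Injective (fun n : ℕ => m + (n : ℤ)) := fun x y hxy => by
    simpa using hxy
  refine (hinj.hasSum_iff fun i hi => ?_).1 ?_
  · rw [if_neg]
    intro hm
    exact hi ⟨(i - m).toNat, by simp; omega⟩
  · simpa [Function.comp_def] using (hasSum_geometric_of_lt_one hr0 hr).mul_right b

theorem hasSum_geomExt {r : ℂ} (hr : ‖r‖ < 1) {c : ℤ → ℂ} (hc : ∀ j, ¬ IsFin J j → c j = 0) (j : ℤ) :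
    HasSum (fun i => ‖geomExt J r c (i, j)‖ ^ 2) ((1 - ‖r‖ ^ 2)⁻¹ * ‖c j‖ ^ 2) := by
  by_cases hj : IsFin J j
  · have := hasSum_geometric_row (edge J j) (r := ‖r‖ ^ 2) (by positivity)
      (pow_lt_one₀ (norm_nonneg _) hr two_ne_zero) (‖c j‖ ^ 2)
    convert this using 2 with i
    unfold geomExt
    simp only [hj, true_and]
    split_ifs
    · rw [norm_mul, norm_pow, mul_pow, ← pow_mul, ← pow_mul, mul_comm 2]
    · simp
  · simp [geomExt, hj, hc j hj, hasSum_zero]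

theorem summable_geomExt {r : ℂ} (hr : ‖r‖ < 1) {c : ℤ → ℂ} (hc : ∀ j, ¬ IsFin J j → c j = 0)
    (hs : Summable fun j => ‖c j‖ ^ 2) : Summable fun p => ‖geomExt J r c p‖ ^ 2 := by
  rw [← (Equiv.prodComm ℤ ℤ).summable_iff]
  refine (summable_prod_of_nonneg fun _ => sq_nonneg _).2 ⟨fun j => (hasSum_geomExt hr hc j).summable, ?_⟩
  refine (hs.mul_left (1 - ‖r‖ ^ 2)⁻¹).congr fun j => ?_
  exact (hasSum_geomExt hr hc j).tsum_eq.symm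

theorem hasSum_of_hasSum_geomExt {r : ℂ} (hr : ‖r‖ < 1) {c : ℤ → ℂ} (hc : ∀ j, ¬ IsFin J j → c j = 0)
    {S : ℝ} (hs : HasSum (fun p => ‖geomExt J r c p‖ ^ 2) S) :
    HasSum (fun j => ‖c j‖ ^ 2) ((1 - ‖r‖ ^ 2) * S) := by
  have h1 := (Equiv.prodComm ℤ ℤ).hasSum_iff.2 hs
  have h2 := h1.prod_fiberwise (fun j => hasSum_geomExt hr hc j)
  have h3 := h2.mul_left (1 - ‖r‖ ^ 2)
  have h4 : 1 - ‖r‖ ^ 2 ≠ 0 := by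
    have := pow_lt_one₀ (norm_nonneg r) hr two_ne_zero
    linarith
  simpa [← mul_assoc, mul_inv_cancel₀ h4] using h3

open Classical in
/-- The first coefficients of a function on `J`. -/
def leading (J : Set (ℤ × ℤ)) (f : ℤ × ℤ → ℂ) (j : ℤ) : ℂ :=
  if IsFin J j then f (edge J j, j) else 0

open Classical in
/-- The weights of the `n`-th power of the compression of `T₂` to `ker (μ - T₁)†`. -/
def weight (J : Set (ℤ × ℤ)) (r : ℂ) (n : ℕ) (j : ℤ) : ℂ :=
  if IsFin J j ∧ IsFin J (j + n) then r ^ (edge J j - edge J (j + n)).toNat else 0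

theorem leading_geomExt {r : ℂ} {c : ℤ → ℂ} (hc : ∀ j, ¬ IsFin J j → c j = 0) :
    leading J (geomExt J r c) = c := by
  ext j
  by_cases hj : IsFin J j <;> simp [leading, geomExt, hj, hc]

/-- On a finite row the recursion determines everything from the first coefficient. On a full row it
can be run to the left without end, so a coefficient is `r ^ n` times a bounded number for every
`n`, hence zero. -/
theorem eq_geomExt (hJ : IsDiagram J) {r : ℂ} (hr : ‖r‖ < 1) {f : ℤ × ℤ → ℂ}
    (h0 : ∀ p ∉ J, f p = 0) (hs : Summable fun p => ‖f p‖ ^ 2)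
    (hf : ∀ p ∈ J, f (p.1 + 1, p.2) = r * f p) : f = geomExt J r (leading J f) := by
  have hpow : ∀ p ∈ J, ∀ n : ℕ, f (p.1 + n, p.2) = r ^ n * f p := by
    intro p hp n
    induction n with
    | zero => simp
    | succ n ih =>
      have := hf (p.1 + n, p.2) (hJ.mem_of_le hp (by omega) le_rfl)
      rw [ih] at this
      push_cast
      rw [← add_assoc, this, pow_succ]
      ring
  ext ⟨i, j⟩
  by_cases hj : IsFin J j
  · by_cases hi : edge J j ≤ i
    · have := hpow _ (hj.edge_mem hJ) (i - edge J j).toNat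
      simp only [geomExt, leading, hj, hi, and_self, if_true]
      rw [← this, Int.toNat_of_nonneg (by omega), add_sub_cancel]
    · simp only [geomExt, hi, and_false, if_false]
      exact h0 _ fun h => hi ((hj.mem_iff hJ _).1 h)
  · simp only [geomExt, hj, false_and, if_false]
    by_cases hij : (i, j) ∈ J
    · have hfull : ∀ i, (i, j) ∈ J := by
        by_contra! h
        exact hj ⟨⟨i, hij⟩, h⟩
      have hb : ∀ p, ‖f p‖ ≤ √(∑' p, ‖f p‖ ^ 2) := fun p =>
        Real.le_sqrt_of_sq_le (hs.le_tsum p fun _ _ => by positivity)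
      have h1 : ∀ n : ℕ, ‖f (i, j)‖ ≤ ‖r‖ ^ n * √(∑' p, ‖f p‖ ^ 2) := fun n => by
        have := hpow (i - n, j) (hfull _) n
        simp only [sub_add_cancel] at this
        rw [this, norm_mul, norm_pow]
        gcongr
        exact hb _
      have h2 := (tendsto_pow_atTop_nhds_zero_of_lt_one (norm_nonneg r) hr).mul_const
        (√(∑' p, ‖f p‖ ^ 2))
      rw [zero_mul] at h2
      have h3 := ge_of_tendsto' h2 h1
      simpa using h3
    · exact h0 _ hij

namespace IsShiftModel

variable {coef : H →ₗ[ℂ] (ℤ × ℤ → ℂ)} {T₁ T₂ : H →L[ℂ] H}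

/-- Each row is a geometric series of ratio `|μ|²`, so taking first coefficients is isometric up to
the constant `1 - |μ|²`. -/
theorem hasSum_leading (h : IsShiftModel J coef T₁ T₂) (hJ : IsDiagram J) {μ : ℂ} (hμ : ‖μ‖ < 1)
    {x : H} (hx : ∀ p ∈ J, coef x (p.1 + 1, p.2) = conj μ * coef x p) :
    HasSum (fun j => ‖leading J (coef x) j‖ ^ 2) ((1 - ‖μ‖ ^ 2) * ‖x‖ ^ 2) := by
  have hr : ‖conj μ‖ < 1 := by simpa using hμ
  have h1 := h.hasSum_norm_sq x
  rw [eq_geomExt hJ hr (fun p => h.coef_of_notMem x) h1.summable hx] at h1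
  have := hasSum_of_hasSum_geomExt hr (fun j hj => by simp [leading, hj]) h1
  simpa using this

variable [CompleteSpace H]

/-- The eigenspaces of `T₁†` are invariant because moving right and moving up from a point of `J`
commute and stay inside `J`. -/
theorem adjoint_snd_mem (h : IsShiftModel J coef T₁ T₂) (hJ : IsDiagram J) {r l : ℂ} {n : ℕ}
    {x : H} (hx : ∀ p ∈ J, coef x (p.1 + 1, p.2) = r * coef x p) :
    ∀ p ∈ J, coef (adjoint (l • ContinuousLinearMap.id ℂ H - T₂ ^ n) x) (p.1 + 1, p.2) =
      r * coef (adjoint (l • ContinuousLinearMap.id ℂ H - T₂ ^ n) x) p := by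
  intro p hp
  have h1 : (p.1 + 1, p.2) ∈ J := hJ.mem_of_le hp (by omega) le_rfl
  have h2 : (p.1, p.2 + (n : ℤ)) ∈ J := hJ.mem_of_le hp le_rfl (by omega)
  rw [h.coef_adjoint_snd_sub l n x hp, h.coef_adjoint_snd_sub l n x h1, hx p hp]
  have := hx _ h2
  simp only at this ⊢
  rw [this]
  ring

/-- The point above the edge of row `j` in row `j + n` lies `M_j - M_{j+n}` places after the edge of
that row, which produces the power of `conj μ` in `weight`. A full row `j + n` contributes nothing,
as the eigenvector vanishes there. -/
theorem leading_adjoint_snd (h : IsShiftModel J coef T₁ T₂) (hJ : IsDiagram J) {μ l : ℂ} {n : ℕ}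
    (hμ : ‖μ‖ < 1) {x : H} (hx : ∀ p ∈ J, coef x (p.1 + 1, p.2) = conj μ * coef x p) (j : ℤ) :
    leading J (coef (adjoint (l • ContinuousLinearMap.id ℂ H - T₂ ^ n) x)) j =
      conj l * leading J (coef x) j - weight J (conj μ) n j * leading J (coef x) (j + n) := by
  have hr : ‖conj μ‖ < 1 := by simpa using hμ
  have h1 := eq_geomExt hJ hr (fun p => h.coef_of_notMem x) (h.hasSum_norm_sq x).summable hx
  by_cases hj : IsFin J j
  · rw [leading, if_pos hj, h.coef_adjoint_snd_sub l n x (hj.edge_mem hJ)]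
    have h2 : leading J (coef x) j = coef x (edge J j, j) := by simp [leading, hj]
    rw [h2]
    congr 1
    conv_lhs => rw [h1]
    by_cases hjn : IsFin J (j + n)
    · have := hj.edge_le hJ hjn (by omega)
      simp [geomExt, weight, hj, hjn, this]
    · simp [geomExt, weight, hjn]
  · simp [leading, weight, hj]

/-- For `|μ| < 1`, if the weighted shift with weights `weight J (conj μ) n` is far from
`conj l`, then `ran (μ - T₁) + ran (l - T₂ⁿ) = H`. -/
theorem range_sup_range_pow_eq_top (h : IsShiftModel J coef T₁ T₂) (hJ : IsDiagram J) {μ l : ℂ}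
    {n : ℕ} (hμ : ‖μ‖ < 1) {e : ℝ} (he : 0 < e)
    (hb : ∀ c : ℤ → ℂ, (∀ j, ¬ IsFin J j → c j = 0) → (Summable fun j => ‖c j‖ ^ 2) →
      (Summable fun j => ‖conj l * c j - weight J (conj μ) n j * c (j + n)‖ ^ 2) →
      e * ∑' j, ‖c j‖ ^ 2 ≤ ∑' j, ‖conj l * c j - weight J (conj μ) n j * c (j + n)‖ ^ 2) :
    (μ • ContinuousLinearMap.id ℂ H - T₁).range ⊔
      (l • ContinuousLinearMap.id ℂ H - T₂ ^ n).range = ⊤ := by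
  have hμ2 : 0 < 1 - ‖μ‖ ^ 2 := by
    have := pow_lt_one₀ (norm_nonneg μ) hμ two_ne_zero
    linarith
  refine range_sup_range_eq_top_of_adjoint_bound _ _ (a := 1 - ‖μ‖) (e := √e) (by linarith)
    (fun x => ?_) (Real.sqrt_pos.2 he) fun x hx => ?_
  · have h1 : ‖T₁ x‖ = ‖x‖ := h.isometry_fst.norm_map_of_map_zero (map_zero _) x
    have h2 := norm_sub_norm_le (T₁ x) (μ • x)
    rw [h1, norm_smul, ← norm_neg (T₁ x - μ • x), neg_sub] at h2
    calc (1 - ‖μ‖) * ‖x‖ = ‖x‖ - ‖μ‖ * ‖x‖ := by ring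
      _ ≤ _ := h2
  · rw [h.adjoint_fst_eq_zero_iff] at hx
    have h1 := h.hasSum_leading hJ hμ hx
    have h2 := h.hasSum_leading hJ hμ (h.adjoint_snd_mem hJ (l := l) (n := n) hx)
    simp only [h.leading_adjoint_snd hJ hμ hx] at h2
    have h3 := hb _ (fun j hj => by simp [leading, hj]) h1.summable h2.summable
    rw [h1.tsum_eq, h2.tsum_eq] at h3
    have h4 : e * ‖x‖ ^ 2 ≤ ‖adjoint (l • ContinuousLinearMap.id ℂ H - T₂ ^ n) x‖ ^ 2 := by
      refine le_of_mul_le_mul_left ?_ hμ2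
      linarith
    refine (sq_le_sq₀ (by positivity) (norm_nonneg _)).1 ?_
    rwa [mul_pow, Real.sq_sqrt he.le]

/-- The converse direction to `range_sup_range_pow_eq_top` for `n = 1`: every admissible `c` comes
from an eigenvector by `geomExt`, and the factor `1 - |μ|²` occurs on both sides. -/
theorem weighted_shift_bound (h : IsShiftModel J coef T₁ T₂) (hJ : IsDiagram J) {μ l : ℂ}
    (hμ : ‖μ‖ < 1) (hG : (μ, l) ∉ Gamma3 T₁ T₂) :
    ∃ C > 0, ∀ c : ℤ → ℂ, (∀ j, ¬ IsFin J j → c j = 0) → (Summable fun j => ‖c j‖ ^ 2) →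
      ∑' j, ‖c j‖ ^ 2 ≤ C * ∑' j, ‖conj l * c j - weight J (conj μ) 1 j * c (j + 1)‖ ^ 2 := by
  simp only [Gamma3, Set.mem_ofPred_eq, not_not] at hG
  obtain ⟨C, hC, hb⟩ := exists_adjoint_bound_of_range_sup_range_eq_top _ _ hG
  refine ⟨C ^ 2, by positivity, fun c hc hs => ?_⟩
  have hr : ‖conj μ‖ < 1 := by simpa using hμ
  have hμ2 : 0 < 1 - ‖μ‖ ^ 2 := by
    have := pow_lt_one₀ (norm_nonneg μ) hμ two_ne_zero
    linarith
  obtain ⟨x, hx⟩ := h.exists_coef_eq (geomExt J (conj μ) c) (fun p hp => by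
    rw [geomExt, if_neg]
    rintro ⟨h1, h2⟩
    exact hp ((h1.mem_iff hJ _).2 h2)) (summable_geomExt hr hc hs)
  have hx1 : ∀ p ∈ J, coef x (p.1 + 1, p.2) = conj μ * coef x p := by
    intro p hp
    rw [hx]
    by_cases hj : IsFin J p.2
    · have h1 := (hj.mem_iff hJ p.1).1 hp
      simp only [geomExt, hj, h1, true_and, if_true, if_pos (show edge J p.2 ≤ p.1 + 1 by omega)]
      rw [show (p.1 + 1 - edge J p.2).toNat = (p.1 - edge J p.2).toNat + 1 by omega, pow_succ]
      ring
    · simp [geomExt, hj]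
  have h1 := h.hasSum_leading hJ hμ hx1
  have h2 := h.hasSum_leading hJ hμ (h.adjoint_snd_mem hJ (l := l) (n := 1) hx1)
  simp only [h.leading_adjoint_snd hJ hμ hx1] at h2
  rw [hx, leading_geomExt hc] at h1 h2
  have h3 := hb x ((h.adjoint_fst_eq_zero_iff _ _).2 hx1)
  rw [Nat.cast_one] at h2
  rw [pow_one] at h2
  rw [h1.tsum_eq, h2.tsum_eq]
  have h4 := pow_le_pow_left₀ (norm_nonneg _) h3 2
  rw [mul_pow] at h4
  calc (1 - ‖μ‖ ^ 2) * ‖x‖ ^ 2 ≤ (1 - ‖μ‖ ^ 2) * _ := mul_le_mul_of_nonneg_left h4 hμ2.le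
    _ = _ := by ring

end IsShiftModel

end Leading

/-! ### Weighted shifts on `ℓ²(ℤ)` -/

section WeightedShift

open Classical in
/-- If on a set `F` stable under `j ↦ j + n` the weights are small compared with `|l|`, then
`l - S` is bounded below there. -/
theorem sum_indicator_forward {c w : ℤ → ℂ} {l : ℂ} {n : ℕ} {F : Set ℤ}
    (hF : ∀ j ∈ F, j + n ∈ F) (hw : ∀ j ∈ F, ‖w j‖ ≤ ‖l‖ / 2)
    (hc : Summable fun j => ‖c j‖ ^ 2) (hd : Summable fun j => ‖l * c j - w j * c (j + n)‖ ^ 2) :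
    ‖l‖ ^ 2 * ∑' j, F.indicator (fun j => ‖c j‖ ^ 2) j ≤
      4 * ∑' j, ‖l * c j - w j * c (j + n)‖ ^ 2 := by
  set d := fun j => l * c j - w j * c (j + n) with hd'
  set a := F.indicator (fun j => ‖c j‖ ^ 2) with ha
  have ha0 : ∀ j, 0 ≤ a j := fun j => Set.indicator_nonneg (fun _ _ => by positivity) _
  have has : Summable a := hc.indicator F
  have has' : Summable fun j => a (j + n) := has.comp_injective (add_left_injective (n : ℤ))
  have hshift : ∑' j, a (j + n) = ∑' j, a j := (Equiv.addRight (n : ℤ)).tsum_eq a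
  -- From `(u + v)² ≤ 2u² + 2v²` with `u ≤ ‖l‖ / 2 * ‖c (j + n)‖`. Summation is invariant under the
  -- shift by `n`, so half of the left side absorbs the first term.
  have key : ∀ j, ‖l‖ ^ 2 * a j ≤ ‖l‖ ^ 2 / 2 * a (j + n) + 2 * ‖d j‖ ^ 2 := by
    intro j
    by_cases hj : j ∈ F
    · simp only [ha, Set.indicator_of_mem hj, Set.indicator_of_mem (hF j hj)]
      have h1 : l * c j = w j * c (j + n) + d j := by simp [hd']
      have h2 : ‖l‖ * ‖c j‖ ≤ ‖l‖ / 2 * ‖c (j + n)‖ + ‖d j‖ := by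
        rw [← norm_mul, h1]
        refine (norm_add_le _ _).trans ?_
        rw [norm_mul]
        gcongr
        exact hw j hj
      have h3 := pow_le_pow_left₀ (by positivity) h2 2
      have h4 := sq_nonneg (‖l‖ / 2 * ‖c (j + n)‖ - ‖d j‖)
      nlinarith
    · simp only [ha, Set.indicator_of_notMem hj, mul_zero]
      have := ha0 (j + n)
      positivity
  have h1 := (has.mul_left (‖l‖ ^ 2)).tsum_le_tsum key ((has'.mul_left _).add (hd.mul_left 2))
  rw [(has'.mul_left _).tsum_add (hd.mul_left 2), tsum_mul_left, tsum_mul_left, tsum_mul_left,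
    hshift] at h1
  linarith

open Classical in
/-- If on a set `B` stable under `k ↦ k - n` the weights are large compared with `|l|`, then
`l - S` is bounded below there. -/
theorem sum_indicator_backward {c w : ℤ → ℂ} {l : ℂ} {n : ℕ} {B : Set ℤ} {D : ℝ} (hD : 0 ≤ D)
    (hB : ∀ k ∈ B, k - n ∈ B) (hw : ∀ k ∈ B, c k ≠ 0 → 1 ≤ D * ‖w (k - n)‖)
    (hl : D * ‖l‖ ≤ 1 / 2)
    (hc : Summable fun j => ‖c j‖ ^ 2) (hd : Summable fun j => ‖l * c j - w j * c (j + n)‖ ^ 2) :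
    ∑' j, B.indicator (fun j => ‖c j‖ ^ 2) j ≤
      4 * D ^ 2 * ∑' j, ‖l * c j - w j * c (j + n)‖ ^ 2 := by
  set d := fun j => l * c j - w j * c (j + n) with hd'
  set a := B.indicator (fun j => ‖c j‖ ^ 2) with ha
  have ha0 : ∀ j, 0 ≤ a j := fun j => Set.indicator_nonneg (fun _ _ => by positivity) _
  have has : Summable a := hc.indicator B
  have has' : Summable fun j => a (j - n) := has.comp_injective (sub_left_injective (b := (n : ℤ)))
  have hds' : Summable fun j : ℤ => ‖d (j - n)‖ ^ 2 :=
    hd.comp_injective (sub_left_injective (b := (n : ℤ)))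
  have hshift : ∑' j, a (j - n) = ∑' j, a j := (Equiv.subRight (n : ℤ)).tsum_eq a
  have hshift' : ∑' j : ℤ, ‖d (j - n)‖ ^ 2 = ∑' j, ‖d j‖ ^ 2 :=
    (Equiv.subRight (n : ℤ)).tsum_eq fun j => ‖d j‖ ^ 2
  -- Here the equation is solved for `c k` instead of `c (k - n)`, dividing by the large weight; the
  -- shifted term is again absorbed after summation.
  have key : ∀ k, a k ≤ 1 / 2 * a (k - n) + 2 * D ^ 2 * ‖d (k - n)‖ ^ 2 := by
    intro k
    by_cases hk : k ∈ B
    · simp only [ha, Set.indicator_of_mem hk, Set.indicator_of_mem (hB k hk)]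
      by_cases hck : c k = 0
      · rw [hck, norm_zero, zero_pow two_ne_zero]
        positivity
      have h1 : w (k - n) * c k = l * c (k - n) - d (k - n) := by simp [hd']
      have h2 : ‖w (k - n)‖ * ‖c k‖ ≤ ‖l‖ * ‖c (k - n)‖ + ‖d (k - n)‖ := by
        rw [← norm_mul, h1, ← norm_mul]
        exact norm_sub_le _ _
      have h3 : ‖c k‖ ≤ 1 / 2 * ‖c (k - n)‖ + D * ‖d (k - n)‖ := by
        calc ‖c k‖ ≤ D * ‖w (k - n)‖ * ‖c k‖ :=
              le_mul_of_one_le_left (norm_nonneg _) (hw k hk hck)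
          _ = D * (‖w (k - n)‖ * ‖c k‖) := by ring
          _ ≤ D * (‖l‖ * ‖c (k - n)‖ + ‖d (k - n)‖) := by gcongr
          _ = D * ‖l‖ * ‖c (k - n)‖ + D * ‖d (k - n)‖ := by ring
          _ ≤ _ := by gcongr
      have h4 := pow_le_pow_left₀ (norm_nonneg _) h3 2
      have h5 := sq_nonneg (1 / 2 * ‖c (k - n)‖ - D * ‖d (k - n)‖)
      nlinarith
    · simp only [ha, Set.indicator_of_notMem hk]
      have := ha0 (k - n)
      positivity
  have h1 := has.tsum_le_tsum key ((has'.mul_left _).add (hds'.mul_left _))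
  rw [(has'.mul_left _).tsum_add (hds'.mul_left _), tsum_mul_left, tsum_mul_left,
    hshift, hshift'] at h1
  linarith

end WeightedShift

/-! ### Points outside and inside `Γ₃` -/

section Gamma

open ContinuousLinearMap ComplexConjugate

variable {J : Set (ℤ × ℤ)} {H : Type*} [NormedAddCommGroup H] [InnerProductSpace ℂ H]
  {coef : H →ₗ[ℂ] (ℤ × ℤ → ℂ)} {T₁ T₂ : H →L[ℂ] H}

theorem Gamma3_swap (T₁ T₂ : H →L[ℂ] H) (μ l : ℂ) :
    (μ, l) ∈ Gamma3 T₁ T₂ ↔ (l, μ) ∈ Gamma3 T₂ T₁ := by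
  simp only [Gamma3, Set.mem_ofPred_eq, sup_comm]

/-- `l - T` is a left factor of `l ^ n - T ^ n`. Hence it suffices to treat a power of `T₂`, whose
weights are products of `n` consecutive weights and show the average slope. -/
theorem range_sub_pow_le (T : H →L[ℂ] H) (l : ℂ) (n : ℕ) :
    (l ^ n • ContinuousLinearMap.id ℂ H - T ^ n).range ≤
      (l • ContinuousLinearMap.id ℂ H - T).range := by
  have h1 : Commute (l • (1 : H →L[ℂ] H)) T := (Commute.one_left T).smul_left l
  have h2 := h1.mul_geom_sum₂ n
  rw [smul_pow, one_pow] at h2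
  rintro _ ⟨x, rfl⟩
  refine ⟨(∑ i ∈ Finset.range n, (l • (1 : H →L[ℂ] H)) ^ i * T ^ (n - 1 - i)) x, ?_⟩
  exact congrArg (fun f : H →L[ℂ] H => f x) h2

variable [CompleteSpace H]

theorem notMem_Gamma3_of_norm_gt (h : IsShiftModel J coef T₁ T₂) {μ l : ℂ} (hμ : 1 < ‖μ‖) :
    (μ, l) ∉ Gamma3 T₁ T₂ := by
  simp only [Gamma3, Set.mem_ofPred_eq, not_not]
  have h1 : ‖T₁‖ < ‖μ‖ := lt_of_le_of_lt
    (T₁.opNorm_le_bound zero_le_one fun x => by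
      rw [h.isometry_fst.norm_map_of_map_zero (map_zero _) x, one_mul]) hμ
  have h2 : IsUnit (μ • ContinuousLinearMap.id ℂ H - T₁) := by
    by_contra h3
    have h4 : μ ∈ spectrum ℂ T₁ := by
      rw [spectrum.mem_iff, Algebra.algebraMap_eq_smul_one]
      exact h3
    cases subsingleton_or_nontrivial H
    · exact h3 (isUnit_of_subsingleton _)
    · exact absurd (spectrum.norm_le_norm_of_mem h4) (not_le.2 h1)
  have h3 := (ContinuousLinearMap.isUnit_iff_bijective.1 h2).2
  rw [eq_top_iff]
  refine le_trans ?_ le_sup_left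
  rintro y -
  exact h3 y

/-- A criterion for `(μ, l) ∉ Γ₃`, `|μ| < 1`. -/
theorem notMem_Gamma3_of_weights (h : IsShiftModel J coef T₁ T₂) (hJ : IsDiagram J) {μ l : ℂ}
    (hμ : ‖μ‖ < 1) (n : ℕ) (F B : Set ℤ) (hFB : ∀ j, IsFin J j → j ∈ F ∨ j ∈ B)
    (hF : ∀ j ∈ F, j + n ∈ F) (hB : ∀ j ∈ B, j - n ∈ B) {D : ℝ} (hD : 0 < D)
    (hl : F.Nonempty → l ≠ 0)
    (hwF : ∀ j ∈ F, IsFin J j → IsFin J (j + n) →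
      ‖μ‖ ^ (edge J j - edge J (j + n)).toNat ≤ ‖l‖ ^ n / 2)
    (hwB : ∀ j ∈ B, IsFin J j → IsFin J (j - n) ∧
      1 ≤ D * ‖μ‖ ^ (edge J (j - n) - edge J j).toNat)
    (hlB : D * ‖l‖ ^ n ≤ 1 / 2) : (μ, l) ∉ Gamma3 T₁ T₂ := by
  simp only [Gamma3, Set.mem_ofPred_eq, not_not]
  rw [eq_top_iff]
  have hl' : ‖conj (l ^ n)‖ = ‖l‖ ^ n := by simp
  refine le_trans (ge_of_eq ?_) (sup_le_sup_left (range_sub_pow_le T₂ l n) _)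
  -- The sum of the constants from the backward estimate on `B` and the forward estimate on `F`. If
  -- `F` is empty, `l = 0` is allowed and the second term is not used.
  set Q : ℝ := 4 * D ^ 2 + 4 * ((‖l‖ ^ n) ^ 2)⁻¹ with hQ
  have hQ0 : 0 < Q := by positivity
  refine h.range_sup_range_pow_eq_top hJ hμ (e := Q⁻¹) (by positivity) fun c hc hs hd => ?_
  rw [inv_mul_le_iff₀ hQ0]
  set Y := ∑' j, ‖conj (l ^ n) * c j - weight J (conj μ) n j * c (j + n)‖ ^ 2 with hY
  have hY0 : 0 ≤ Y := tsum_nonneg fun _ => by positivity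
  have h1 : ∑' j, F.indicator (fun j => ‖c j‖ ^ 2) j ≤ 4 * ((‖l‖ ^ n) ^ 2)⁻¹ * Y := by
    rcases F.eq_empty_or_nonempty with rfl | hne
    · simp only [Set.indicator_empty, tsum_zero]
      positivity
    · have hl0 : 0 < (‖l‖ ^ n) ^ 2 := by have := norm_pos_iff.2 (hl hne); positivity
      have := sum_indicator_forward (w := weight J (conj μ) n) (l := conj (l ^ n)) hF
        (fun j hj => by
          rw [hl', weight]
          split_ifs with hj2
          · simpa using hwF j hj hj2.1 hj2.2
          · simp only [norm_zero]; positivity) hs hd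
      rw [hl', ← hY] at this
      rw [mul_assoc, ← mul_le_mul_iff_right₀ hl0]
      calc _ ≤ _ := this
        _ = ((‖l‖ ^ n) ^ 2 * ((‖l‖ ^ n) ^ 2)⁻¹) * (4 * Y) := by
          rw [mul_inv_cancel₀ hl0.ne', one_mul]
        _ = _ := by ring
  have h2 : ∑' j, B.indicator (fun j => ‖c j‖ ^ 2) j ≤ 4 * D ^ 2 * Y :=
    sum_indicator_backward (w := weight J (conj μ) n) (l := conj (l ^ n)) hD.le hB
      (fun k hk hck => by
        have hk1 : IsFin J k := by
          by_contra h0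
          exact hck (hc k h0)
        have := hwB k hk hk1
        simpa [weight, hk1, this.1] using this.2) (by rw [hl']; exact hlB) hs hd
  have h3 : ∀ j, ‖c j‖ ^ 2 ≤ F.indicator (fun j => ‖c j‖ ^ 2) j + B.indicator (fun j => ‖c j‖ ^ 2) j := by
    intro j
    have h4 : 0 ≤ F.indicator (fun j => ‖c j‖ ^ 2) j :=
      Set.indicator_nonneg (fun _ _ => by positivity) _
    have h5 : 0 ≤ B.indicator (fun j => ‖c j‖ ^ 2) j :=
      Set.indicator_nonneg (fun _ _ => by positivity) _
    by_cases hj : IsFin J j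
    · rcases hFB j hj with hj | hj
      · have := Set.indicator_of_mem hj (fun j => ‖c j‖ ^ 2)
        linarith
      · have := Set.indicator_of_mem hj (fun j => ‖c j‖ ^ 2)
        linarith
    · rw [hc j hj, norm_zero, zero_pow two_ne_zero]
      positivity
  have h4 := hs.tsum_le_tsum h3 ((hs.indicator F).add (hs.indicator B))
  rw [(hs.indicator F).tsum_add (hs.indicator B)] at h4
  calc _ ≤ _ := h4
    _ ≤ 4 * ((‖l‖ ^ n) ^ 2)⁻¹ * Y + 4 * D ^ 2 * Y := add_le_add h1 h2
    _ = Q * Y := by rw [hQ]; ring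

open Classical in
/-- The necessary condition for `(μ, l) ∉ Γ₃`, `|μ| < 1`, obtained by testing on windows. -/
theorem window_bound_of_notMem_Gamma3 (h : IsShiftModel J coef T₁ T₂) (hJ : IsDiagram J) {μ l : ℂ}
    (hμ : ‖μ‖ < 1) (hG : (μ, l) ∉ Gamma3 T₁ T₂) :
    ∃ C > 0, ∀ p q, p ≤ q → IsFin J p → IsFin J q →
      ∑ j ∈ Finset.Icc p q, ‖l‖ ^ (2 * (j - p).toNat) * ‖μ‖ ^ (2 * (edge J j - edge J q).toNat) ≤
        C * ((if IsFin J (p - 1) then ‖μ‖ ^ (2 * (edge J (p - 1) - edge J q).toNat) else 0) +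
          ‖l‖ ^ (2 * (q - p + 1).toNat)) := by
  obtain ⟨C, hC, hb⟩ := h.weighted_shift_bound hJ hμ hG
  refine ⟨C, hC, fun p q hpq hp hq => ?_⟩
  have hfin : ∀ j, p ≤ j → j ≤ q → IsFin J j := fun j h1 h2 => hp.of_between hJ hq h1 h2
  -- The formal eigenvector cut off to the window, scaled so that both exponents are non-negative;
  -- this keeps `μ = 0` and `l = 0` admissible.
  set c : ℤ → ℂ := fun j => if p ≤ j ∧ j ≤ q then
    conj l ^ (j - p).toNat * conj μ ^ (edge J j - edge J q).toNat else 0 with hc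
  have hc0 : ∀ j ∉ Finset.Icc p q, c j = 0 := fun j hj => by
    rw [Finset.mem_Icc] at hj
    simp only [hc, if_neg hj]
  have h1 := hb c (fun j hj => hc0 j fun hj' => hj (by
      rw [Finset.mem_Icc] at hj'
      exact hfin j hj'.1 hj'.2))
    (summable_of_ne_finset_zero (s := Finset.Icc p q) fun j hj => by rw [hc0 j hj]; simp)
  have h2 : ∑' j, ‖c j‖ ^ 2 = ∑ j ∈ Finset.Icc p q,
      ‖l‖ ^ (2 * (j - p).toNat) * ‖μ‖ ^ (2 * (edge J j - edge J q).toNat) := by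
    rw [tsum_eq_sum (s := Finset.Icc p q) fun j hj => by rw [hc0 j hj]; simp]
    refine Finset.sum_congr rfl fun j hj => ?_
    rw [Finset.mem_Icc] at hj
    simp only [hc, if_pos hj, norm_mul, norm_pow, RCLike.norm_conj, mul_pow]
    ring
  set d : ℤ → ℂ := fun j => conj l * c j - weight J (conj μ) 1 j * c (j + 1) with hd
  -- Inside the window the eigenvalue equation holds exactly, so the defect lives at `q`, where the
  -- successor is cut off, and at `p - 1`, whose successor is the first row kept.
  have h3 : ∀ j ∉ ({p - 1, q} : Finset ℤ), d j = 0 := by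
    intro j hj
    simp only [Finset.mem_insert, Finset.mem_singleton, not_or] at hj
    by_cases h4 : p ≤ j ∧ j ≤ q
    · have h5 : p ≤ j + 1 ∧ j + 1 ≤ q := by omega
      have f1 := hfin j h4.1 h4.2
      have f2 := hfin (j + 1) h5.1 h5.2
      have e1 := f1.edge_le hJ f2 (by omega)
      have e2 := f2.edge_le hJ hq (by omega)
      simp only [hd, hc, if_pos h4, if_pos h5, weight, Nat.cast_one, f1, f2, and_self, if_true]
      rw [show (j + 1 - p).toNat = (j - p).toNat + 1 by omega,
        show (edge J j - edge J q).toNat = (edge J j - edge J (j + 1)).toNat +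
          (edge J (j + 1) - edge J q).toNat by omega]
      ring
    · have h5 : ¬ (p ≤ j + 1 ∧ j + 1 ≤ q) := by omega
      simp only [hd, hc, if_neg h4, if_neg h5, mul_zero, sub_zero]
  have h4 : ∑' j, ‖d j‖ ^ 2 = (if IsFin J (p - 1) then
      ‖μ‖ ^ (2 * (edge J (p - 1) - edge J q).toNat) else 0) + ‖l‖ ^ (2 * (q - p + 1).toNat) := by
    rw [tsum_eq_sum (s := {p - 1, q}) fun j hj => by rw [h3 j hj]; simp,
      Finset.sum_pair (by omega)]
    congr 1
    · have h5 : ¬ (p ≤ p - 1 ∧ p - 1 ≤ q) := by omega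
      have h6 : p ≤ p ∧ p ≤ q := by omega
      simp only [hd, hc, if_neg h5, weight, Nat.cast_one, sub_add_cancel, if_pos h6, hp, and_true,
        sub_self, Int.toNat_zero, pow_zero, one_mul, mul_zero, zero_sub, norm_neg]
      split_ifs with f1
      · have e1 := f1.edge_le hJ hp (by omega)
        have e2 := hp.edge_le hJ hq hpq
        rw [← pow_add, norm_pow, RCLike.norm_conj, ← pow_mul, mul_comm 2]
        congr 2
        omega
      · simp
    · have h5 : p ≤ q ∧ q ≤ q := by omega
      have h6 : ¬ (p ≤ q + 1 ∧ q + 1 ≤ q) := by omega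
      simp only [hd, hc, if_pos h5, if_neg h6, mul_zero, sub_zero, sub_self, Int.toNat_zero,
        pow_zero, mul_one]
      rw [← pow_succ', norm_pow, RCLike.norm_conj, ← pow_mul, mul_comm 2]
      congr 2
      omega
  rw [h2] at h1
  rw [← h4]
  exact h1

end Gamma

/-! ### Flat pieces of the boundary of a diagram -/

/-- The boundary of `J` contains arbitrarily long vertical segments. -/
def HasLongVertical (J : Set (ℤ × ℤ)) : Prop :=
  ∀ n : ℕ, ∃ i j : ℤ, (i, j) ∈ J ∧ (i - 1, j + n) ∉ J

/-- The boundary of `J` contains arbitrarily long horizontal segments. -/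
def HasLongHorizontal (J : Set (ℤ × ℤ)) : Prop :=
  ∀ n : ℕ, ∃ i j : ℤ, (i, j) ∈ J ∧ (i + n, j - 1) ∉ J

/-- The boundary of `J` contains arbitrarily long vertical segments along columns that are not
full. -/
def HasLongVerticalEnd (J : Set (ℤ × ℤ)) : Prop :=
  ∀ n : ℕ, ∃ i j : ℤ, (i, j) ∈ J ∧ (i - 1, j + n) ∉ J ∧ ∃ j', (i, j') ∉ J

/-- The boundary of `J` contains arbitrarily long horizontal segments along rows that are not
full. -/
def HasLongHorizontalEnd (J : Set (ℤ × ℤ)) : Prop :=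
  ∀ n : ℕ, ∃ i j : ℤ, (i, j) ∈ J ∧ (i + n, j - 1) ∉ J ∧ ∃ i', (i', j) ∉ J

/-! ### Boundary strata of the bidisc and the origin -/

section Points

variable {J : Set (ℤ × ℤ)}

theorem hasLongVertical_swap : HasLongVertical (Prod.swap ⁻¹' J) ↔ HasLongHorizontal J := by
  refine forall_congr' fun n => ?_
  constructor <;> rintro ⟨i, j, h1, h2⟩ <;> exact ⟨j, i, h1, h2⟩

theorem hasLongHorizontalEnd_swap :
    HasLongHorizontalEnd (Prod.swap ⁻¹' J) ↔ HasLongVerticalEnd J := by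
  refine forall_congr' fun n => ?_
  constructor <;> rintro ⟨i, j, h1, h2, h3⟩ <;> exact ⟨j, i, h1, h2, h3⟩

namespace IsShiftModel

variable {H : Type*} [NormedAddCommGroup H] [InnerProductSpace ℂ H] [CompleteSpace H]
  {coef : H →ₗ[ℂ] (ℤ × ℤ → ℂ)} {T₁ T₂ : H →L[ℂ] H}

-- All weights have modulus at most `1 = |l|`. If vertical segments are shorter than some `N`, the
-- edge moves left by `k` within `k * N` rows and the weight drops to `|μ| ^ k ≤ 1 / 2`. Along a
-- segment of length `n` the test vector has modulus `1` on `n + 1` rows, while its defect stays at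
-- most `2`.
open Classical in
theorem mem_Gamma3_iff_of_norm_snd_eq_one (h : IsShiftModel J coef T₁ T₂) (hJ : IsDiagram J)
    {μ l : ℂ} (hμ : ‖μ‖ < 1) (hl : ‖l‖ = 1) : (μ, l) ∈ Gamma3 T₁ T₂ ↔ HasLongVertical J := by
  constructor
  · contrapose
    intro hV
    simp only [HasLongVertical] at hV
    push Not at hV
    obtain ⟨N, hN⟩ := hV
    have hk : ∀ k : ℕ, ∀ i j : ℤ, (i, j) ∈ J → (i - k, j + k * N) ∈ J := by
      intro k
      induction k with
      | zero => intro i j hij; simpa using hij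
      | succ k ih =>
        intro i j hij
        have := hN _ _ (ih i j hij)
        convert this using 2 <;> push_cast <;> ring
    obtain ⟨k, hk2⟩ := exists_pow_lt_of_lt_one (show (0 : ℝ) < 1 / 2 by norm_num) hμ
    refine notMem_Gamma3_of_weights h hJ hμ (k * N) Set.univ ∅ (fun j _ => Or.inl trivial)
      (fun _ _ => trivial) (fun _ hj => hj.elim) (D := 1 / 2) (by norm_num)
      (fun _ => norm_pos_iff.1 (by rw [hl]; norm_num)) (fun j _ h1 h2 => ?_)
      (fun _ hj => hj.elim) (by rw [hl]; norm_num)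
    rw [hl, one_pow]
    refine le_trans (pow_le_pow_of_le_one (norm_nonneg _) hμ.le (m := k) ?_) hk2.le
    have h3 := hk k _ _ (h1.edge_mem hJ)
    have h4 := (h2.mem_iff hJ (edge J j - k)).1 (by push_cast; exact h3)
    omega
  · intro hV
    by_contra hG
    obtain ⟨C, hC, hb⟩ := window_bound_of_notMem_Gamma3 h hJ hμ hG
    obtain ⟨n, hn⟩ := exists_nat_gt (2 * C)
    obtain ⟨i, j, h1, h2⟩ := hV n
    have hj : IsFin J j := ⟨⟨i, h1⟩, i - 1, fun h3 => h2 (hJ.mem_of_le h3 le_rfl (by omega))⟩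
    have hjn : IsFin J (j + n) := ⟨⟨i, hJ.mem_of_le h1 le_rfl (by omega)⟩, i - 1, h2⟩
    have e1 := (hj.mem_iff hJ i).1 h1
    have e2 : i - 1 < edge J (j + n) := not_le.1 fun h3 => h2 ((hjn.mem_iff hJ _).2 h3)
    have h3 := hb j (j + n) (by omega) hj hjn
    have h4 : ∀ k ∈ Finset.Icc j (j + n),
        ‖l‖ ^ (2 * (k - j).toNat) * ‖μ‖ ^ (2 * (edge J k - edge J (j + n)).toNat) = 1 := by
      intro k hk
      rw [Finset.mem_Icc] at hk
      have hkf := hj.of_between hJ hjn hk.1 hk.2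
      have e3 := hj.edge_le hJ hkf hk.1
      rw [show (edge J k - edge J (j + n)).toNat = 0 by omega, hl]
      simp
    rw [Finset.sum_congr rfl h4, Finset.sum_const, Int.card_Icc, hl, one_pow] at h3
    have h5 : (if IsFin J (j - 1) then ‖μ‖ ^ (2 * (edge J (j - 1) - edge J (j + n)).toNat) else 0)
        ≤ 1 := by
      split_ifs
      · exact pow_le_one₀ (norm_nonneg _) hμ.le
      · norm_num
    have h6 : (j + n + 1 - j).toNat = n + 1 := by omega
    rw [h6] at h3
    simp only [nsmul_eq_mul, mul_one] at h3
    push_cast at h3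
    nlinarith

-- For `l = 0` only the weighted shift itself remains, which is bounded below exactly when the
-- weights leading into finite rows are bounded away from `0`, that is, when the jumps `M_{j-1} -
-- M_j` are bounded. Full rows carry no coefficient, hence the restricted notion of long horizontal
-- segment.
open Classical in
theorem mem_Gamma3_snd_zero_iff (h : IsShiftModel J coef T₁ T₂) (hJ : IsDiagram J)
    {μ : ℂ} (hμ0 : μ ≠ 0) (hμ : ‖μ‖ < 1) : (μ, 0) ∈ Gamma3 T₁ T₂ ↔ HasLongHorizontalEnd J := by
  have hpos : 0 < ‖μ‖ := norm_pos_iff.2 hμ0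
  constructor
  · contrapose
    intro hV
    simp only [HasLongHorizontalEnd] at hV
    push Not at hV
    obtain ⟨N, hN⟩ := hV
    refine notMem_Gamma3_of_weights h hJ hμ 1 ∅ Set.univ (fun j _ => Or.inr trivial)
      (fun _ hj => hj.elim) (fun _ _ => trivial) (D := (‖μ‖ ^ N)⁻¹) (by positivity)
      (fun hj => hj.ne_empty.elim rfl) (fun _ hj => hj.elim) (fun j _ hj => ?_) (by simp)
    have h1 : (edge J j + N, j - 1) ∈ J := by
      by_contra h0
      obtain ⟨i, hi⟩ := hj.2
      exact hi (hN _ _ (hj.edge_mem hJ) h0 i)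
    have h2 : IsFin J (j - 1) := by
      obtain ⟨i, hi⟩ := hj.2
      exact ⟨⟨_, h1⟩, i, fun h => hi (hJ.mem_of_le h le_rfl (by omega))⟩
    have h3 := (h2.mem_iff hJ _).1 h1
    push_cast
    refine ⟨h2, ?_⟩
    rw [inv_mul_eq_div, le_div_iff₀ (by positivity), one_mul]
    exact pow_le_pow_of_le_one (norm_nonneg _) hμ.le (by omega)
  · intro hV
    by_contra hG
    obtain ⟨C, hC, hb⟩ := window_bound_of_notMem_Gamma3 h hJ hμ hG
    obtain ⟨n, hn⟩ := exists_pow_lt_of_lt_one (inv_pos.2 hC) hμ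
    obtain ⟨i, j, h1, h2, h3⟩ := hV n
    have hj : IsFin J j := ⟨⟨i, h1⟩, h3⟩
    have e1 := (hj.mem_iff hJ i).1 h1
    have h4 := hb j j le_rfl hj hj
    have h5 : (if IsFin J (j - 1) then ‖μ‖ ^ (2 * (edge J (j - 1) - edge J j).toNat) else 0)
        ≤ ‖μ‖ ^ n := by
      split_ifs with hf
      · refine pow_le_pow_of_le_one (norm_nonneg _) hμ.le ?_
        have : i + n < edge J (j - 1) := not_le.1 fun h => h2 ((hf.mem_iff hJ _).2 h)
        omega
      · positivity
    have h6 : (j - j + 1).toNat = 1 := by omega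
    rw [h6] at h4
    simp only [Finset.Icc_self, Finset.sum_singleton, sub_self, Int.toNat_zero, mul_zero, pow_zero,
      mul_one, norm_zero, ne_eq, OfNat.ofNat_ne_zero, not_false_eq_true, zero_pow, add_zero] at h4
    have h7 : C * ‖μ‖ ^ n < 1 := by
      calc C * ‖μ‖ ^ n < C * C⁻¹ := by gcongr
        _ = 1 := mul_inv_cancel₀ hC.ne'
    have h8 := mul_le_mul_of_nonneg_left h5 hC.le
    linarith

-- A corner is a point of `J` with neither its left nor its lower neighbour in `J`; its monomial is
-- orthogonal to both ranges.
omit [CompleteSpace H] in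
theorem zero_mem_Gamma3 (h : IsShiftModel J coef T₁ T₂) {i j : ℤ} (h1 : (i, j) ∈ J)
    (h2 : (i - 1, j) ∉ J) (h3 : (i, j - 1) ∉ J) : ((0, 0) : ℂ × ℂ) ∈ Gamma3 T₁ T₂ := by
  intro htop
  obtain ⟨x, hx⟩ := h.exists_single h1
  have hy : x ∈ ((0 : ℂ) • ContinuousLinearMap.id ℂ H - T₁).range ⊔
      ((0 : ℂ) • ContinuousLinearMap.id ℂ H - T₂).range := htop ▸ Submodule.mem_top
  obtain ⟨_, ⟨u, rfl⟩, _, ⟨v, rfl⟩, h4⟩ := Submodule.mem_sup.1 hy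
  have h5 : coef x (i, j) = - coef (T₁ u) (i, j) - coef (T₂ v) (i, j) := by
    rw [← h4, map_add]
    simp [sub_eq_add_neg]
  rw [h.coef_fst, h.coef_snd, h.coef_of_notMem u h2, h.coef_of_notMem v h3, hx] at h5
  simp at h5

end IsShiftModel

end Points

/-! ### Growth of the boundary of a diagram -/

section Growth

variable {J : Set (ℤ × ℤ)}

/-- The boundary below row `c` has all slopes less than `t`: this says `ρ₋ < t`. -/
def LowerSlopeLT (J : Set (ℤ × ℤ)) (c : ℤ) (t : ℝ) : Prop :=
  (∀ j, ∃ i, (i, j) ∈ J) ∧ ∃ s < t, ∃ K : ℝ, ∀ j k : ℤ, j ≤ k → k ≤ c →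
    (edge J j - edge J k : ℝ) ≤ s * (k - j) + K

/-- The boundary below row `c` has all slopes greater than `t`: this says `t < δ₋`. -/
def LTLowerSlope (J : Set (ℤ × ℤ)) (c : ℤ) (t : ℝ) : Prop :=
  (∃ j, ∀ i, (i, j) ∉ J) ∨ ∃ s > t, ∃ K : ℝ, ∀ j k : ℤ, j ≤ k → k ≤ c →
    s * (k - j) - K ≤ (edge J j - edge J k : ℝ)

/-- The boundary above row `c` has all slopes less than `t`: this says `ρ₊ < t`. -/
def UpperSlopeLT (J : Set (ℤ × ℤ)) (c : ℤ) (t : ℝ) : Prop :=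
  (∀ j, ∃ i, (i, j) ∉ J) ∧ ∃ s < t, ∃ K : ℝ, ∀ j k : ℤ, c ≤ j → j ≤ k →
    (edge J j - edge J k : ℝ) ≤ s * (k - j) + K

/-- The boundary above row `c` has all slopes greater than `t`: this says `t < δ₊`. -/
def LTUpperSlope (J : Set (ℤ × ℤ)) (c : ℤ) (t : ℝ) : Prop :=
  (∃ j, ∀ i, (i, j) ∈ J) ∨ ∃ s > t, ∃ K : ℝ, ∀ j k : ℤ, c ≤ j → j ≤ k →
    s * (k - j) - K ≤ (edge J j - edge J k : ℝ)

/-- A positive sequence each of whose terms dominates the sum of the previous ones grows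
geometrically. -/
theorem geometric_growth_of_sum_le {z : ℕ → ℝ} (hz : ∀ k, 0 ≤ z k) {C : ℝ} (hC : 1 ≤ C)
    (h : ∀ k, ∑ i ∈ Finset.range k, z i ≤ C * z k) (i n : ℕ) :
    (1 + C⁻¹) ^ n * z i ≤ C * (1 + C⁻¹) * z (i + n) := by
  have hC0 : 0 < C := by linarith
  have hθ : 1 ≤ 1 + C⁻¹ := by have := inv_pos.2 hC0; linarith
  set A : ℕ → ℝ := fun k => ∑ i ∈ Finset.range k, z i with hA
  -- The geometric growth belongs to the partial sums; it passes to `z` because `z i ≤ A (i + 1)`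
  -- and `A k ≤ C * z k`.
  have hstep : ∀ k, (1 + C⁻¹) * A k ≤ A (k + 1) := by
    intro k
    have h1 : A (k + 1) = A k + z k := Finset.sum_range_succ _ _
    have h2 : C⁻¹ * A k ≤ z k := by
      rw [inv_mul_le_iff₀ hC0]
      exact h k
    rw [h1]
    linarith
  have hpow : ∀ n, (1 + C⁻¹) ^ n * A (i + 1) ≤ A (i + 1 + n) := by
    intro n
    induction n with
    | zero => simp
    | succ n ih =>
      calc (1 + C⁻¹) ^ (n + 1) * A (i + 1) = (1 + C⁻¹) * ((1 + C⁻¹) ^ n * A (i + 1)) := by ring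
        _ ≤ (1 + C⁻¹) * A (i + 1 + n) := by gcongr
        _ ≤ _ := hstep _
  have hzA : z i ≤ A (i + 1) :=
    Finset.single_le_sum (f := z) (fun j _ => hz j) (Finset.self_mem_range_succ i)
  cases n with
  | zero =>
    have : 1 ≤ C * (1 + C⁻¹) := by nlinarith
    simpa using le_mul_of_one_le_left (hz i) this
  | succ n =>
    calc (1 + C⁻¹) ^ (n + 1) * z i = (1 + C⁻¹) * ((1 + C⁻¹) ^ n * z i) := by ring
      _ ≤ (1 + C⁻¹) * ((1 + C⁻¹) ^ n * A (i + 1)) := by gcongr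
      _ ≤ (1 + C⁻¹) * A (i + 1 + n) := by gcongr; exact hpow n
      _ ≤ (1 + C⁻¹) * (C * z (i + 1 + n)) := by gcongr; exact h _
      _ = _ := by rw [show i + 1 + n = i + (n + 1) by ring]; ring

theorem sum_range_sub (y : ℤ → ℝ) (m : ℤ) (k : ℕ) :
    ∑ i ∈ Finset.range k, y (m - i) = ∑ j ∈ Finset.Ioc (m - k) m, y j := by
  refine Finset.sum_nbij' (fun i => m - i) (fun j => (m - j).toNat) ?_ ?_ ?_ ?_ ?_
  · intro i hi; rw [Finset.mem_range] at hi; rw [Finset.mem_Ioc]; omega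
  · intro j hj; rw [Finset.mem_Ioc] at hj; rw [Finset.mem_range]; omega
  · intro i hi; simp
  · intro j hj; rw [Finset.mem_Ioc] at hj; omega
  · intro i hi; rfl

theorem sum_range_add (y : ℤ → ℝ) (m : ℤ) (k : ℕ) :
    ∑ i ∈ Finset.range k, y (m + i) = ∑ j ∈ Finset.Ico m (m + k), y j := by
  refine Finset.sum_nbij' (fun i => m + i) (fun j => (j - m).toNat) ?_ ?_ ?_ ?_ ?_
  · intro i hi; rw [Finset.mem_range] at hi; rw [Finset.mem_Ico]; omega
  · intro j hj; rw [Finset.mem_Ico] at hj; rw [Finset.mem_range]; omega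
  · intro i hi; simp
  · intro j hj; rw [Finset.mem_Ico] at hj; omega
  · intro i hi; rfl

open Classical in
/-- The squared norms `x^{2(tj + M_j)}` of the rows of the formal eigenvector. -/
def rowMass (J : Set (ℤ × ℤ)) (x t : ℝ) (j : ℤ) : ℝ :=
  if IsFin J j then x ^ (2 * (t * j + edge J j)) else 0

/-- Partial sums of the row masses are controlled by the two end rows. -/
def MassBound (J : Set (ℤ × ℤ)) (x t C : ℝ) : Prop :=
  1 ≤ C ∧ ∀ p q : ℤ, p < q → IsFin J (p + 1) → IsFin J q →
    ∑ j ∈ Finset.Ioc p q, rowMass J x t j ≤ C * (rowMass J x t p + rowMass J x t q)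

theorem rowMass_nonneg {x : ℝ} (hx : 0 < x) (t : ℝ) (j : ℤ) : 0 ≤ rowMass J x t j := by
  unfold rowMass
  split_ifs <;> positivity

theorem rowMass_of_isFin {x t : ℝ} {j : ℤ} (hj : IsFin J j) :
    rowMass J x t j = x ^ (2 * (t * j + edge J j)) := if_pos hj

theorem rowMass_pos {x : ℝ} (hx : 0 < x) {t : ℝ} {j : ℤ} (hj : IsFin J j) :
    0 < rowMass J x t j := by
  rw [rowMass_of_isFin hj]
  positivity

theorem isFin_of_rowMass_pos {x t : ℝ} {j : ℤ} (hj : 0 < rowMass J x t j) : IsFin J j := by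
  by_contra h
  simp [rowMass, h] at hj

/-- Taking logarithms in a geometric comparison of row masses. -/
theorem edge_sub_of_geometric {x θ C t : ℝ} (hx0 : 0 < x) (hx : x < 1) (hθ : 0 < θ) (hC : 0 < C)
    {j k : ℤ} (hj : IsFin J j) (hk : IsFin J k) {n : ℕ}
    (h : θ ^ n * rowMass J x t j ≤ C * rowMass J x t k) :
    (edge J k - edge J j : ℝ) ≤
      t * (j - k) - Real.log θ / (-2 * Real.log x) * n + Real.log C / (-2 * Real.log x) := by
  have hL : 0 < -2 * Real.log x := by have := Real.log_neg hx0 hx; linarith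
  rw [rowMass_of_isFin hj, rowMass_of_isFin hk] at h
  have h1 := Real.log_le_log (by positivity) h
  rw [Real.log_mul (by positivity) (by positivity), Real.log_mul (by positivity) (by positivity),
    Real.log_pow, Real.log_rpow hx0, Real.log_rpow hx0] at h1
  refine le_of_mul_le_mul_left ?_ hL
  have h2 : -2 * Real.log x * (t * (j - k) - Real.log θ / (-2 * Real.log x) * n +
      Real.log C / (-2 * Real.log x)) =
      -2 * Real.log x * (t * (j - k)) - Real.log θ * n + Real.log C := by
    have := (Real.log_neg hx0 hx).ne
    field_simp
    ring
  rw [h2]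
  linarith

/-- A steep descent of the row masses propagates downwards. -/
theorem MassBound.lowerSlopeLT (hJ : IsDiagram J) {x t C : ℝ} (hx0 : 0 < x) (hx : x < 1)
    (hM : MassBound J x t C) {m m' : ℤ} (hmm : m < m') (hm : IsFin J m) (hm' : IsFin J m')
    (h : 2 * C * rowMass J x t m' ≤ rowMass J x t m) : LowerSlopeLT J m t := by
  obtain ⟨hC, hb⟩ := hM
  have hy := fun j => rowMass_nonneg (J := J) hx0 t j
  set y := rowMass J x t with hy'
  -- The far end `m'` contributes at most `C * y m' ≤ y m / 2`, which is half of a summand on the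
  -- left and is absorbed at the price of doubling `C`.
  have hsum : ∀ p < m, IsFin J (p + 1) → ∑ j ∈ Finset.Ioc p m, y j ≤ 2 * C * y p := by
    intro p hp hp1
    have h1 := hb p m' (by omega) hp1 hm'
    have h2 : ∑ j ∈ Finset.Ioc p m, y j ≤ ∑ j ∈ Finset.Ioc p m', y j :=
      Finset.sum_le_sum_of_subset_of_nonneg (Finset.Ioc_subset_Ioc_right hmm.le) fun j _ _ => hy j
    have h3 : y m ≤ ∑ j ∈ Finset.Ioc p m, y j :=
      Finset.single_le_sum (f := y) (fun j _ => hy j) (by rw [Finset.mem_Ioc]; omega)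
    linarith
  -- An empty row would have mass zero, yet it must dominate `y m > 0`; so no empty row is met on
  -- the way down.
  have hfin : ∀ p ≤ m, IsFin J p := by
    intro p hp
    induction p, hp using Int.leInductionDown with
    | base => exact hm
    | pred p hp ih =>
      have h1 := hsum (p - 1) (by omega) (by simpa using ih)
      have h3 : y m ≤ ∑ j ∈ Finset.Ioc (p - 1) m, y j :=
        Finset.single_le_sum (f := y) (fun j _ => hy j) (by rw [Finset.mem_Ioc]; omega)
      have h4 := rowMass_pos (J := J) hx0 (t := t) hm
      refine isFin_of_rowMass_pos (x := x) (t := t) ?_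
      have h5 : 0 < 2 * C * y (p - 1) := by linarith
      exact pos_of_mul_pos_right h5 (by linarith)
  have hC2 : 1 ≤ 2 * C := by linarith
  have hgrow := geometric_growth_of_sum_le (z := fun k : ℕ => y (m - k)) (fun k => hy _) hC2
    (fun k => by
      rw [sum_range_sub]
      rcases Nat.eq_zero_or_pos k with rfl | hk
      · simpa using mul_nonneg (by linarith) (hy m)
      · exact hsum _ (by omega) (hfin _ (by omega)))
  set θ := 1 + (2 * C)⁻¹ with hθ
  have hθ1 : 1 < θ := by have : 0 < (2 * C)⁻¹ := by positivity
                         linarith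
  have hL : 0 < -2 * Real.log x := by have := Real.log_neg hx0 hx; linarith
  -- Growth of the mass by a factor `θ` per row is worth this gain in slope, since masses are powers
  -- of `x` with exponent doubled.
  have hε : 0 < Real.log θ / (-2 * Real.log x) := div_pos (Real.log_pos hθ1) hL
  refine ⟨fun j => ?_, t - Real.log θ / (-2 * Real.log x), by linarith,
    Real.log (2 * C * θ) / (-2 * Real.log x), fun j k hjk hkm => ?_⟩
  · rcases le_total j m with hj | hj
    · exact (hfin j hj).1
    · exact ⟨_, hJ.mem_of_le (hm.edge_mem hJ) le_rfl hj⟩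
  · have h1 := hgrow (m - k).toNat (k - j).toNat
    simp only [Nat.cast_add] at h1
    rw [Int.toNat_of_nonneg (by omega), Int.toNat_of_nonneg (by omega),
      show m - (m - k) = k by ring, show m - (m - k + (k - j)) = j by ring] at h1
    have h2 := edge_sub_of_geometric (J := J) hx0 hx (by linarith) (by positivity)
      (hfin k hkm) (hfin j (by omega)) h1
    have h3 : (((k - j).toNat : ℕ) : ℝ) = k - j := by
      have : (((k - j).toNat : ℕ) : ℤ) = k - j := Int.toNat_of_nonneg (by omega)
      exact_mod_cast this
    rw [h3] at h2
    linarith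

/-- A steep ascent of the row masses propagates upwards. -/
theorem MassBound.ltUpperSlope (hJ : IsDiagram J) {x t C : ℝ} (hx0 : 0 < x) (hx : x < 1)
    (hM : MassBound J x t C) {m m' : ℤ} (hmm : m < m') (hm : IsFin J m)
    (h : 2 * C * rowMass J x t m ≤ rowMass J x t m') : LTUpperSlope J m' t := by
  obtain ⟨hC, hb⟩ := hM
  by_cases hfull : ∃ j, ∀ i, (i, j) ∈ J
  · exact Or.inl hfull
  right
  have hy := fun j => rowMass_nonneg (J := J) hx0 t j
  set y := rowMass J x t with hy'
  have hfin : ∀ q ≥ m, IsFin J q := by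
    intro q hq
    refine ⟨⟨_, hJ.mem_of_le (hm.edge_mem hJ) le_rfl hq⟩, ?_⟩
    by_contra! h0
    exact hfull ⟨q, h0⟩
  -- The mirror image: the lower end `m` contributes at most `y m' / 2`, which is absorbed. Without
  -- full rows all rows from `m` upwards are finite.
  have hsum : ∀ q > m', ∑ j ∈ Finset.Ico m' q, y j ≤ 2 * C * y q := by
    intro q hq
    have h1 := hb m q (by omega) (hfin _ (by omega)) (hfin q (by omega))
    have h2 : ∑ j ∈ Finset.Ico m' q, y j ≤ ∑ j ∈ Finset.Ioc m q, y j :=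
      Finset.sum_le_sum_of_subset_of_nonneg (fun j hj => by
        rw [Finset.mem_Ico] at hj; rw [Finset.mem_Ioc]; omega) fun j _ _ => hy j
    have h3 : y m' ≤ ∑ j ∈ Finset.Ico m' q, y j :=
      Finset.single_le_sum (f := y) (fun j _ => hy j) (by rw [Finset.mem_Ico]; omega)
    linarith
  have hC2 : 1 ≤ 2 * C := by linarith
  have hgrow := geometric_growth_of_sum_le (z := fun k : ℕ => y (m' + k)) (fun k => hy _) hC2
    (fun k => by
      rw [sum_range_add]
      rcases Nat.eq_zero_or_pos k with rfl | hk
      · simpa using mul_nonneg (by linarith) (hy m')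
      · exact hsum _ (by omega))
  set θ := 1 + (2 * C)⁻¹ with hθ
  have hθ1 : 1 < θ := by have : 0 < (2 * C)⁻¹ := by positivity
                         linarith
  have hL : 0 < -2 * Real.log x := by have := Real.log_neg hx0 hx; linarith
  have hε : 0 < Real.log θ / (-2 * Real.log x) := div_pos (Real.log_pos hθ1) hL
  refine ⟨t + Real.log θ / (-2 * Real.log x), by linarith,
    Real.log (2 * C * θ) / (-2 * Real.log x), fun j k hjm hjk => ?_⟩
  have h1 := hgrow (j - m').toNat (k - j).toNat
  simp only [Nat.cast_add] at h1
  rw [Int.toNat_of_nonneg (by omega), Int.toNat_of_nonneg (by omega),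
    show m' + (j - m') = j by ring, show m' + (j - m' + (k - j)) = k by ring] at h1
  have h2 := edge_sub_of_geometric (J := J) hx0 hx (by linarith) (by positivity)
    (hfin j (by omega)) (hfin k (by omega)) h1
  have h3 : (((k - j).toNat : ℕ) : ℝ) = k - j := by
    have : (((k - j).toNat : ℕ) : ℤ) = k - j := Int.toNat_of_nonneg (by omega)
    exact_mod_cast this
  rw [h3] at h2
  linarith

/-- On a long window, the row masses somewhere get small compared with the larger end. -/
theorem MassBound.exists_small (hJ : IsDiagram J) {x t C c₁ : ℝ} (hx0 : 0 < x)
    (hM : MassBound J x t C) {p q : ℤ} (hpq : p < q) (hp : IsFin J p) (hq : IsFin J q)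
    {Y : ℝ} (hpY : rowMass J x t p ≤ c₁ * Y) (hqY : rowMass J x t q ≤ c₁ * Y) (hY : 0 ≤ Y)
    (hn : 4 * C ^ 2 * c₁ < q - p) :
    ∃ m, p < m ∧ m ≤ q ∧ 2 * C * rowMass J x t m ≤ Y := by
  obtain ⟨hC, hb⟩ := hM
  -- If every row were heavier than `Y / (2 * C)`, the window would have mass at least `(q - p) * Y
  -- / (2 * C)`, while its two ends allow at most `2 * C * c₁ * Y`.
  by_contra! h
  have h1 := hb p q hpq (hp.of_between hJ hq (by omega) (by omega)) hq
  have h2 : ∑ _j ∈ Finset.Ioc p q, Y / (2 * C) ≤ ∑ j ∈ Finset.Ioc p q, rowMass J x t j :=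
    Finset.sum_le_sum fun j hj => by
      rw [Finset.mem_Ioc] at hj
      rw [div_le_iff₀ (by linarith)]
      linarith [h j hj.1 hj.2]
  rw [Finset.sum_const, Int.card_Ioc, nsmul_eq_mul] at h2
  have h3 : (((q - p).toNat : ℕ) : ℝ) = q - p := by
    have : (((q - p).toNat : ℕ) : ℤ) = q - p := Int.toNat_of_nonneg (by omega)
    exact_mod_cast this
  rw [h3] at h2
  have h4 : (q - p : ℝ) * (Y / (2 * C)) ≤ C * (2 * (c₁ * Y)) := by
    refine h2.trans (h1.trans ?_)
    gcongr
    linarith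
  have h5 : (q - p : ℝ) * Y ≤ 4 * C ^ 2 * c₁ * Y := by
    have h6 : (q - p : ℝ) * (Y / (2 * C)) * (2 * C) = (q - p) * Y := by field_simp
    rw [← h6]
    calc _ ≤ C * (2 * (c₁ * Y)) * (2 * C) := by gcongr
      _ = _ := by ring
  rcases hY.eq_or_lt with h0 | h0
  · have h7 := h q hpq le_rfl
    rw [← h0] at h7 hqY
    have h8 := rowMass_pos (J := J) hx0 (t := t) hq
    linarith
  · exact absurd h5 (not_le.2 (by gcongr))

/-- A long window whose top is not much heavier than its bottom contains a row that is light
compared with the bottom, which is the steep descent needed to start the propagation. -/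
theorem MassBound.lowerSlopeLT_of_block (hJ : IsDiagram J) {x t C c₁ : ℝ} (hx0 : 0 < x) (hx : x < 1)
    (hM : MassBound J x t C) (hc₁ : 1 ≤ c₁) {p q : ℤ} (hpq : p < q) (hp : IsFin J p)
    (hq : IsFin J q) (hn : 4 * C ^ 2 * c₁ < q - p)
    (h : rowMass J x t q ≤ c₁ * rowMass J x t p) : LowerSlopeLT J p t := by
  have hy := rowMass_nonneg (J := J) hx0 t p
  obtain ⟨m, h1, h2, h3⟩ := hM.exists_small hJ hx0 hpq hp hq (le_mul_of_one_le_left hy hc₁) h hy hn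
  exact hM.lowerSlopeLT hJ hx0 hx h1 hp (hp.of_between hJ hq h1.le h2) h3

theorem MassBound.ltUpperSlope_of_block (hJ : IsDiagram J) {x t C c₁ : ℝ} (hx0 : 0 < x) (hx : x < 1)
    (hM : MassBound J x t C) (hc₁ : 1 ≤ c₁) {p q : ℤ} (hpq : p < q) (hp : IsFin J p)
    (hq : IsFin J q) (hn : 4 * C ^ 2 * c₁ < q - p)
    (h : rowMass J x t p ≤ c₁ * rowMass J x t q) : LTUpperSlope J q t := by
  have hy := rowMass_nonneg (J := J) hx0 t q
  obtain ⟨m, h1, h2, h3⟩ := hM.exists_small hJ hx0 hpq hp hq h (le_mul_of_one_le_left hy hc₁) hy hn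
  -- The light row cannot be `q` itself, because `2 * C > 1` and the mass of `q` is positive.
  rcases h2.eq_or_lt with rfl | h2
  · have h4 := rowMass_pos (J := J) hx0 (t := t) hq
    have := hM.1
    nlinarith
  · exact hM.ltUpperSlope hJ hx0 hx h2 (hp.of_between hJ hq h1.le h2.le) h3

end Growth

section Slopes

/-! ### Slopes of monotone sequences -/

/-- Divide `r` by `n`: the quotient is handled by whole steps, and the remainder changes the linear
bound by at most `|d|`. -/
theorem slope_ge_of_step {g : ℕ → ℝ} (hg : Monotone g) {n : ℕ} (hn : 1 ≤ n) {d : ℝ}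
    (h : ∀ i, d ≤ g (i + n) - g i) (i r : ℕ) : d / n * r - |d| ≤ g (i + r) - g i := by
  have hn0 : (0 : ℝ) < n := by exact_mod_cast hn
  have h1 := monotone_le_step h (r / n) i
  have h2 : g (i + n * (r / n)) ≤ g (i + r) := hg (by have := Nat.mul_div_le r n; omega)
  have h3 : (n : ℝ) * ((r / n : ℕ) : ℝ) + ((r % n : ℕ) : ℝ) = r := by
    exact_mod_cast Nat.div_add_mod r n
  have h4 : ((r % n : ℕ) : ℝ) ≤ n := by exact_mod_cast (Nat.mod_lt r hn).le
  have h5 : d / n * r = ((r / n : ℕ) : ℝ) * d + d * (((r % n : ℕ) : ℝ) / n) := by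
    rw [← h3]; field_simp
  have h6 : d * (((r % n : ℕ) : ℝ) / n) ≤ |d| * 1 :=
    mul_le_mul (le_abs_self d) ((div_le_one hn0).2 h4) (by positivity) (abs_nonneg d)
  linarith

theorem slope_le_of_step {g : ℕ → ℝ} (hg : Monotone g) {n : ℕ} (hn : 1 ≤ n) {d : ℝ}
    (h : ∀ i, g (i + n) - g i ≤ d) (i r : ℕ) : g (i + r) - g i ≤ d / n * r + d := by
  have hn0 : (0 : ℝ) < n := by exact_mod_cast hn
  have h1 := monotone_step_le h (r / n + 1) i
  have h2 : g (i + r) ≤ g (i + n * (r / n + 1)) :=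
    hg (by have := (Nat.lt_mul_div_succ r hn).le; omega)
  have h3 : (n : ℝ) * ((r / n : ℕ) : ℝ) + ((r % n : ℕ) : ℝ) = r := by
    exact_mod_cast Nat.div_add_mod r n
  have hd : 0 ≤ d := (sub_nonneg.2 (hg (Nat.le_add_right 0 n))).trans (h 0)
  have h5 : d / n * r = ((r / n : ℕ) : ℝ) * d + d * (((r % n : ℕ) : ℝ) / n) := by
    rw [← h3]; field_simp
  have h6 : 0 ≤ d * (((r % n : ℕ) : ℝ) / n) := by positivity
  push_cast at h1
  linarith

/-- Turns a strict inequality for the limit into a linear bound with an additive constant, the form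
used in the operator estimates. The constant disappears in the limit as `K / n`. -/
theorem limsup_sup_slope_lt_iff {g : ℕ → ℝ} (hg : Monotone g) {u : ℕ → EReal}
    (hu : ∀ n, u n = ⨆ i : ℕ, (((g (i + n) - g i) / n : ℝ) : EReal)) (t : ℝ) :
    limsup u atTop < t ↔ ∃ s < t, ∃ K : ℝ, ∀ i r : ℕ, g (i + r) - g i ≤ s * r + K := by
  constructor
  · intro h
    obtain ⟨s, hs1, hs2⟩ := EReal.lt_iff_exists_real_btwn.1 h
    obtain ⟨n, h1, hn⟩ := ((eventually_lt_of_limsup_lt hs1).and (eventually_ge_atTop 1)).exists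
    have hn0 : (0 : ℝ) < n := by exact_mod_cast hn
    have h2 : ∀ i, g (i + n) - g i ≤ s * n := by
      intro i
      have h3 : (((g (i + n) - g i) / n : ℝ) : EReal) ≤ (s : EReal) :=
        (le_iSup (fun i : ℕ => (((g (i + n) - g i) / n : ℝ) : EReal)) i).trans
          ((hu n).symm.le.trans h1.le)
      exact (div_le_iff₀ hn0).1 (EReal.coe_le_coe_iff.1 h3)
    refine ⟨s, EReal.coe_lt_coe_iff.1 hs2, s * n, fun i r => ?_⟩
    have := slope_le_of_step hg hn h2 i r
    rwa [mul_div_cancel_right₀ _ hn0.ne'] at this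
  · rintro ⟨s, hs, K, h⟩
    have h3 : ∀ n : ℕ, 1 ≤ n → u n ≤ ((s + K / n : ℝ) : EReal) := by
      intro n hn
      have hn0 : (0 : ℝ) < n := by exact_mod_cast hn
      rw [hu n]
      refine iSup_le fun i => EReal.coe_le_coe_iff.2 ?_
      rw [div_le_iff₀ hn0]
      have : (s + K / n) * n = s * n + K := by field_simp
      rw [this]
      exact h i n
    have h4 : Tendsto (fun n : ℕ => ((s + K / n : ℝ) : EReal)) atTop (𝓝 (s : EReal)) := by
      refine (continuous_coe_real_ereal.tendsto s).comp ?_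
      simpa using (tendsto_const_div_atTop_nhds_zero_nat K).const_add s
    calc limsup u atTop ≤ limsup (fun n : ℕ => ((s + K / n : ℝ) : EReal)) atTop :=
          limsup_le_limsup (eventually_atTop.2 ⟨1, h3⟩)
      _ = s := h4.limsup_eq
      _ < t := EReal.coe_lt_coe_iff.2 hs

theorem lt_limsup_inf_slope_iff {g : ℕ → ℝ} (hg : Monotone g) {u : ℕ → EReal}
    (hu : ∀ n, u n = ⨅ i : ℕ, (((g (i + n) - g i) / n : ℝ) : EReal)) (t : ℝ) :
    t < limsup u atTop ↔ ∃ s > t, ∃ K : ℝ, ∀ i r : ℕ, s * r - K ≤ g (i + r) - g i := by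
  constructor
  · intro h
    obtain ⟨s, hs1, hs2⟩ := EReal.lt_iff_exists_real_btwn.1 h
    obtain ⟨n, h1, hn⟩ :=
      (((tendsto_inf_slope hg hu).eventually_const_lt hs2).and (eventually_ge_atTop 1)).exists
    have hn0 : (0 : ℝ) < n := by exact_mod_cast hn
    have h2 : ∀ i, s * n ≤ g (i + n) - g i := by
      intro i
      have h3 : (s : EReal) ≤ (((g (i + n) - g i) / n : ℝ) : EReal) :=
        (h1.le.trans (hu n).le).trans
          (iInf_le (fun i : ℕ => (((g (i + n) - g i) / n : ℝ) : EReal)) i)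
      exact (le_div_iff₀ hn0).1 (EReal.coe_le_coe_iff.1 h3)
    refine ⟨s, EReal.coe_lt_coe_iff.1 hs1, |s * n|, fun i r => ?_⟩
    have := slope_ge_of_step hg hn h2 i r
    rwa [mul_div_cancel_right₀ _ hn0.ne'] at this
  · rintro ⟨s, hs, K, h⟩
    have h3 : ∀ n : ℕ, 1 ≤ n → ((s - K / n : ℝ) : EReal) ≤ u n := by
      intro n hn
      have hn0 : (0 : ℝ) < n := by exact_mod_cast hn
      rw [hu n]
      refine le_iInf fun i => EReal.coe_le_coe_iff.2 ?_
      rw [le_div_iff₀ hn0]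
      have : (s - K / n) * n = s * n - K := by field_simp
      rw [this]
      exact h i n
    have h4 : Tendsto (fun n : ℕ => ((s - K / n : ℝ) : EReal)) atTop (𝓝 (s : EReal)) := by
      refine (continuous_coe_real_ereal.tendsto s).comp ?_
      simpa using (tendsto_const_div_atTop_nhds_zero_nat K).const_sub s
    calc (t : EReal) < s := EReal.coe_lt_coe_iff.2 hs
      _ = limsup (fun n : ℕ => ((s - K / n : ℝ) : EReal)) atTop := h4.limsup_eq.symm
      _ ≤ limsup u atTop := limsup_le_limsup (eventually_atTop.2 ⟨1, h3⟩)

/-! ### The parameters of a diagram in terms of its edge -/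

variable {J : Set (ℤ × ℤ)}

theorem rowInf_eq_top_iff {j : ℤ} : rowInf J j = ⊤ ↔ ∀ i, (i, j) ∉ J := by
  simp [rowInf]

theorem rowInf_eq_edge (hJ : IsDiagram J) {j : ℤ} (hj : IsFin J j) :
    rowInf J j = ((edge J j : ℝ) : EReal) := by
  refine le_antisymm (iInf₂_le (f := fun i (_ : i ∈ {i : ℤ | (i, j) ∈ J}) => ((i : ℝ) : EReal))
    (edge J j) (hj.edge_mem hJ)) (le_iInf₂ fun i hi => ?_)
  have := (hj.mem_iff hJ i).1 hi
  exact EReal.coe_le_coe_iff.2 (by exact_mod_cast this)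

theorem rowInf_eq_bot_iff (hJ : IsDiagram J) {j : ℤ} : rowInf J j = ⊥ ↔ ∀ i, (i, j) ∈ J := by
  constructor
  · intro h
    by_contra! h0
    by_cases h1 : ∃ i, (i, j) ∈ J
    · rw [rowInf_eq_edge hJ ⟨h1, h0⟩] at h
      exact EReal.coe_ne_bot _ h
    · push Not at h1
      rw [rowInf_eq_top_iff.2 h1] at h
      exact top_ne_bot h
  · intro h
    refine EReal.eq_bot_iff_forall_lt _ |>.2 fun y => ?_
    obtain ⟨i, hi⟩ := exists_int_lt y
    exact lt_of_le_of_lt (iInf₂_le i (h i)) (EReal.coe_lt_coe_iff.2 hi)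

theorem isFin_iff (hJ : IsDiagram J) {j : ℤ} : IsFin J j ↔ rowInf J j ≠ ⊤ ∧ rowInf J j ≠ ⊥ := by
  rw [Ne, Ne, rowInf_eq_top_iff, rowInf_eq_bot_iff hJ]
  push Not
  rfl

theorem isFin_of_le (hJ : IsDiagram J) (hE : ∀ j, ∃ i, (i, j) ∈ J) {c j : ℤ} (hc : IsFin J c)
    (hj : j ≤ c) : IsFin J j := by
  obtain ⟨i, hi⟩ := hc.2
  exact ⟨hE j, i, fun h => hi (hJ.mem_of_le h le_rfl hj)⟩

theorem isFin_of_ge (hJ : IsDiagram J) (hF : ∀ j, ∃ i, (i, j) ∉ J) {c j : ℤ} (hc : IsFin J c)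
    (hj : c ≤ j) : IsFin J j :=
  ⟨⟨_, hJ.mem_of_le (hc.edge_mem hJ) le_rfl hj⟩, hF j⟩

/-- The edge below row `c`, as a sequence. -/
def lowerSeq (J : Set (ℤ × ℤ)) (c : ℤ) (i : ℕ) : ℝ := edge J (c - i)

/-- The edge above row `c`, as an increasing sequence. -/
def upperSeq (J : Set (ℤ × ℤ)) (c : ℤ) (i : ℕ) : ℝ := -edge J (c + i)

theorem monotone_lowerSeq (hJ : IsDiagram J) (hE : ∀ j, ∃ i, (i, j) ∈ J) {c : ℤ} (hc : IsFin J c) :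
    Monotone (lowerSeq J c) := fun i i' h => by
  have := (isFin_of_le hJ hE hc (j := c - i') (by omega)).edge_le hJ
    (isFin_of_le hJ hE hc (j := c - i) (by omega)) (by omega)
  exact Int.cast_le.2 this

theorem monotone_upperSeq (hJ : IsDiagram J) (hF : ∀ j, ∃ i, (i, j) ∉ J) {c : ℤ} (hc : IsFin J c) :
    Monotone (upperSeq J c) := fun i i' h => by
  have := (isFin_of_ge hJ hF hc (j := c + i) (by omega)).edge_le hJ
    (isFin_of_ge hJ hF hc (j := c + i') (by omega)) (by omega)
  exact neg_le_neg (Int.cast_le.2 this)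

theorem forall_lower_iff {c : ℤ} (P : ℝ → ℝ → Prop) :
    (∀ j k : ℤ, j ≤ k → k ≤ c → P (k - j) (edge J j - edge J k)) ↔
      ∀ i r : ℕ, P r (lowerSeq J c (i + r) - lowerSeq J c i) := by
  constructor
  · intro h i r
    have := h (c - i - r) (c - i) (by omega) (by omega)
    convert this using 1
    · push_cast; ring
    · simp only [lowerSeq]
      push_cast
      rw [sub_sub]
  · intro h j k hjk hkc
    have := h (c - k).toNat (k - j).toNat
    have e1 : (((k - j).toNat : ℕ) : ℝ) = k - j := by
      have : (((k - j).toNat : ℕ) : ℤ) = k - j := Int.toNat_of_nonneg (by omega)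
      exact_mod_cast this
    rw [e1] at this
    simp only [lowerSeq] at this
    rwa [show c - (((c - k).toNat + (k - j).toNat : ℕ) : ℤ) = j by omega,
      show c - (((c - k).toNat : ℕ) : ℤ) = k by omega] at this

theorem forall_upper_iff {c : ℤ} (P : ℝ → ℝ → Prop) :
    (∀ j k : ℤ, c ≤ j → j ≤ k → P (k - j) (edge J j - edge J k)) ↔
      ∀ i r : ℕ, P r (upperSeq J c (i + r) - upperSeq J c i) := by
  constructor
  · intro h i r
    have := h (c + i) (c + i + r) (by omega) (by omega)
    convert this using 1
    · push_cast; ring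
    · simp only [upperSeq]
      push_cast
      rw [add_assoc]
      ring
  · intro h j k hjk hkc
    have := h (j - c).toNat (k - j).toNat
    have e1 : (((k - j).toNat : ℕ) : ℝ) = k - j := by
      have : (((k - j).toNat : ℕ) : ℤ) = k - j := Int.toNat_of_nonneg (by omega)
      exact_mod_cast this
    rw [e1] at this
    simp only [upperSeq] at this
    rw [show c + (((j - c).toNat + (k - j).toNat : ℕ) : ℤ) = k by omega,
      show c + (((j - c).toNat : ℕ) : ℤ) = j by omega] at this
    convert this using 1
    ring

theorem rowInf_sub_lower (hJ : IsDiagram J) (hE : ∀ j, ∃ i, (i, j) ∈ J) {c : ℤ} (hc : IsFin J c)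
    (i : ℕ) : rowInf J (c - i) = (lowerSeq J c i : EReal) :=
  rowInf_eq_edge hJ (isFin_of_le hJ hE hc (by omega))

theorem rowInf_add_upper (hJ : IsDiagram J) (hF : ∀ j, ∃ i, (i, j) ∉ J) {c : ℤ} (hc : IsFin J c)
    (i : ℕ) : rowInf J (c + i) = ((-upperSeq J c i : ℝ) : EReal) := by
  rw [upperSeq, neg_neg]
  exact rowInf_eq_edge hJ (isFin_of_ge hJ hF hc (by omega))

theorem lowerSlopeLT_self_iff (hJ : IsDiagram J) {a : ℤ} (ha : IsFin J a) (t : ℝ) :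
    rhoMinus J a < t ↔ LowerSlopeLT J a t := by
  by_cases hE : ∀ j, ∃ i, (i, j) ∈ J
  · have h0 : ¬ ∃ j, rowInf J j = ⊤ := by
      rintro ⟨j, hj⟩
      obtain ⟨i, hi⟩ := hE j
      exact rowInf_eq_top_iff.1 hj i hi
    rw [rhoMinus, if_neg h0, limsup_sup_slope_lt_iff (monotone_lowerSeq hJ hE ha) (fun n => ?_)]
    · simp only [LowerSlopeLT, hE, implies_true, true_and]
      refine exists_congr fun s => and_congr_right fun _ => exists_congr fun K => ?_
      exact (forall_lower_iff fun r d => d ≤ s * r + K).symm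
    · simp_rw [← lower_quot (rowInf_sub_lower hJ hE ha)]
      refine le_antisymm (iSup₂_le fun j hj => ?_) (iSup_le fun i => ?_)
      · obtain ⟨i, rfl⟩ : ∃ i : ℕ, j = a - i := ⟨(a - j).toNat, by omega⟩
        exact le_iSup (fun i : ℕ => (rowInf J (a - i - n) - rowInf J (a - i)) / (n : EReal)) i
      · exact le_iSup₂ (f := fun j (_ : j ≤ a) => (rowInf J (j - n) - rowInf J j) / (n : EReal))
          (a - i) (by omega)
  · have h0 : ∃ j, rowInf J j = ⊤ := by
      push Not at hE
      obtain ⟨j, hj⟩ := hE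
      exact ⟨j, rowInf_eq_top_iff.2 hj⟩
    rw [rhoMinus, if_pos h0]
    simp [LowerSlopeLT, hE]

theorem ltLowerSlope_self_iff (hJ : IsDiagram J) {a : ℤ} (ha : IsFin J a) (t : ℝ) :
    t < deltaMinus J a ↔ LTLowerSlope J a t := by
  by_cases hE : ∀ j, ∃ i, (i, j) ∈ J
  · have h0 : ¬ ∃ j, rowInf J j = ⊤ := by
      rintro ⟨j, hj⟩
      obtain ⟨i, hi⟩ := hE j
      exact rowInf_eq_top_iff.1 hj i hi
    have h1 : ¬ ∃ j, ∀ i, (i, j) ∉ J := by push Not; exact hE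
    rw [deltaMinus, if_neg h0, lt_limsup_inf_slope_iff (monotone_lowerSeq hJ hE ha) (fun n => ?_)]
    · simp only [LTLowerSlope, h1, false_or]
      refine exists_congr fun s => and_congr_right fun _ => exists_congr fun K => ?_
      exact (forall_lower_iff fun r d => s * r - K ≤ d).symm
    · simp_rw [← lower_quot (rowInf_sub_lower hJ hE ha)]
      refine le_antisymm (le_iInf fun i => ?_) (le_iInf₂ fun j hj => ?_)
      · exact iInf₂_le (f := fun j (_ : j ≤ a) => (rowInf J (j - n) - rowInf J j) / (n : EReal))
          (a - i) (by omega)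
      · obtain ⟨i, rfl⟩ : ∃ i : ℕ, j = a - i := ⟨(a - j).toNat, by omega⟩
        exact iInf_le (fun i : ℕ => (rowInf J (a - i - n) - rowInf J (a - i)) / (n : EReal)) i
  · push Not at hE
    have h0 : ∃ j, rowInf J j = ⊤ := by
      obtain ⟨j, hj⟩ := hE
      exact ⟨j, rowInf_eq_top_iff.2 hj⟩
    rw [deltaMinus, if_pos h0]
    simp [LTLowerSlope, hE, EReal.coe_lt_top]

theorem upperSlopeLT_self_iff (hJ : IsDiagram J) {b : ℤ} (hb : IsFin J b) (t : ℝ) :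
    rhoPlus J b < t ↔ UpperSlopeLT J b t := by
  by_cases hF : ∀ j, ∃ i, (i, j) ∉ J
  · have h0 : ¬ ∃ j, rowInf J j = ⊥ := by
      rintro ⟨j, hj⟩
      obtain ⟨i, hi⟩ := hF j
      exact hi ((rowInf_eq_bot_iff hJ).1 hj i)
    rw [rhoPlus, if_neg h0, limsup_sup_slope_lt_iff (monotone_upperSeq hJ hF hb) (fun n => ?_)]
    · simp only [UpperSlopeLT, hF, implies_true, true_and]
      refine exists_congr fun s => and_congr_right fun _ => exists_congr fun K => ?_
      exact (forall_upper_iff fun r d => d ≤ s * r + K).symm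
    · simp_rw [← upper_quot (rowInf_add_upper hJ hF hb)]
      refine le_antisymm (iSup₂_le fun j hj => ?_) (iSup_le fun i => ?_)
      · obtain ⟨i, rfl⟩ : ∃ i : ℕ, j = b + i := ⟨(j - b).toNat, by omega⟩
        exact le_iSup (fun i : ℕ => (rowInf J (b + i) - rowInf J (b + i + n)) / (n : EReal)) i
      · exact le_iSup₂ (f := fun j (_ : j ≥ b) => (rowInf J j - rowInf J (j + n)) / (n : EReal))
          (b + i) (by omega)
  · have h0 : ∃ j, rowInf J j = ⊥ := by
      push Not at hF
      obtain ⟨j, hj⟩ := hF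
      exact ⟨j, (rowInf_eq_bot_iff hJ).2 hj⟩
    rw [rhoPlus, if_pos h0]
    simp [UpperSlopeLT, hF]

theorem ltUpperSlope_self_iff (hJ : IsDiagram J) {b : ℤ} (hb : IsFin J b) (t : ℝ) :
    t < deltaPlus J b ↔ LTUpperSlope J b t := by
  by_cases hF : ∀ j, ∃ i, (i, j) ∉ J
  · have h0 : ¬ ∃ j, rowInf J j = ⊥ := by
      rintro ⟨j, hj⟩
      obtain ⟨i, hi⟩ := hF j
      exact hi ((rowInf_eq_bot_iff hJ).1 hj i)
    have h1 : ¬ ∃ j, ∀ i, (i, j) ∈ J := by push Not; exact hF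
    rw [deltaPlus, if_neg h0, lt_limsup_inf_slope_iff (monotone_upperSeq hJ hF hb) (fun n => ?_)]
    · simp only [LTUpperSlope, h1, false_or]
      refine exists_congr fun s => and_congr_right fun _ => exists_congr fun K => ?_
      exact (forall_upper_iff fun r d => s * r - K ≤ d).symm
    · simp_rw [← upper_quot (rowInf_add_upper hJ hF hb)]
      refine le_antisymm (le_iInf fun i => ?_) (le_iInf₂ fun j hj => ?_)
      · exact iInf₂_le (f := fun j (_ : j ≥ b) => (rowInf J j - rowInf J (j + n)) / (n : EReal))
          (b + i) (by omega)
      · obtain ⟨i, rfl⟩ : ∃ i : ℕ, j = b + i := ⟨(j - b).toNat, by omega⟩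
        exact iInf_le (fun i : ℕ => (rowInf J (b + i) - rowInf J (b + i + n)) / (n : EReal)) i
  · push Not at hF
    have h0 : ∃ j, rowInf J j = ⊥ := by
      obtain ⟨j, hj⟩ := hF
      exact ⟨j, (rowInf_eq_bot_iff hJ).2 hj⟩
    rw [deltaPlus, if_pos h0]
    simp [LTUpperSlope, hF, EReal.coe_lt_top]

/-! ### Independence of the base row -/

/-- A bounded change of the row distance and of the drop only alters the additive constant, never
the slope; this is why the parameters do not depend on the base row. -/
theorem slope_compare {s K : ℝ} {j k j' k' : ℤ} {D : ℝ} {W : ℝ}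
    (hd : |((k' - j' : ℝ)) - (k - j)| ≤ D) (hW : |(edge J j - edge J k : ℝ) - (edge J j' - edge J k')| ≤ W) :
     ((edge J j' - edge J k' : ℝ) ≤ s * (k' - j') + K →
        (edge J j - edge J k : ℝ) ≤ s * (k - j) + (K + W + |s| * D)) ∧
      (s * (k' - j') - K ≤ (edge J j' - edge J k' : ℝ) →
        s * (k - j) - (K + W + |s| * D) ≤ (edge J j - edge J k : ℝ)) := by
  have h1 : |s * ((k' - j' : ℝ) - (k - j))| ≤ |s| * D := by
    rw [abs_mul]; gcongr
  have h2 := abs_le.1 h1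
  have h3 := abs_le.1 hW
  constructor <;> intro h <;> nlinarith [h2.1, h2.2, h3.1, h3.2]

/-- Cutting both rows off at `a` discards only what lies between `a` and `c`, whose height and width
do not depend on `j` and `k`. -/
theorem lower_base_change (hJ : IsDiagram J) (hE : ∀ j, ∃ i, (i, j) ∈ J) {a c : ℤ}
    (ha : IsFin J a) (hc : IsFin J c) {j k : ℤ} (hjk : j ≤ k) (hk : k ≤ c) :
    |((min k a - min j a : ℤ) : ℝ) - (k - j)| ≤ |(a - c : ℝ)| ∧
    |(edge J j - edge J k : ℝ) - (edge J (min j a) - edge J (min k a))| ≤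
      |(edge J a - edge J c : ℝ)| := by
  have key : |(min k a - min j a) - (k - j)| ≤ |a - c| ∧
      |(edge J j - edge J k) - (edge J (min j a) - edge J (min k a))| ≤ |edge J a - edge J c| := by
    have fj := isFin_of_le hJ hE hc (hjk.trans hk)
    have fk := isFin_of_le hJ hE hc hk
    have e1 := fj.edge_le hJ fk hjk
    have e2 := fk.edge_le hJ hc hk
    rcases le_total k a with h1 | h1
    · have h2 : j ≤ a := hjk.trans h1
      rw [min_eq_left h1, min_eq_left h2]
      simp
    · have e3 := ha.edge_le hJ fk h1
      rw [min_eq_right h1]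
      rcases le_total j a with h2 | h2
      · rw [min_eq_left h2]
        constructor
        · rw [abs_le, abs_of_nonpos (by omega)]; omega
        · rw [abs_le, abs_of_nonneg (by omega)]; omega
      · have e4 := ha.edge_le hJ fj h2
        rw [min_eq_right h2]
        constructor
        · rw [abs_le, abs_of_nonpos (by omega)]; omega
        · rw [abs_le, abs_of_nonneg (by omega)]; omega
  exact_mod_cast key

theorem upper_base_change (hJ : IsDiagram J) (hF : ∀ j, ∃ i, (i, j) ∉ J) {a c : ℤ}
    (ha : IsFin J a) (hc : IsFin J c) {j k : ℤ} (hj : c ≤ j) (hjk : j ≤ k) :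
    |((max k a - max j a : ℤ) : ℝ) - (k - j)| ≤ |(a - c : ℝ)| ∧
    |(edge J j - edge J k : ℝ) - (edge J (max j a) - edge J (max k a))| ≤
      |(edge J a - edge J c : ℝ)| := by
  have key : |(max k a - max j a) - (k - j)| ≤ |a - c| ∧
      |(edge J j - edge J k) - (edge J (max j a) - edge J (max k a))| ≤ |edge J a - edge J c| := by
    have fj := isFin_of_ge hJ hF hc hj
    have fk := isFin_of_ge hJ hF hc (hj.trans hjk)
    have e1 := fj.edge_le hJ fk hjk
    have e2 := hc.edge_le hJ fj hj
    rcases le_total a j with h1 | h1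
    · have h2 : a ≤ k := h1.trans hjk
      rw [max_eq_left h1, max_eq_left h2]
      simp
    · have e3 := fj.edge_le hJ ha h1
      rw [max_eq_right h1]
      rcases le_total a k with h2 | h2
      · rw [max_eq_left h2]
        constructor
        · rw [abs_le, abs_of_nonneg (by omega)]; omega
        · rw [abs_le, abs_of_nonpos (by omega)]; omega
      · have e4 := fk.edge_le hJ ha h2
        rw [max_eq_right h2]
        constructor
        · rw [abs_le, abs_of_nonneg (by omega)]; omega
        · rw [abs_le, abs_of_nonpos (by omega)]; omega
  exact_mod_cast key

theorem LowerSlopeLT.base_change (hJ : IsDiagram J) {a c : ℤ} (ha : IsFin J a) (hc : IsFin J c)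
    {t : ℝ} (h : LowerSlopeLT J a t) : LowerSlopeLT J c t := by
  obtain ⟨hE, s, hs, K, h⟩ := h
  refine ⟨hE, s, hs, K + |(edge J a - edge J c : ℝ)| + |s| * |(a - c : ℝ)|, fun j k hjk hk => ?_⟩
  obtain ⟨h1, h2⟩ := lower_base_change hJ hE ha hc hjk hk
  have h3 := h (min j a) (min k a) (min_le_min_right a hjk) (min_le_right _ _)
  push_cast at h1 h3
  exact (slope_compare (s := s) (K := K) (by exact_mod_cast h1) h2).1 (by exact_mod_cast h3)

theorem LTLowerSlope.base_change (hJ : IsDiagram J) {a c : ℤ} (ha : IsFin J a) (hc : IsFin J c)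
    {t : ℝ} (h : LTLowerSlope J a t) : LTLowerSlope J c t := by
  by_cases hE' : ∃ j, ∀ i, (i, j) ∉ J
  · exact Or.inl hE'
  obtain ⟨s, hs, K, h⟩ := h.resolve_left hE'
  push Not at hE'
  refine Or.inr ⟨s, hs, K + |(edge J a - edge J c : ℝ)| + |s| * |(a - c : ℝ)|, fun j k hjk hk => ?_⟩
  obtain ⟨h1, h2⟩ := lower_base_change hJ hE' ha hc hjk hk
  have h3 := h (min j a) (min k a) (min_le_min_right a hjk) (min_le_right _ _)
  push_cast at h1 h3
  exact (slope_compare (s := s) (K := K) (by exact_mod_cast h1) h2).2 (by exact_mod_cast h3)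

theorem UpperSlopeLT.base_change (hJ : IsDiagram J) {a c : ℤ} (ha : IsFin J a) (hc : IsFin J c)
    {t : ℝ} (h : UpperSlopeLT J a t) : UpperSlopeLT J c t := by
  obtain ⟨hF, s, hs, K, h⟩ := h
  refine ⟨hF, s, hs, K + |(edge J a - edge J c : ℝ)| + |s| * |(a - c : ℝ)|, fun j k hj hjk => ?_⟩
  obtain ⟨h1, h2⟩ := upper_base_change hJ hF ha hc hj hjk
  have h3 := h (max j a) (max k a) (le_max_right _ _) (max_le_max_right a hjk)
  push_cast at h1 h3
  exact (slope_compare (s := s) (K := K) (by exact_mod_cast h1) h2).1 (by exact_mod_cast h3)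

theorem LTUpperSlope.base_change (hJ : IsDiagram J) {a c : ℤ} (ha : IsFin J a) (hc : IsFin J c)
    {t : ℝ} (h : LTUpperSlope J a t) : LTUpperSlope J c t := by
  by_cases hF' : ∃ j, ∀ i, (i, j) ∈ J
  · exact Or.inl hF'
  obtain ⟨s, hs, K, h⟩ := h.resolve_left hF'
  push Not at hF'
  refine Or.inr ⟨s, hs, K + |(edge J a - edge J c : ℝ)| + |s| * |(a - c : ℝ)|, fun j k hj hjk => ?_⟩
  obtain ⟨h1, h2⟩ := upper_base_change hJ hF' ha hc hj hjk
  have h3 := h (max j a) (max k a) (le_max_right _ _) (max_le_max_right a hjk)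
  push_cast at h1 h3
  exact (slope_compare (s := s) (K := K) (by exact_mod_cast h1) h2).2 (by exact_mod_cast h3)

/-- Row `a` is only required not to be full. If it is empty, the parameter is `∞` and both sides
fail; otherwise the base row is moved to `c`. -/
theorem rhoMinus_lt_iff (hJ : IsDiagram J) {a c : ℤ} (ha : rowInf J a ≠ ⊥) (hc : IsFin J c)
    (t : ℝ) : rhoMinus J a < t ↔ LowerSlopeLT J c t := by
  by_cases ha' : rowInf J a = ⊤
  · rw [rhoMinus, if_pos ⟨a, ha'⟩]
    rw [rowInf_eq_top_iff] at ha'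
    have : ¬ ∀ j, ∃ i, (i, j) ∈ J := by push Not; exact ⟨a, ha'⟩
    simp [LowerSlopeLT, this]
  · have ha2 := (isFin_iff hJ).2 ⟨ha', ha⟩
    rw [lowerSlopeLT_self_iff hJ ha2]
    exact ⟨fun h => h.base_change hJ ha2 hc, fun h => h.base_change hJ hc ha2⟩

theorem lt_deltaMinus_iff (hJ : IsDiagram J) {a c : ℤ} (ha : rowInf J a ≠ ⊥) (hc : IsFin J c)
    (t : ℝ) : t < deltaMinus J a ↔ LTLowerSlope J c t := by
  by_cases ha' : rowInf J a = ⊤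
  · rw [deltaMinus, if_pos ⟨a, ha'⟩]
    rw [rowInf_eq_top_iff] at ha'
    have : ∃ j, ∀ i, (i, j) ∉ J := ⟨a, ha'⟩
    simp [LTLowerSlope, this, EReal.coe_lt_top]
  · have ha2 := (isFin_iff hJ).2 ⟨ha', ha⟩
    rw [ltLowerSlope_self_iff hJ ha2]
    exact ⟨fun h => h.base_change hJ ha2 hc, fun h => h.base_change hJ hc ha2⟩

theorem rhoPlus_lt_iff (hJ : IsDiagram J) {b c : ℤ} (hb : rowInf J b ≠ ⊤) (hc : IsFin J c)
    (t : ℝ) : rhoPlus J b < t ↔ UpperSlopeLT J c t := by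
  by_cases hb' : rowInf J b = ⊥
  · rw [rhoPlus, if_pos ⟨b, hb'⟩]
    rw [rowInf_eq_bot_iff hJ] at hb'
    have : ¬ ∀ j, ∃ i, (i, j) ∉ J := by push Not; exact ⟨b, hb'⟩
    simp [UpperSlopeLT, this]
  · have hb2 := (isFin_iff hJ).2 ⟨hb, hb'⟩
    rw [upperSlopeLT_self_iff hJ hb2]
    exact ⟨fun h => h.base_change hJ hb2 hc, fun h => h.base_change hJ hc hb2⟩

theorem lt_deltaPlus_iff (hJ : IsDiagram J) {b c : ℤ} (hb : rowInf J b ≠ ⊤) (hc : IsFin J c)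
    (t : ℝ) : t < deltaPlus J b ↔ LTUpperSlope J c t := by
  by_cases hb' : rowInf J b = ⊥
  · rw [deltaPlus, if_pos ⟨b, hb'⟩]
    rw [rowInf_eq_bot_iff hJ] at hb'
    have : ∃ j, ∀ i, (i, j) ∈ J := ⟨b, hb'⟩
    simp [LTUpperSlope, this, EReal.coe_lt_top]
  · have hb2 := (isFin_iff hJ).2 ⟨hb, hb'⟩
    rw [ltUpperSlope_self_iff hJ hb2]
    exact ⟨fun h => h.base_change hJ hb2 hc, fun h => h.base_change hJ hc hb2⟩

end Slopes

section Interior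

variable {J : Set (ℤ × ℤ)}

/-! ### The interior points of the bidisc -/

/-- Makes the two alternatives of `LTLowerSlope` uniform. Above an empty row only finitely many rows
up to `c` are finite, so a suitable additive constant makes any slope admissible there. -/
theorem LTLowerSlope.bound (hJ : IsDiagram J) {c : ℤ} (hc : IsFin J c) {t : ℝ}
    (h : LTLowerSlope J c t) : ∃ s > t, ∃ K ≥ 0, ∀ j k : ℤ, j ≤ k → k ≤ c → IsFin J j →
      s * (k - j) - K ≤ (edge J j - edge J k : ℝ) := by
  rcases h with ⟨j₀, h0⟩ | ⟨s, hs, K, h⟩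
  · have hlt : ∀ j, IsFin J j → j₀ < j := fun j hj => not_le.1 fun hle =>
      h0 _ (hJ.mem_of_le (hj.edge_mem hJ) le_rfl hle)
    have h1 : (j₀ : ℝ) ≤ c := by exact_mod_cast (hlt c hc).le
    refine ⟨t + 1, by linarith, |t + 1| * (c - j₀), mul_nonneg (abs_nonneg _) (by linarith),
      fun j k hjk hk hj => ?_⟩
    have h2 : (edge J k : ℝ) ≤ edge J j := by
      exact_mod_cast hj.edge_le hJ (hj.of_between hJ hc hjk hk) hjk
    have h3 : (j : ℝ) ≤ k := by exact_mod_cast hjk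
    have h4 : (k : ℝ) ≤ c := by exact_mod_cast hk
    have h5 : (j₀ : ℝ) ≤ j := by exact_mod_cast (hlt j hj).le
    have h6 : (t + 1) * (k - j : ℝ) ≤ |t + 1| * (c - j₀) :=
      mul_le_mul (le_abs_self _) (by linarith) (by linarith) (abs_nonneg _)
    linarith
  · exact ⟨s, hs, |K|, abs_nonneg _, fun j k h1 h2 _ => by linarith [h j k h1 h2, le_abs_self K]⟩

theorem LTUpperSlope.bound (hJ : IsDiagram J) {c : ℤ} (hc : IsFin J c) {t : ℝ}
    (h : LTUpperSlope J c t) : ∃ s > t, ∃ K ≥ 0, ∀ j k : ℤ, c ≤ j → j ≤ k → IsFin J k →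
      s * (k - j) - K ≤ (edge J j - edge J k : ℝ) := by
  rcases h with ⟨j₀, h0⟩ | ⟨s, hs, K, h⟩
  · have hlt : ∀ j, IsFin J j → j < j₀ := fun j hj => not_le.1 fun hle => by
      obtain ⟨i, hi⟩ := hj.2
      exact hi (hJ.mem_of_le (h0 i) le_rfl hle)
    have h1 : (c : ℝ) ≤ j₀ := by exact_mod_cast (hlt c hc).le
    refine ⟨t + 1, by linarith, |t + 1| * (j₀ - c), mul_nonneg (abs_nonneg _) (by linarith),
      fun j k hj hjk hk => ?_⟩
    have h2 : (edge J k : ℝ) ≤ edge J j := by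
      exact_mod_cast (hc.of_between hJ hk hj hjk).edge_le hJ hk hjk
    have h3 : (j : ℝ) ≤ k := by exact_mod_cast hjk
    have h4 : (c : ℝ) ≤ j := by exact_mod_cast hj
    have h5 : (k : ℝ) ≤ j₀ := by exact_mod_cast (hlt k hk).le
    have h6 : (t + 1) * (k - j : ℝ) ≤ |t + 1| * (j₀ - c) :=
      mul_le_mul (le_abs_self _) (by linarith) (by linarith) (abs_nonneg _)
    linarith
  · exact ⟨s, hs, |K|, abs_nonneg _, fun j k h1 h2 _ => by linarith [h j k h1 h2, le_abs_self K]⟩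

/-- If the slopes are too small on arbitrarily long blocks below row `c`, then `t < δ₋` fails. -/
theorem exists_lower_block (hJ : IsDiagram J) {c : ℤ} (hc : IsFin J c) {t : ℝ}
    (h : ¬ LTLowerSlope J c t) {n : ℕ} (hn : 1 ≤ n) :
    ∃ p, IsFin J p ∧ IsFin J (p + n) ∧ p + n ≤ c ∧
      (edge J p - edge J (p + n) : ℝ) < t * n + 1 := by
  have hE : ∀ j, ∃ i, (i, j) ∈ J := by
    by_contra hE
    push Not at hE
    exact h (Or.inl hE)
  by_contra! h0
  -- If every block of `n` rows dropped by at least `t * n + 1`, the average slope would exceed `t`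
  -- by `1 / n`.
  refine h (Or.inr ⟨(t * n + 1) / n, ?_, |t * n + 1|, ?_⟩)
  · have : (0 : ℝ) < n := by exact_mod_cast hn
    rw [gt_iff_lt, lt_div_iff₀ this]
    linarith
  · refine (forall_lower_iff fun r d => (t * n + 1) / n * r - |t * n + 1| ≤ d).2 ?_
    refine slope_ge_of_step (monotone_lowerSeq hJ hE hc) hn fun i => ?_
    have := h0 (c - i - n) (isFin_of_le hJ hE hc (by omega)) (isFin_of_le hJ hE hc (by omega))
      (by omega)
    simp only [lowerSeq]
    push_cast
    rwa [sub_add_cancel, sub_sub] at this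

theorem exists_upper_block (hJ : IsDiagram J) {c : ℤ} (hc : IsFin J c) {t : ℝ}
    (hF : ∀ j, ∃ i, (i, j) ∉ J)
    (h : ¬ UpperSlopeLT J c t) {n : ℕ} (hn : 1 ≤ n) :
    ∃ p, c ≤ p ∧ t * n - 1 < (edge J p - edge J (p + n) : ℝ) := by
  by_contra! h0
  refine h ⟨hF, (t * n - 1) / n, ?_, t * n - 1, ?_⟩
  · have : (0 : ℝ) < n := by exact_mod_cast hn
    rw [div_lt_iff₀ this]
    linarith
  · refine (forall_upper_iff fun r d => d ≤ (t * n - 1) / n * r + (t * n - 1)).2 ?_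
    refine slope_le_of_step (monotone_upperSeq hJ hF hc) hn fun i => ?_
    have := h0 (c + i) (by omega)
    simp only [upperSeq]
    push_cast
    rw [add_assoc] at this
    linarith

namespace IsShiftModel

variable {H : Type*} [NormedAddCommGroup H] [InnerProductSpace ℂ H] [CompleteSpace H]
  {coef : H →ₗ[ℂ] (ℤ × ℤ → ℂ)} {T₁ T₂ : H →L[ℂ] H}

/-- Over `n` rows the weights are at most `|μ| ^ (s n - K)` on `F` with `s > t`, and at least `|μ| ^
(s n + K)` on `B` with `s < t`. For large `n` both are separated from `|l| ^ n = |μ| ^ (t n)` by a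
factor `2`. -/
theorem notMem_Gamma3_of_slopes (h : IsShiftModel J coef T₁ T₂) (hJ : IsDiagram J) {μ l : ℂ}
    {t : ℝ} (hμ0 : 0 < ‖μ‖) (hμ : ‖μ‖ < 1) (hl : ‖l‖ = ‖μ‖ ^ t) (F B : Set ℤ)
    (hFB : ∀ j, IsFin J j → j ∈ F ∨ j ∈ B) (hF : ∀ j ∈ F, ∀ k ≥ j, k ∈ F)
    (hB : ∀ j ∈ B, ∀ k ≤ j, k ∈ B)
    (hsF : ∃ s > t, ∃ K : ℝ, ∀ j k : ℤ, j ∈ F → j ≤ k → IsFin J j → IsFin J k →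
      s * (k - j) - K ≤ (edge J j - edge J k : ℝ))
    (hsB : ∃ s < t, ∃ K : ℝ, ∀ j k : ℤ, k ∈ B → j ≤ k → IsFin J k → IsFin J j ∧
      (edge J j - edge J k : ℝ) ≤ s * (k - j) + K) : (μ, l) ∉ Gamma3 T₁ T₂ := by
  obtain ⟨s₁, hs₁, K₁, h₁⟩ := hsF
  obtain ⟨s₂, hs₂, K₂, h₂⟩ := hsB
  obtain ⟨M, hM⟩ := exists_pow_lt_of_lt_one (show (0 : ℝ) < 1 / 2 by norm_num) hμ
  -- This `n` makes both exponent gaps larger than `M`, with `|μ| ^ M < 1 / 2`, after the additive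
  -- constants are paid.
  obtain ⟨n, hn⟩ := exists_nat_gt (max ((M + K₁) / (s₁ - t)) ((M + K₂) / (t - s₂)))
  have hn1 := (le_max_left _ _).trans_lt hn
  have hn2 := (le_max_right _ _).trans_lt hn
  rw [div_lt_iff₀ (by linarith)] at hn1 hn2
  have hln : ‖l‖ ^ n = ‖μ‖ ^ (t * n) := by
    rw [hl, Real.rpow_mul_natCast hμ0.le]
  have hM' : ‖μ‖ ^ (M : ℝ) < 1 / 2 := by rwa [Real.rpow_natCast]
  have hcast : ∀ d : ℤ, 0 ≤ d → ‖μ‖ ^ d.toNat = ‖μ‖ ^ (d : ℝ) := fun d hd => by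
    rw [← Real.rpow_natCast]
    congr 1
    exact_mod_cast Int.toNat_of_nonneg hd
  refine notMem_Gamma3_of_weights h hJ hμ n F B hFB (fun j hj => hF j hj _ (by omega))
    (fun j hj => hB j hj _ (by omega)) (D := ‖μ‖ ^ (-(s₂ * n + K₂))) (by positivity)
    (fun _ => norm_pos_iff.1 (by rw [hl]; positivity)) (fun j hj f1 f2 => ?_)
    (fun k hk f1 => ?_) ?_
  · have e1 := f1.edge_le hJ f2 (by omega)
    have e2 := h₁ j (j + n) hj (by omega) f1 f2
    push_cast at e2
    rw [hcast _ (by omega), hln]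
    calc ‖μ‖ ^ ((edge J j - edge J (j + n) : ℤ) : ℝ) ≤ ‖μ‖ ^ (t * n + M) := by
          refine Real.rpow_le_rpow_of_exponent_ge hμ0 hμ.le ?_
          push_cast
          nlinarith
      _ = ‖μ‖ ^ (t * n) * ‖μ‖ ^ (M : ℝ) := Real.rpow_add hμ0 _ _
      _ ≤ ‖μ‖ ^ (t * n) * (1 / 2) := by gcongr
      _ = _ := by ring
  · obtain ⟨f2, e2⟩ := h₂ (k - n) k hk (by omega) f1
    have e1 := f2.edge_le hJ f1 (by omega)
    push_cast at e2
    refine ⟨f2, ?_⟩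
    rw [hcast _ (by omega), ← Real.rpow_add hμ0]
    refine Real.one_le_rpow_of_pos_of_le_one_of_nonpos hμ0 hμ.le ?_
    push_cast
    linarith
  · rw [hln, ← Real.rpow_add hμ0]
    refine (Real.rpow_le_rpow_of_exponent_ge hμ0 hμ.le ?_).trans hM'.le
    linarith

/-- The window estimate in terms of row masses. -/
theorem massBound_of_notMem_Gamma3 (h : IsShiftModel J coef T₁ T₂) (hJ : IsDiagram J) {μ l : ℂ}
    {t : ℝ} (hμ0 : 0 < ‖μ‖) (hμ : ‖μ‖ < 1) (ht : 0 ≤ t) (hl : ‖l‖ = ‖μ‖ ^ t)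
    (hG : (μ, l) ∉ Gamma3 T₁ T₂) : ∃ C, MassBound J ‖μ‖ t C := by
  classical
  obtain ⟨C, hC, hb⟩ := window_bound_of_notMem_Gamma3 h hJ hμ hG
  refine ⟨max 1 C, le_max_left _ _, fun p q hpq hp hq => ?_⟩
  have hy := fun j => rowMass_nonneg (J := J) hμ0 t j
  set x := ‖μ‖ with hx
  have hcast : ∀ d : ℤ, 0 ≤ d → x ^ (2 * d.toNat) = x ^ (2 * (d : ℝ)) := fun d hd => by
    rw [← Real.rpow_natCast]
    congr 1
    push_cast
    congr 1
    exact_mod_cast Int.toNat_of_nonneg hd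
  have hlcast : ∀ d : ℤ, 0 ≤ d → ‖l‖ ^ (2 * d.toNat) = x ^ (t * (2 * (d : ℝ))) := fun d hd => by
    rw [hl, ← Real.rpow_mul_natCast hμ0.le]
    congr 1
    push_cast
    congr 2
    exact_mod_cast Int.toNat_of_nonneg hd
  -- Removes the normalisation of the window test vector: `Z` times its squared modulus in row `j`
  -- is `x ^ (2 * (t * j + M_j))`.
  set Z : ℝ := x ^ (2 * (t * (p + 1) + edge J q)) with hZ
  have hZ0 : 0 < Z := by positivity
  have h1 := hb (p + 1) q (by omega) hp hq
  have h2 : Z * ∑ j ∈ Finset.Icc (p + 1) q, ‖l‖ ^ (2 * (j - (p + 1)).toNat) *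
      x ^ (2 * (edge J j - edge J q).toNat) = ∑ j ∈ Finset.Ioc p q, rowMass J x t j := by
    have e : Finset.Icc (p + 1) q = Finset.Ioc p q := by
      ext j; rw [Finset.mem_Icc, Finset.mem_Ioc]; omega
    rw [e, Finset.mul_sum]
    refine Finset.sum_congr rfl fun j hj => ?_
    rw [Finset.mem_Ioc] at hj
    have f := hp.of_between hJ hq (k := j) (by omega) hj.2
    have e1 := f.edge_le hJ hq hj.2
    rw [rowMass_of_isFin f, hcast _ (by omega), hlcast _ (by omega), hZ, ← Real.rpow_add hμ0,
      ← Real.rpow_add hμ0]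
    congr 1
    push_cast
    ring
  rw [add_sub_cancel_right] at h1
  -- Each end term comes out with a surplus `t` in the exponent, from the window starting at `p +
  -- 1`; it is dropped using `t ≥ 0` and `x < 1`.
  have h3 : Z * (if IsFin J p then x ^ (2 * (edge J p - edge J q).toNat) else 0) ≤
      rowMass J x t p := by
    split_ifs with f
    · have e1 := f.edge_le hJ hq hpq.le
      rw [rowMass_of_isFin f, hcast _ (by omega), hZ, ← Real.rpow_add hμ0]
      refine Real.rpow_le_rpow_of_exponent_ge hμ0 hμ.le ?_
      push_cast
      linarith
    · rw [mul_zero]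
      exact hy p
  have h4 : Z * ‖l‖ ^ (2 * (q - (p + 1) + 1).toNat) ≤ rowMass J x t q := by
    rw [rowMass_of_isFin hq, hlcast _ (by omega), hZ, ← Real.rpow_add hμ0]
    refine Real.rpow_le_rpow_of_exponent_ge hμ0 hμ.le ?_
    push_cast
    linarith
  rw [← h2]
  calc _ ≤ Z * (C * _) := mul_le_mul_of_nonneg_left h1 hZ0.le
    _ = C * (Z * (if IsFin J p then x ^ (2 * (edge J p - edge J q).toNat) else 0) +
        Z * ‖l‖ ^ (2 * (q - (p + 1) + 1).toNat)) := by ring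
    _ ≤ C * (rowMass J x t p + rowMass J x t q) := by gcongr
    _ ≤ _ := by
      have := hy p
      have := hy q
      gcongr
      exact le_max_right _ _

/-- Membership in `Γ₃` of the points of the bidisc with non-zero coordinates. -/
theorem notMem_Gamma3_iff (h : IsShiftModel J coef T₁ T₂) (hJ : IsDiagram J) {μ l : ℂ}
    {t : ℝ} (hμ0 : 0 < ‖μ‖) (hμ : ‖μ‖ < 1) (ht : 0 ≤ t) (hl : ‖l‖ = ‖μ‖ ^ t)
    {c : ℤ} (hc : IsFin J c) : (μ, l) ∉ Gamma3 T₁ T₂ ↔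
      (LTUpperSlope J c t ∧ (LTLowerSlope J c t ∨ LowerSlopeLT J c t)) ∨
        (LowerSlopeLT J c t ∧ UpperSlopeLT J c t) := by
  constructor
  · intro hG
    obtain ⟨C, hM⟩ := h.massBound_of_notMem_Gamma3 hJ hμ0 hμ ht hl hG
    -- The blocks found below violate their slope bound only up to an additive `1`, which costs a
    -- factor `|μ| ^ (-2)` in mass.
    set c₁ : ℝ := ‖μ‖ ^ (-2 : ℝ) with hc₁
    have hc₁1 : 1 ≤ c₁ := Real.one_le_rpow_of_pos_of_le_one_of_nonpos hμ0 hμ.le (by norm_num)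
    obtain ⟨n, hn⟩ := exists_nat_gt (max 1 (4 * C ^ 2 * c₁))
    have hn1 : 1 ≤ n := by
      have := (le_max_left _ _).trans_lt hn
      exact_mod_cast this.le
    have hn2 := (le_max_right _ _).trans_lt hn
    have hlow : ¬ LTLowerSlope J c t → LowerSlopeLT J c t := by
      intro h0
      obtain ⟨p, f1, f2, -, h1⟩ := exists_lower_block hJ hc h0 hn1
      refine LowerSlopeLT.base_change hJ f1 hc
        (hM.lowerSlopeLT_of_block hJ hμ0 hμ hc₁1 (q := p + n) (by omega) f1 f2
          (by push_cast; linarith) ?_)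
      rw [rowMass_of_isFin f1, rowMass_of_isFin f2, hc₁, ← Real.rpow_add hμ0]
      refine Real.rpow_le_rpow_of_exponent_ge hμ0 hμ.le ?_
      push_cast
      linarith
    have hup : ¬ UpperSlopeLT J c t → LTUpperSlope J c t := by
      intro h0
      by_cases hF : ∃ j, ∀ i, (i, j) ∈ J
      · exact Or.inl hF
      push Not at hF
      obtain ⟨p, hp, h1⟩ := exists_upper_block hJ hc hF h0 hn1
      have f1 := isFin_of_ge hJ hF hc hp
      have f2 := isFin_of_ge hJ hF hc (j := p + n) (by omega)
      refine LTUpperSlope.base_change hJ f2 hc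
        (hM.ltUpperSlope_of_block hJ hμ0 hμ hc₁1 (q := p + n) (by omega) f1 f2
          (by push_cast; linarith) ?_)
      rw [rowMass_of_isFin f1, rowMass_of_isFin f2, hc₁, ← Real.rpow_add hμ0]
      refine Real.rpow_le_rpow_of_exponent_ge hμ0 hμ.le ?_
      push_cast
      linarith
    -- Rules out decay of the formal eigenvector at both ends: a long window above `c` is heavier at
    -- one of its ends, and the block lemmas apply to either case.
    have hmid : LowerSlopeLT J c t ∨ LTUpperSlope J c t := by
      by_cases hF : ∃ j, ∀ i, (i, j) ∈ J
      · exact Or.inr (Or.inl hF)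
      push Not at hF
      have f2 := isFin_of_ge hJ hF hc (j := c + n) (by omega)
      have hy := rowMass_nonneg (J := J) hμ0 t
      rcases le_total (rowMass J ‖μ‖ t c) (rowMass J ‖μ‖ t (c + n)) with h1 | h1
      · refine Or.inr (LTUpperSlope.base_change hJ f2 hc
          (hM.ltUpperSlope_of_block hJ hμ0 hμ hc₁1 (q := c + n) (by omega) hc f2
          (by push_cast; linarith) (h1.trans (le_mul_of_one_le_left (hy _) hc₁1))))
      · exact Or.inl (hM.lowerSlopeLT_of_block hJ hμ0 hμ hc₁1 (q := c + n) (by omega) hc f2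
          (by push_cast; linarith) (h1.trans (le_mul_of_one_le_left (hy _) hc₁1)))
    tauto
  -- Growth throughout takes `F` to be all rows, decay throughout takes `B` to be all rows, and the
  -- mixed case splits at `c`. In the first and last cases windows across `c` are cut there and the
  -- constants added.
  · rintro (⟨hU, hL | hL⟩ | ⟨hL, hU⟩)
    · obtain ⟨s₁, hs₁, K₁, hK₁, h₁⟩ := hL.bound hJ hc
      obtain ⟨s₂, hs₂, K₂, hK₂, h₂⟩ := hU.bound hJ hc
      refine h.notMem_Gamma3_of_slopes hJ hμ0 hμ hl Set.univ ∅ (fun _ _ => Or.inl trivial)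
        (fun _ _ _ _ => trivial) (fun _ hj => hj.elim)
        ⟨min s₁ s₂, lt_min hs₁ hs₂, K₁ + K₂, fun j k _ hjk f1 f2 => ?_⟩
        ⟨t - 1, by linarith, 0, fun _ _ hk => hk.elim⟩
      have e : ∀ u v : ℝ, u ≤ v → min s₁ s₂ * (v - u) ≤ s₁ * (v - u) ∧
          min s₁ s₂ * (v - u) ≤ s₂ * (v - u) := fun u v huv =>
        ⟨mul_le_mul_of_nonneg_right (min_le_left _ _) (by linarith),
          mul_le_mul_of_nonneg_right (min_le_right _ _) (by linarith)⟩
      rcases le_total k c with hk | hk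
      · linarith [h₁ j k hjk hk f1, (e j k (by exact_mod_cast hjk)).1]
      rcases le_total c j with hj | hj
      · linarith [h₂ j k hj hjk f2, (e j k (by exact_mod_cast hjk)).2]
      linarith [h₁ j c hj le_rfl f1, h₂ c k le_rfl hk f2, (e j c (by exact_mod_cast hj)).1,
        (e c k (by exact_mod_cast hk)).2]
    · obtain ⟨hE, s₁, hs₁, K₁, h₁⟩ := hL
      obtain ⟨s₂, hs₂, K₂, hK₂, h₂⟩ := hU.bound hJ hc
      refine h.notMem_Gamma3_of_slopes hJ hμ0 hμ hl (Set.Ici c) (Set.Iic c)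
        (fun j _ => le_total c j) (fun j hj k hk => le_trans hj hk) (fun j hj k hk => le_trans hk hj)
        ⟨s₂, hs₂, K₂, fun j k hj hjk _ f2 => h₂ j k hj hjk f2⟩
        ⟨s₁, hs₁, K₁, fun j k hk hjk f1 => ⟨isFin_of_le hJ hE hc (hjk.trans hk), h₁ j k hjk hk⟩⟩
    · obtain ⟨hE, s₁, hs₁, K₁, h₁⟩ := hL
      obtain ⟨hF, s₂, hs₂, K₂, h₂⟩ := hU
      refine h.notMem_Gamma3_of_slopes hJ hμ0 hμ hl ∅ Set.univ (fun _ _ => Or.inr trivial)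
        (fun _ hj => hj.elim) (fun _ _ _ _ => trivial)
        ⟨t + 1, by linarith, 0, fun _ _ hj => hj.elim⟩
        ⟨max s₁ s₂, max_lt hs₁ hs₂, |K₁| + |K₂|, fun j k _ hjk f2 => ⟨?_, ?_⟩⟩
      · rcases le_total j c with hj | hj
        · exact isFin_of_le hJ hE hc hj
        · exact isFin_of_ge hJ hF hc hj
      have e : ∀ u v : ℝ, u ≤ v → s₁ * (v - u) ≤ max s₁ s₂ * (v - u) ∧
          s₂ * (v - u) ≤ max s₁ s₂ * (v - u) := fun u v huv =>
        ⟨mul_le_mul_of_nonneg_right (le_max_left _ _) (by linarith),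
          mul_le_mul_of_nonneg_right (le_max_right _ _) (by linarith)⟩
      have a1 := le_abs_self K₁
      have a2 := le_abs_self K₂
      have a3 := abs_nonneg K₁
      have a4 := abs_nonneg K₂
      rcases le_total k c with hk | hk
      · linarith [h₁ j k hjk hk, (e j k (by exact_mod_cast hjk)).1]
      rcases le_total c j with hj | hj
      · linarith [h₂ j k hj hjk, (e j k (by exact_mod_cast hjk)).2]
      linarith [h₁ j c hj le_rfl, h₂ c k le_rfl hk, (e j c (by exact_mod_cast hj)).1,
        (e c k (by exact_mod_cast hk)).2]

end IsShiftModel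

end Interior

section Flats

variable {J : Set (ℤ × ℤ)}

/-! ### Flat pieces and slopes -/

/-- Horizontal segments are jumps of the edge between consecutive rows. Bounded jumps add up to a
linear bound, and a linear bound limits each jump. An empty row below a finite one is an infinite
jump; the passage to a full row is excluded from the count. -/
theorem hasLongHorizontalEnd_iff (hJ : IsDiagram J) {c : ℤ} (hc : IsFin J c) :
    HasLongHorizontalEnd J ↔ (∀ t, ¬ LowerSlopeLT J c t) ∨
      ((∀ j, ∃ i, (i, j) ∉ J) ∧ ∀ t, ¬ UpperSlopeLT J c t) := by
  rw [← not_iff_not]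
  push Not
  constructor
  · intro h
    simp only [HasLongHorizontalEnd] at h
    push Not at h
    obtain ⟨N, hN⟩ := h
    have hstep : ∀ j, IsFin J j → (edge J j + N, j - 1) ∈ J := by
      intro j hj
      by_contra h0
      obtain ⟨i, hi⟩ := hj.2
      exact hi (hN _ _ (hj.edge_mem hJ) h0 i)
    have hfin : ∀ j ≤ c, IsFin J j := by
      intro j hj
      induction j, hj using Int.leInductionDown with
      | base => exact hc
      | pred j hj ih =>
        obtain ⟨i, hi⟩ := hc.2
        exact ⟨⟨_, hstep j ih⟩, i, fun h => hi (hJ.mem_of_le h le_rfl (by omega))⟩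
    have hE : ∀ j, ∃ i, (i, j) ∈ J := fun j => by
      rcases le_total j c with hj | hj
      · exact (hfin j hj).1
      · exact ⟨_, hJ.mem_of_le (hc.edge_mem hJ) le_rfl hj⟩
    have hjump : ∀ j, IsFin J j → IsFin J (j - 1) → (edge J (j - 1) : ℝ) ≤ edge J j + N := by
      intro j hj hj1
      exact_mod_cast (hj1.mem_iff hJ _).1 (hstep j hj)
    refine ⟨⟨(N : ℝ) / (1 : ℕ) + 1, hE, (N : ℝ) / (1 : ℕ), by linarith, N, ?_⟩, fun hF =>
      ⟨(N : ℝ) / (1 : ℕ) + 1, hF, (N : ℝ) / (1 : ℕ), by linarith, N, ?_⟩⟩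
    · refine (forall_lower_iff fun r d => d ≤ (N : ℝ) / (1 : ℕ) * r + N).2 ?_
      refine slope_le_of_step (monotone_lowerSeq hJ hE hc) le_rfl fun i => ?_
      have := hjump (c - i) (hfin _ (by omega)) (hfin _ (by omega))
      simp only [lowerSeq]
      push_cast
      rw [sub_sub] at this
      linarith
    · refine (forall_upper_iff fun r d => d ≤ (N : ℝ) / (1 : ℕ) * r + N).2 ?_
      refine slope_le_of_step (monotone_upperSeq hJ hF hc) le_rfl fun i => ?_
      have := hjump (c + i + 1) (isFin_of_ge hJ hF hc (by omega)) (isFin_of_ge hJ hF hc (by omega))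
      simp only [upperSeq]
      push_cast
      rw [add_sub_cancel_right, add_assoc] at this
      linarith
  · rintro ⟨⟨t, hE, s₁, -, K₁, h₁⟩, hU⟩
    have hD : ∃ D : ℝ, ∀ k > c, IsFin J k → (edge J (k - 1) - edge J k : ℝ) ≤ D := by
      by_cases hF : ∀ j, ∃ i, (i, j) ∉ J
      · obtain ⟨t, -, s, -, K, h⟩ := hU hF
        refine ⟨s + K, fun k hk _ => ?_⟩
        have := h (k - 1) k (by omega) (by omega)
        push_cast at this
        linarith
      · push Not at hF
        obtain ⟨q, hq⟩ := hF
        -- Under a full row there is a last finite row `m`, and the total drop from `c` to `m`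
        -- bounds every jump in between.
        obtain ⟨m, hm, hmax⟩ := Int.exists_greatest_of_bdd (P := fun k => IsFin J k)
          ⟨q, fun k hk => not_lt.1 fun hlt => by
            obtain ⟨i, hi⟩ := hk.2
            exact hi (hJ.mem_of_le (hq i) le_rfl hlt.le)⟩ ⟨c, hc⟩
        refine ⟨edge J c - edge J m, fun k hk hkf => ?_⟩
        have e1 := hkf.edge_le hJ hm (hmax k hkf)
        have e2 := hc.edge_le hJ (hc.of_between hJ hkf (k := k - 1) (by omega) (by omega)) (by omega)
        have e1' : (edge J m : ℝ) ≤ edge J k := by exact_mod_cast e1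
        have e2' : (edge J (k - 1) : ℝ) ≤ edge J c := by exact_mod_cast e2
        linarith
    obtain ⟨D, hD⟩ := hD
    intro hL
    obtain ⟨N, hN⟩ := exists_nat_ge (max D (s₁ + K₁))
    obtain ⟨i, j, h2, h3, h4⟩ := hL N
    have hj : IsFin J j := ⟨⟨i, h2⟩, h4⟩
    have hj1 : IsFin J (j - 1) := ⟨hE _, by
      obtain ⟨i', hi'⟩ := h4
      exact ⟨i', fun h => hi' (hJ.mem_of_le h le_rfl (by omega))⟩⟩
    have h5 : (edge J (j - 1) - edge J j : ℝ) ≤ N := by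
      rcases le_or_gt j c with hjc | hjc
      · have := h₁ (j - 1) j (by omega) hjc
        push_cast at this
        linarith [le_max_right D (s₁ + K₁)]
      · exact (hD j hjc hj).trans ((le_max_left _ _).trans hN)
    have h6 : edge J (j - 1) - edge J j ≤ N := by exact_mod_cast h5
    have h7 := (hj.mem_iff hJ i).1 h2
    exact h3 ((hj1.mem_iff hJ _).2 (by omega))

/-- A diagram without full rows, with a full column, has a finite row whose first element lies in a
column that is not full, unless it is a half-plane. -/
theorem exists_edge_column_not_full (hJ : IsDiagram J) (hns : ¬ IsSimple J) {c : ℤ}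
    (hc : IsFin J c) (hF : ∀ j, ∃ i, (i, j) ∉ J) :
    ∃ c', IsFin J c' ∧ ∃ j', (edge J c', j') ∉ J := by
  by_contra! h
  refine hns (Or.inr (Or.inr (Or.inl ⟨(edge J c - 1, 0), ?_⟩)))
  have hfin : ∀ j, IsFin J j := fun j => ⟨⟨_, h c hc j⟩, hF j⟩
  have hedge : ∀ j, edge J j = edge J c := fun j =>
    le_antisymm (((hfin j).mem_iff hJ _).1 (h c hc j))
      (((hfin c).mem_iff hJ _).1 (h j (hfin j) c))
  ext ⟨i, j⟩
  rw [(hfin j).mem_iff hJ, hedge]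
  constructor
  · intro hi
    exact ⟨(i - edge J c + 1, j), by simp; omega, by ext <;> simp⟩
  · rintro ⟨⟨i', j'⟩, h1, h2⟩
    simp only [Set.mem_ofPred_eq, Prod.mk_add_mk, Prod.mk.injEq] at h1 h2
    omega

/-- If segments are shorter than `N`, the edge moves left at least once in `N` rows, so slopes are
at least `1 / N`; a positive slope conversely bounds the segments. When full columns exist, the
non-full columns give no condition far below, which removes the lower parameter. Non-simplicity
ensures that the upper boundary meets a non-full column. -/
theorem hasLongVerticalEnd_iff (hJ : IsDiagram J) (hns : ¬ IsSimple J) {c : ℤ} (hc : IsFin J c) :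
    HasLongVerticalEnd J ↔ ¬ LTUpperSlope J c 0 ∨
      ((∀ i, ∃ j, (i, j) ∉ J) ∧ ¬ LTLowerSlope J c 0) := by
  rw [← not_iff_not]
  push Not
  constructor
  · intro h
    simp only [HasLongVerticalEnd] at h
    push Not at h
    obtain ⟨N, hN⟩ := h
    -- `N = 0` would put the point to the left of an edge into `J`.
    have hN1 : ∀ j, IsFin J j → (∃ j', (edge J j, j') ∉ J) → 1 ≤ N := by
      rintro j hj ⟨j', hj'⟩
      by_contra h0
      have : (edge J j - 1, j + N) ∈ J := by
        by_contra h1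
        exact hj' (hN _ _ (hj.edge_mem hJ) h1 j')
      rw [show (N : ℤ) = 0 by omega, add_zero, hj.mem_iff hJ] at this
      omega
    have hstep : ∀ j, IsFin J j → (∃ j', (edge J j, j') ∉ J) → IsFin J (j + N) →
        (1 : ℝ) ≤ edge J j - edge J (j + N) := by
      rintro j hj ⟨j', hj'⟩ hjN
      have : (edge J j - 1, j + N) ∈ J := by
        by_contra h1
        exact hj' (hN _ _ (hj.edge_mem hJ) h1 j')
      rw [hjN.mem_iff hJ] at this
      have h2 : 1 ≤ edge J j - edge J (j + N) := by omega
      exact_mod_cast h2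
    constructor
    · by_cases hF : ∃ j, ∀ i, (i, j) ∈ J
      · exact Or.inl hF
      push Not at hF
      obtain ⟨c', hc', j', hj'⟩ := exists_edge_column_not_full hJ hns hc hF
      have hn1 := hN1 c' hc' ⟨j', hj'⟩
      have hn0 : (0 : ℝ) < N := by exact_mod_cast hn1
      refine LTUpperSlope.base_change hJ hc' hc (Or.inr ⟨1 / N, by positivity, |1|, ?_⟩)
      refine (forall_upper_iff fun r d => 1 / (N : ℝ) * r - |1| ≤ d).2 ?_
      refine slope_ge_of_step (monotone_upperSeq hJ hF hc') hn1 fun i => ?_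
      have f1 := isFin_of_ge hJ hF hc' (j := c' + i) (by omega)
      have := hstep (c' + i) f1 ⟨j', fun h => hj' (hJ.mem_of_le h
        (hc'.edge_le hJ f1 (by omega)) le_rfl)⟩ (isFin_of_ge hJ hF hc' (by omega))
      simp only [upperSeq]
      push_cast
      rw [add_assoc] at this
      linarith
    · intro hC
      by_cases hE : ∃ j, ∀ i, (i, j) ∉ J
      · exact Or.inl hE
      push Not at hE
      have hn1 := hN1 c hc (hC _)
      have hn0 : (0 : ℝ) < N := by exact_mod_cast hn1
      refine Or.inr ⟨1 / N, by positivity, |1|, ?_⟩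
      refine (forall_lower_iff fun r d => 1 / (N : ℝ) * r - |1| ≤ d).2 ?_
      refine slope_ge_of_step (monotone_lowerSeq hJ hE hc) hn1 fun i => ?_
      have := hstep (c - i - N) (isFin_of_le hJ hE hc (by omega)) (hC _)
        (isFin_of_le hJ hE hc (by omega))
      simp only [lowerSeq]
      push_cast
      rw [sub_add_cancel, sub_sub] at this
      linarith
  · rintro ⟨hU, hL⟩ hV
    obtain ⟨s, hs, K, -, h⟩ := hU.bound hJ hc
    obtain ⟨n₁, hn₁⟩ := exists_nat_gt (K / s)
    rw [div_lt_iff₀ hs] at hn₁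
    have hup : ∀ i j : ℤ, c ≤ j → (i, j) ∈ J → (i - 1, j + n₁) ∈ J := by
      intro i j hj hij
      by_cases hfull : ∀ i, (i, j + n₁) ∈ J
      · exact hfull _
      push Not at hfull
      have f2 : IsFin J (j + n₁) := ⟨⟨i, hJ.mem_of_le hij le_rfl (by omega)⟩, hfull⟩
      have f1 := hc.of_between hJ f2 hj (by omega)
      have h1 := h j (j + n₁) hj (by omega) f2
      push_cast at h1
      have h2 : (0 : ℝ) < edge J j - edge J (j + n₁) := by linarith
      have h3 : 0 < edge J j - edge J (j + n₁) := by exact_mod_cast h2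
      have h4 := (f1.mem_iff hJ i).1 hij
      exact (f2.mem_iff hJ _).2 (by omega)
    by_cases hC : ∀ i, ∃ j, (i, j) ∉ J
    · obtain ⟨s', hs', K', -, h'⟩ := (hL hC).bound hJ hc
      obtain ⟨n₂, hn₂⟩ := exists_nat_gt (K' / s')
      rw [div_lt_iff₀ hs'] at hn₂
      obtain ⟨i, j, h1, h2, -⟩ := hV (n₁ + n₂)
      push_cast at h2
      rcases le_or_gt (j + n₂) c with h3 | h3
      · obtain ⟨i', hi'⟩ := hc.2
        have f1 : IsFin J j := ⟨⟨i, h1⟩, i', fun h => hi' (hJ.mem_of_le h le_rfl (by omega))⟩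
        have f2 := f1.of_between hJ hc (k := j + n₂) (by omega) h3
        have h4 := h' j (j + n₂) (by omega) h3 f1
        push_cast at h4
        have h5 : (0 : ℝ) < edge J j - edge J (j + n₂) := by linarith
        have h6 : 0 < edge J j - edge J (j + n₂) := by exact_mod_cast h5
        have h7 := (f1.mem_iff hJ i).1 h1
        exact h2 (hJ.mem_of_le ((f2.mem_iff hJ (i - 1)).2 (by omega)) le_rfl (by omega))
      · have h4 := hup i (j + n₂) h3.le (hJ.mem_of_le h1 le_rfl (by omega))
        exact h2 (by convert h4 using 2; ring)
    · push Not at hC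
      obtain ⟨i₀, hi₀⟩ := hC
      obtain ⟨i₁, j₁, -, -, j₁', h1⟩ := hV 0
      -- The rightmost non-full column `m` misses row `jm`, so every segment along a non-full column
      -- starts above `jm`. It reaches row `c` within `c - jm` rows and then obeys the upper bound.
      obtain ⟨m, ⟨jm, hm⟩, hmax⟩ := Int.exists_greatest_of_bdd (P := fun i => ∃ j, (i, j) ∉ J)
        ⟨i₀, fun i ⟨j, hij⟩ => not_lt.1 fun hlt => hij (hJ.mem_of_le (hi₀ j) hlt.le le_rfl)⟩
        ⟨i₁, j₁', h1⟩
      obtain ⟨i, j, h2, h3, h4⟩ := hV (n₁ + (c - jm).toNat)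
      have h5 : jm < j := not_le.1 fun hle => hm (hJ.mem_of_le h2 (hmax i h4) hle)
      have h6 := hup i (j + (c - jm).toNat) (by omega) (hJ.mem_of_le h2 le_rfl (by omega))
      push_cast at h3
      exact h3 (by convert h6 using 2; ring)

/-! ### Simple diagrams, corners and full rows -/

theorem IsSimple.of_swap (h : IsSimple (Prod.swap ⁻¹' J)) : IsSimple J := by
  have key : ∀ S : Set (ℤ × ℤ), TranslationEquiv (Prod.swap ⁻¹' J) S →
      TranslationEquiv J (Prod.swap ⁻¹' S) := by
    rintro S ⟨v, hv⟩
    refine ⟨v.swap, ?_⟩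
    ext p
    have h1 : p ∈ J ↔ p.swap ∈ Prod.swap ⁻¹' J := by simp
    rw [h1, hv]
    constructor
    · rintro ⟨q, hq, hqp⟩
      exact ⟨q.swap, by simpa using hq, by
        show v.swap + q.swap = p
        rw [← Prod.swap_add]
        exact (congrArg Prod.swap hqp).trans (Prod.swap_swap p)⟩
    · rintro ⟨q, hq, hqp⟩
      exact ⟨q.swap, hq, by rw [← hqp, Prod.swap_add, Prod.swap_swap]⟩
  rcases h with h | h | h | h
  · exact Or.inl (key _ h)
  · refine Or.inr (Or.inl ?_)
    have := key _ h
    convert this using 1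
    ext p
    exact and_comm
  · exact Or.inr (Or.inr (Or.inr (key _ h)))
  · exact Or.inr (Or.inr (Or.inl (key _ h)))

/-- Otherwise every row is empty or full, and `J` is the plane or an upper half-plane. -/
theorem exists_isFin (hJ : IsDiagram J) (hne : J.Nonempty) (hns : ¬ IsSimple J) :
    ∃ c, IsFin J c := by
  by_contra! h
  have hfull : ∀ i j, (i, j) ∈ J → ∀ i', (i', j) ∈ J := by
    intro i j hij
    by_contra! h0
    exact h j ⟨⟨i, hij⟩, h0⟩
  obtain ⟨⟨i₀, j₀⟩, h0⟩ := hne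
  by_cases hE : ∃ j, (0, j) ∉ J
  · obtain ⟨j₁, h1⟩ := hE
    obtain ⟨m, hm, hmin⟩ := Int.exists_least_of_bdd (P := fun j => (0, j) ∈ J)
      ⟨j₁, fun j hj => not_lt.1 fun hlt => h1 (hJ.mem_of_le hj le_rfl hlt.le)⟩
      ⟨j₀, hfull _ _ h0 0⟩
    refine hns (Or.inr (Or.inr (Or.inr ⟨(0, m - 1), ?_⟩)))
    ext ⟨i, j⟩
    constructor
    · intro hij
      have := hmin j (hfull _ _ hij 0)
      exact ⟨(i, j - m + 1), by simp; omega, by ext <;> simp⟩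
    · rintro ⟨⟨i', j'⟩, h2, h3⟩
      simp only [Set.mem_ofPred_eq, Prod.mk_add_mk, Prod.mk.injEq] at h2 h3
      exact hfull _ _ (hJ.mem_of_le hm le_rfl (by omega)) _
  · push Not at hE
    refine hns (Or.inl ⟨0, ?_⟩)
    ext ⟨i, j⟩
    simp [hfull _ _ (hE j) i]

/-- Descend along the column of an edge point. Its left neighbours stay outside `J`, so in the
absence of a corner the descent never ends and the column is full. -/
theorem exists_corner_of_no_full_column (hJ : IsDiagram J) {c : ℤ} (hc : IsFin J c)
    (hC : ∀ i, ∃ j, (i, j) ∉ J) : ∃ i j : ℤ, (i, j) ∈ J ∧ (i - 1, j) ∉ J ∧ (i, j - 1) ∉ J := by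
  by_contra! h
  obtain ⟨j₁, h1⟩ := hC (edge J c)
  have key : ∀ j ≤ c, (edge J c, j) ∈ J := by
    intro j hj
    induction j, hj using Int.leInductionDown with
    | base => exact hc.edge_mem hJ
    | pred j hj ih =>
      refine h _ _ ih fun h2 => ?_
      have := (hc.mem_iff hJ _).1 (hJ.mem_of_le h2 le_rfl hj)
      omega
  rcases le_total j₁ c with h2 | h2
  · exact h1 (key j₁ h2)
  · exact h1 (hJ.mem_of_le (hc.edge_mem hJ) le_rfl h2)

theorem exists_corner (hJ : IsDiagram J) (hne : J.Nonempty) (hns : ¬ IsSimple J)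
    (h : (∀ i, ∃ j, (i, j) ∉ J) ∨ ∀ j, ∃ i, (i, j) ∉ J) :
    ∃ i j : ℤ, (i, j) ∈ J ∧ (i - 1, j) ∉ J ∧ (i, j - 1) ∉ J := by
  rcases h with h | h
  · obtain ⟨c, hc⟩ := exists_isFin hJ hne hns
    exact exists_corner_of_no_full_column hJ hc h
  · have hne' : (Prod.swap ⁻¹' J).Nonempty := by
      obtain ⟨p, hp⟩ := hne
      exact ⟨p.swap, by simpa using hp⟩
    obtain ⟨c, hc⟩ := exists_isFin hJ.swap hne' fun h => hns h.of_swap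
    obtain ⟨i, j, h1, h2, h3⟩ := exists_corner_of_no_full_column hJ.swap hc h
    exact ⟨j, i, h1, h3, h2⟩

/-- There is a leftmost full column. Its left neighbour misses a point, hence everything below that
point, and the boundary contains a vertical half-line. -/
theorem hasLongVertical_of_full_column (hJ : IsDiagram J) (hne : J.Nonempty) (hns : ¬ IsSimple J)
    (h : ∃ i, ∀ j, (i, j) ∈ J) : HasLongVertical J := by
  have hne' : (Prod.swap ⁻¹' J).Nonempty := by
    obtain ⟨p, hp⟩ := hne
    exact ⟨p.swap, by simpa using hp⟩
  obtain ⟨i₁, -, j₁, h1⟩ := exists_isFin hJ.swap hne' fun h => hns h.of_swap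
  obtain ⟨m, hm, hmin⟩ := Int.exists_least_of_bdd (P := fun i => ∀ j, (i, j) ∈ J)
    ⟨i₁, fun i hi => not_lt.1 fun hlt => h1 (hJ.mem_of_le (hi j₁) hlt.le le_rfl)⟩ h
  have h2 : ∃ j, (m - 1, j) ∉ J := by
    by_contra! h2
    have := hmin _ h2
    omega
  obtain ⟨j, hj⟩ := h2
  exact fun n => ⟨m, j - n, hm _, by rwa [sub_add_cancel]⟩

theorem hasLongHorizontal_of_full_row (hJ : IsDiagram J) (hne : J.Nonempty) (hns : ¬ IsSimple J)
    (h : ∃ j, ∀ i, (i, j) ∈ J) : HasLongHorizontal J := by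
  have hne' : (Prod.swap ⁻¹' J).Nonempty := by
    obtain ⟨p, hp⟩ := hne
    exact ⟨p.swap, by simpa using hp⟩
  exact hasLongVertical_swap.1
    (hasLongVertical_of_full_column hJ.swap hne' (fun h => hns h.of_swap) h)

theorem hasLongVertical_iff_of_no_full_column (hC : ∀ i, ∃ j, (i, j) ∉ J) :
    HasLongVertical J ↔ HasLongVerticalEnd J :=
  forall_congr' fun _ => exists_congr fun i => exists_congr fun _ =>
    and_congr_right fun _ => (and_iff_left (hC i)).symm

theorem hasLongHorizontal_iff_of_no_full_row (hF : ∀ j, ∃ i, (i, j) ∉ J) :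
    HasLongHorizontal J ↔ HasLongHorizontalEnd J :=
  forall_congr' fun _ => exists_congr fun _ => exists_congr fun j =>
    and_congr_right fun _ => (and_iff_left (hF j)).symm

/-- With a full column, the boundary is eventually vertical downwards. -/
theorem lowerSlopeLT_of_full_column (hJ : IsDiagram J) {c : ℤ} (hc : IsFin J c)
    (h : ∃ i, ∀ j, (i, j) ∈ J) {t : ℝ} (ht : 0 < t) : LowerSlopeLT J c t := by
  obtain ⟨i₀, hi₀⟩ := h
  have hE : ∀ j, ∃ i, (i, j) ∈ J := fun j => ⟨i₀, hi₀ j⟩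
  refine ⟨hE, 0, ht, i₀ - edge J c, fun j k hjk hk => ?_⟩
  have f1 := isFin_of_le hJ hE hc (hjk.trans hk)
  have f2 := isFin_of_le hJ hE hc hk
  have e1 : (edge J j : ℝ) ≤ i₀ := by exact_mod_cast (f1.mem_iff hJ _).1 (hi₀ j)
  have e2 : (edge J c : ℝ) ≤ edge J k := by exact_mod_cast f2.edge_le hJ hc hk
  linarith

theorem not_ltLowerSlope_of_lowerSlopeLT {c : ℤ} {t : ℝ} (h1 : LowerSlopeLT J c t) :
    ¬ LTLowerSlope J c t := by
  obtain ⟨hE, s, hs, K, h⟩ := h1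
  rintro (⟨j, hj⟩ | ⟨s', hs', K', h'⟩)
  · obtain ⟨i, hi⟩ := hE j
    exact hj i hi
  obtain ⟨n, hn⟩ := exists_nat_gt ((K + K') / (s' - s))
  rw [div_lt_iff₀ (by linarith)] at hn
  have h2 := h (c - n) c (by omega) le_rfl
  have h3 := h' (c - n) c (by omega) le_rfl
  push_cast at h2 h3
  nlinarith

theorem not_ltUpperSlope_of_upperSlopeLT {c : ℤ} {t : ℝ} (h1 : UpperSlopeLT J c t) :
    ¬ LTUpperSlope J c t := by
  obtain ⟨hF, s, hs, K, h⟩ := h1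
  rintro (⟨j, hj⟩ | ⟨s', hs', K', h'⟩)
  · obtain ⟨i, hi⟩ := hF j
    exact hi (hj i)
  obtain ⟨n, hn⟩ := exists_nat_gt ((K + K') / (s' - s))
  rw [div_lt_iff₀ (by linarith)] at hn
  have h2 := h c (c + n) le_rfl (by omega)
  have h3 := h' c (c + n) le_rfl (by omega)
  push_cast at h2 h3
  nlinarith

theorem ltLowerSlope_of_neg (hJ : IsDiagram J) {c : ℤ} (hc : IsFin J c) {t : ℝ} (ht : t < 0) :
    LTLowerSlope J c t := by
  by_cases hE : ∃ j, ∀ i, (i, j) ∉ J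
  · exact Or.inl hE
  push Not at hE
  refine Or.inr ⟨0, ht, 0, fun j k hjk hk => ?_⟩
  have : (edge J k : ℝ) ≤ edge J j := by
    exact_mod_cast (isFin_of_le hJ hE hc (hjk.trans hk)).edge_le hJ (isFin_of_le hJ hE hc hk) hjk
  linarith

theorem ltUpperSlope_of_neg (hJ : IsDiagram J) {c : ℤ} (hc : IsFin J c) {t : ℝ} (ht : t < 0) :
    LTUpperSlope J c t := by
  by_cases hF : ∃ j, ∀ i, (i, j) ∈ J
  · exact Or.inl hF
  push Not at hF
  refine Or.inr ⟨0, ht, 0, fun j k hj hjk => ?_⟩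
  have : (edge J k : ℝ) ≤ edge J j := by
    exact_mod_cast (isFin_of_ge hJ hF hc hj).edge_le hJ (isFin_of_ge hJ hF hc (hj.trans hjk)) hjk
  linarith

end Flats

section HJModel

open ComplexConjugate

variable {J : Set (ℤ × ℤ)}

/-! ### The space `H_J` as a model -/

/-- The Fourier coefficients of the elements of `H_J`. -/
def coefHJ (J : Set (ℤ × ℤ)) : HJ J →ₗ[ℂ] (ℤ × ℤ → ℂ) where
  toFun f p := coeffAt f p
  map_add' f g := by
    ext p
    simp only [coeffAt_eq_repr, Submodule.coe_add, Pi.add_apply]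
    erw [map_add]
    rfl
  map_smul' c f := by
    ext p
    simp only [coeffAt_eq_repr, Submodule.coe_smul, Pi.smul_apply, RingHom.id_apply]
    erw [map_smul]
    rfl

theorem hasSum_coeffAt (f g : L2Torus) :
    HasSum (fun p => conj (coeffAt f p) * coeffAt g p) (inner ℂ f g) := by
  have h1 := lp.hasSum_inner (𝕜 := ℂ) (G := fun _ : Fin 2 → ℤ => ℂ)
    (UnitAddTorus.mFourierBasis.repr f) (UnitAddTorus.mFourierBasis.repr g)
  rw [LinearIsometryEquiv.inner_map_map] at h1
  have h2 := (finTwoArrowEquiv ℤ).symm.hasSum_iff.2 h1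
  have h3 : (fun p => conj (coeffAt f p) * coeffAt g p) =
      (fun i => inner ℂ (UnitAddTorus.mFourierBasis.repr f i)
        (UnitAddTorus.mFourierBasis.repr g i)) ∘ (finTwoArrowEquiv ℤ).symm := by
    ext p
    rw [coeffAt_eq_repr, coeffAt_eq_repr, mul_comm]
    rfl
  rw [h3]
  exact h2

theorem isShiftModel_HJ (hJ : IsDiagram J) : IsShiftModel J (coefHJ J) (Mw hJ) (Mz hJ) where
  hasSum_inner x y := hasSum_coeffAt x.1 y.1
  coef_of_notMem x p hp := x.2 p hp
  exists_coef_eq c hc hs := by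
    have hmem : Memℓp (fun n : Fin 2 → ℤ => c (finTwoArrowEquiv ℤ n)) 2 := by
      rw [memℓp_gen_iff (by norm_num)]
      have := (finTwoArrowEquiv ℤ).summable_iff.2 hs
      simpa [Function.comp_def] using this
    have hcoef : ∀ p, coeffAt (UnitAddTorus.mFourierBasis.repr.symm ⟨_, hmem⟩) p = c p := by
      intro p
      rw [coeffAt_eq_repr, LinearIsometryEquiv.apply_symm_apply]
      rfl
    refine ⟨⟨UnitAddTorus.mFourierBasis.repr.symm ⟨_, hmem⟩, fun p hp => ?_⟩, ?_⟩
    · rw [hcoef, hc p hp]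
    · ext p
      exact hcoef p
  coef_fst x p := by
    have := coeffAt_mulMonomial (1, 0) p x.1
    rwa [show p - (1, 0) = (p.1 - 1, p.2) by ext <;> simp] at this
  coef_snd x p := by
    have := coeffAt_mulMonomial (0, 1) p x.1
    rwa [show p - (0, 1) = (p.1, p.2 - 1) by ext <;> simp] at this

theorem isClosed_HJ (J : Set (ℤ × ℤ)) : IsClosed (HJ J : Set L2Torus) := by
  have h : (HJ J : Set L2Torus) = ⋂ p ∈ Jᶜ, {f | coeffAt f p = 0} := by
    ext f
    simp [HJ]
  rw [h]
  refine isClosed_biInter fun p _ => isClosed_eq ?_ continuous_const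
  simp_rw [coeffAt_eq_repr, HilbertBasis.repr_apply_apply]
  fun_prop

instance completeSpace_HJ (J : Set (ℤ × ℤ)) : CompleteSpace (HJ J) :=
  (isClosed_HJ J).completeSpace_coe

end HJModel

/-! ### Wold decompositions -/

section Wold

variable {J : Set (ℤ × ℤ)} {H : Type*} [NormedAddCommGroup H] [InnerProductSpace ℂ H]
  {coef : H →ₗ[ℂ] (ℤ × ℤ → ℂ)} {T₁ T₂ : H →L[ℂ] H}

namespace IsShiftModel

/-- Range of `T₁ ^ n` means that the coefficients can be moved left by `n` within `J`. For all `n`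
at once this confines the support to full rows. -/
theorem mem_woldUnitary_iff (h : IsShiftModel J coef T₁ T₂) (hJ : IsDiagram J) (x : H) :
    x ∈ woldUnitary T₁ ↔ ∀ p, coef x p ≠ 0 → ∀ i, (i, p.2) ∈ J := by
  simp only [woldUnitary, Submodule.mem_iInf]
  constructor
  · intro hx p hp i
    obtain ⟨u, hu⟩ := hx (p.1 - i).toNat
    have h1 : coef x p = coef u (p.1 - (p.1 - i).toNat, p.2) := by
      rw [← hu]
      exact h.coef_fst_pow _ u p
    by_contra h2
    refine hp (h1.trans (h.coef_of_notMem u fun h3 => h2 (hJ.mem_of_le h3 ?_ le_rfl)))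
    omega
  · intro hx n
    obtain ⟨u, hu⟩ := h.exists_coef_eq (fun p => coef x (p.1 + n, p.2))
      (fun p hp => by
        by_contra h1
        exact hp (hx _ h1 p.1))
      (by
        have := ((Equiv.addRight (n : ℤ)).prodCongr (Equiv.refl ℤ)).summable_iff.2
          (h.hasSum_norm_sq x).summable
        exact this)
    refine ⟨u, h.coef_injective ?_⟩
    ext p
    refine (h.coef_fst_pow n u p).trans ?_
    rw [hu]
    simp

theorem woldUnitary_eq_bot_iff (h : IsShiftModel J coef T₁ T₂) (hJ : IsDiagram J) :
    woldUnitary T₁ = ⊥ ↔ ∀ j, ∃ i, (i, j) ∉ J := by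
  constructor
  · intro hbot
    by_contra! h0
    obtain ⟨j, hj⟩ := h0
    obtain ⟨x, hx⟩ := h.exists_single (hj 0)
    have h1 : x ∈ woldUnitary T₁ := (h.mem_woldUnitary_iff hJ x).2 fun p hp => by
      rw [hx] at hp
      have : p = (0, j) := by
        by_contra h2
        exact hp (Pi.single_eq_of_ne h2 _)
      rw [this]
      exact hj
    rw [hbot, Submodule.mem_bot] at h1
    rw [h1, map_zero] at hx
    simpa using congrFun hx (0, j)
  · intro h0
    rw [Submodule.eq_bot_iff]
    intro x hx
    rw [h.mem_woldUnitary_iff hJ] at hx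
    refine h.coef_injective ?_
    ext p
    rw [map_zero]
    by_contra h1
    obtain ⟨i, hi⟩ := h0 p.2
    exact hi (hx p h1 i)

theorem woldUnitary_ne_top (h : IsShiftModel J coef T₁ T₂) (hJ : IsDiagram J) {c : ℤ}
    (hc : IsFin J c) : woldUnitary T₁ ≠ ⊤ := by
  intro htop
  obtain ⟨x, hx⟩ := h.exists_single (hc.edge_mem hJ)
  have h1 : x ∈ woldUnitary T₁ := htop ▸ Submodule.mem_top
  rw [h.mem_woldUnitary_iff hJ] at h1
  obtain ⟨i, hi⟩ := hc.2
  exact hi (h1 (edge J c, c) (by rw [hx]; simp) i)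

theorem isUnilateralShift_iff (h : IsShiftModel J coef T₁ T₂) (hJ : IsDiagram J) :
    IsUnilateralShift T₁ ↔ ∀ j, ∃ i, (i, j) ∉ J := by
  rw [IsUnilateralShift, h.woldUnitary_eq_bot_iff hJ]
  exact and_iff_right h.isometry_fst

theorem hasNontrivialWold_iff (h : IsShiftModel J coef T₁ T₂) (hJ : IsDiagram J) {c : ℤ}
    (hc : IsFin J c) : HasNontrivialWold T₁ ↔ ∃ j, ∀ i, (i, j) ∈ J := by
  rw [HasNontrivialWold, Ne, h.woldUnitary_eq_bot_iff hJ]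
  push Not
  exact ⟨fun h1 => h1.2.1, fun h1 => ⟨h.isometry_fst, h1, h.woldUnitary_ne_top hJ hc⟩⟩

end IsShiftModel

end Wold

/-! ### The sets `{|μ| ^ q ≤ |λ| ≤ |μ| ^ p}` -/

section AnnularSet

theorem extPow_one (q : EReal) : extPow 1 q = 1 := by
  unfold extPow
  split_ifs <;> simp_all

theorem extPow_nonneg {x : ℝ} (hx : 0 ≤ x) (q : EReal) : 0 ≤ extPow x q := by
  unfold extPow
  split_ifs
  · exact le_rfl
  · exact zero_le_one
  · positivity

theorem extPow_zero {q : EReal} (hq : 0 < q) : extPow 0 q = 0 := by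
  unfold extPow
  split_ifs with h1 h2
  · rfl
  · exact absurd (zero_lt_one' ℝ) h2
  · refine Real.zero_rpow fun h0 => ?_
    have : q = ((q.toReal : ℝ) : EReal) := (EReal.coe_toReal h1 (by rintro rfl; simp at hq)).symm
    rw [h0] at this
    rw [this] at hq
    simp at hq

theorem not_indeterminate {x : ℝ} (h0 : 0 < x) (h1 : x < 1) (q : EReal) : ¬ Indeterminate x q := by
  rintro (⟨h, -⟩ | ⟨h, -⟩) <;> linarith

theorem extPow_le_iff {x t : ℝ} (h0 : 0 < x) (h1 : x < 1) {q : EReal} (hq : 0 ≤ q) :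
    extPow x q ≤ x ^ t ↔ (t : EReal) ≤ q := by
  induction q with
  | bot => simp at hq
  | top => simp [extPow, h1]; positivity
  | coe r =>
    simp only [extPow, EReal.coe_ne_top, if_false, EReal.toReal_coe, EReal.coe_le_coe_iff]
    exact Real.rpow_le_rpow_left_iff_of_base_lt_one h0 h1

theorem le_extPow_iff {x t : ℝ} (h0 : 0 < x) (h1 : x < 1) {q : EReal} (hq : 0 ≤ q) :
    x ^ t ≤ extPow x q ↔ q ≤ (t : EReal) := by
  induction q with
  | bot => simp at hq
  | top => simp [extPow, h1]; positivity
  | coe r =>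
    simp only [extPow, EReal.coe_ne_top, if_false, EReal.toReal_coe, EReal.coe_le_coe_iff]
    exact Real.rpow_le_rpow_left_iff_of_base_lt_one h0 h1

variable {p q : EReal} {μ l : ℂ}

theorem mem_annularSet_iff {t : ℝ} (h0 : 0 < ‖μ‖) (h1 : ‖μ‖ < 1) (ht : 0 ≤ t)
    (hl : ‖l‖ = ‖μ‖ ^ t) (hq : 0 ≤ q) (hp : 0 ≤ p) :
    (μ, l) ∈ annularSet q p ↔ p ≤ (t : EReal) ∧ (t : EReal) ≤ q := by
  have h2 : ‖l‖ ≤ 1 := by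
    rw [hl]
    exact Real.rpow_le_one h0.le h1.le ht
  simp only [annularSet, PowBetween, Set.mem_ofPred_eq, h1.le, h2, true_and,
    not_indeterminate h0 h1, false_or]
  rw [hl, extPow_le_iff h0 h1 hq, le_extPow_iff h0 h1 hp, and_comm]

theorem mem_annularSet_of_fst_norm_one (h1 : ‖μ‖ = 1) (h2 : ‖l‖ = 1) : (μ, l) ∈ annularSet q p := by
  simp [annularSet, PowBetween, h1, h2, extPow_one]

/-- The lower inequality reads `1 ≤ |λ|` and fails, unless it is the symbol `1 ^ ∞`; this convention
is what admits points with `|μ| = 1` and `|λ| < 1`. -/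
theorem mem_annularSet_fst_norm_one_iff (h1 : ‖μ‖ = 1) (h2 : ‖l‖ < 1) :
    (μ, l) ∈ annularSet q p ↔ q = ⊤ := by
  simp only [annularSet, PowBetween, Set.mem_ofPred_eq, h1, h2.le, le_refl, true_and, extPow_one,
    or_true, and_true, Indeterminate, one_ne_zero, false_and, false_or, or_iff_left (not_le.2 h2)]

theorem mem_annularSet_snd_zero_iff (h0 : 0 < ‖μ‖) (h1 : ‖μ‖ < 1) :
    (μ, 0) ∈ annularSet q p ↔ q = ⊤ := by
  simp only [annularSet, PowBetween, Set.mem_ofPred_eq, h1.le, norm_zero, zero_le_one, true_and,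
    not_indeterminate h0 h1, false_or, extPow_nonneg h0.le, and_true]
  constructor
  · intro h
    by_contra hq
    simp only [extPow, hq, if_false] at h
    have : 0 < ‖μ‖ ^ q.toReal := by positivity
    linarith
  · rintro rfl
    simp [extPow, h1]

/-- The upper inequality reads `|λ| ≤ 0` and fails, unless it is the symbol `0 ^ 0`. -/
theorem mem_annularSet_fst_zero_iff (h0 : 0 < ‖l‖) (h1 : ‖l‖ ≤ 1) (hq : 0 ≤ q) (hp : 0 ≤ p) :
    (0, l) ∈ annularSet q p ↔ p = 0 := by
  have h2 : Indeterminate 0 q ∨ extPow 0 q ≤ ‖l‖ := by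
    rcases hq.eq_or_lt with h | h
    · exact Or.inl (Or.inl ⟨rfl, h.symm⟩)
    · right
      rw [extPow_zero h]
      exact h0.le
  simp only [annularSet, PowBetween, Set.mem_ofPred_eq, norm_zero, zero_le_one, h1, h2, true_and]
  constructor
  · rintro (h | h)
    · rcases h with h | h
      · exact h.2
      · exact absurd h.1 zero_ne_one
    · by_contra h3
      rw [extPow_zero (lt_of_le_of_ne hp (Ne.symm h3))] at h
      linarith
  · rintro rfl
    exact Or.inl (Or.inl ⟨rfl, rfl⟩)

theorem zero_mem_annularSet (hq : 0 ≤ q) : ((0, 0) : ℂ × ℂ) ∈ annularSet q p := by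
  simp only [annularSet, PowBetween, Set.mem_ofPred_eq, norm_zero, zero_le_one, true_and,
    extPow_nonneg le_rfl, or_true, and_true]
  rcases hq.eq_or_lt with h | h
  · exact Or.inl (Or.inl ⟨rfl, h.symm⟩)
  · right
    rw [extPow_zero h]

theorem annularSet_subset : annularSet q p ⊆ disc ×ˢ disc := by
  rintro ⟨μ, l⟩ ⟨h1, h2, -⟩
  exact ⟨by simpa [disc] using h1, by simpa [disc] using h2⟩

end AnnularSet

/-! ### The theorem -/

section Parameters

variable {J : Set (ℤ × ℤ)} {a b c : ℤ}

theorem deltaMinus_nonneg (hJ : IsDiagram J) (ha : rowInf J a ≠ ⊥) (hc : IsFin J c) :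
    0 ≤ deltaMinus J a := by
  by_contra! h
  obtain ⟨t, h1, h2⟩ := EReal.lt_iff_exists_real_btwn.1 h
  exact h1.not_gt ((lt_deltaMinus_iff hJ ha hc t).2
    (ltLowerSlope_of_neg hJ hc (by exact_mod_cast h2)))

theorem deltaPlus_nonneg (hJ : IsDiagram J) (hb : rowInf J b ≠ ⊤) (hc : IsFin J c) :
    0 ≤ deltaPlus J b := by
  by_contra! h
  obtain ⟨t, h1, h2⟩ := EReal.lt_iff_exists_real_btwn.1 h
  exact h1.not_gt ((lt_deltaPlus_iff hJ hb hc t).2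
    (ltUpperSlope_of_neg hJ hc (by exact_mod_cast h2)))

theorem deltaMinus_le_rhoMinus (hJ : IsDiagram J) (ha : rowInf J a ≠ ⊥) (hc : IsFin J c) :
    deltaMinus J a ≤ rhoMinus J a := by
  by_contra! h
  obtain ⟨t, h1, h2⟩ := EReal.lt_iff_exists_real_btwn.1 h
  exact not_ltLowerSlope_of_lowerSlopeLT ((rhoMinus_lt_iff hJ ha hc t).1 h1)
    ((lt_deltaMinus_iff hJ ha hc t).1 h2)

theorem deltaPlus_le_rhoPlus (hJ : IsDiagram J) (hb : rowInf J b ≠ ⊤) (hc : IsFin J c) :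
    deltaPlus J b ≤ rhoPlus J b := by
  by_contra! h
  obtain ⟨t, h1, h2⟩ := EReal.lt_iff_exists_real_btwn.1 h
  exact not_ltUpperSlope_of_upperSlopeLT ((rhoPlus_lt_iff hJ hb hc t).1 h1)
    ((lt_deltaPlus_iff hJ hb hc t).1 h2)

theorem forall_not_lt_coe_iff {x : EReal} : (∀ t : ℝ, ¬ x < t) ↔ x = ⊤ := by
  constructor
  · intro h
    by_contra hx
    obtain ⟨t, ht, -⟩ := EReal.lt_iff_exists_real_btwn.1 (lt_top_iff_ne_top.2 hx)
    exact h t ht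
  · rintro rfl t
    simp

theorem hasLongHorizontalEnd_iff_rho (hJ : IsDiagram J) (ha : rowInf J a ≠ ⊥)
    (hb : rowInf J b ≠ ⊤) (hc : IsFin J c) :
    HasLongHorizontalEnd J ↔
      rhoMinus J a = ⊤ ∨ ((∀ j, ∃ i, (i, j) ∉ J) ∧ rhoPlus J b = ⊤) := by
  rw [hasLongHorizontalEnd_iff hJ hc]
  simp_rw [← rhoMinus_lt_iff hJ ha hc, ← rhoPlus_lt_iff hJ hb hc, forall_not_lt_coe_iff]

theorem hasLongVerticalEnd_iff_delta (hJ : IsDiagram J) (hns : ¬ IsSimple J)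
    (ha : rowInf J a ≠ ⊥) (hb : rowInf J b ≠ ⊤) (hc : IsFin J c) :
    HasLongVerticalEnd J ↔
      deltaPlus J b = 0 ∨ ((∀ i, ∃ j, (i, j) ∉ J) ∧ deltaMinus J a = 0) := by
  rw [hasLongVerticalEnd_iff hJ hns hc, ← lt_deltaPlus_iff hJ hb hc,
    ← lt_deltaMinus_iff hJ ha hc, not_lt, not_lt, EReal.coe_zero]
  rw [(deltaPlus_nonneg hJ hb hc).ge_iff_eq', (deltaMinus_nonneg hJ ha hc).ge_iff_eq']

end Parameters

/-- Two subsets of the closed bidisc that agree away from the distinguished boundary. -/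
theorem union_circ_eq_of_strata {G S : Set (ℂ × ℂ)} (hG : G ⊆ disc ×ˢ disc)
    (hS : S ⊆ disc ×ˢ disc) (hT : circ ×ˢ circ ⊆ S) (h0 : (0, 0) ∈ G ↔ (0, 0) ∈ S)
    (hl : ∀ μ l : ℂ, ‖μ‖ < 1 → ‖l‖ = 1 → ((μ, l) ∈ G ↔ (μ, l) ∈ S))
    (hμ : ∀ μ l : ℂ, ‖μ‖ = 1 → ‖l‖ < 1 → ((μ, l) ∈ G ↔ (μ, l) ∈ S))
    (hl0 : ∀ μ : ℂ, 0 < ‖μ‖ → ‖μ‖ < 1 → ((μ, 0) ∈ G ↔ (μ, 0) ∈ S))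
    (hμ0 : ∀ l : ℂ, 0 < ‖l‖ → ‖l‖ < 1 → ((0, l) ∈ G ↔ (0, l) ∈ S))
    (hi : ∀ (μ l : ℂ) (t : ℝ), 0 < ‖μ‖ → ‖μ‖ < 1 → ‖l‖ < 1 → 0 < t → ‖l‖ = ‖μ‖ ^ t →
      ((μ, l) ∈ G ↔ (μ, l) ∈ S)) :
    G ∪ circ ×ˢ circ = S := by
  ext ⟨μ, l⟩
  by_cases hd : ‖μ‖ ≤ 1 ∧ ‖l‖ ≤ 1
  swap
  · have h1 : (μ, l) ∉ disc ×ˢ disc := by simpa [disc] using hd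
    refine iff_of_false ?_ fun h => h1 (hS h)
    rintro (h | h)
    · exact h1 (hG h)
    · exact h1 (hS (hT h))
  obtain ⟨hd1, hd2⟩ := hd
  by_cases hc : (μ, l) ∈ circ ×ˢ circ
  · exact iff_of_true (Or.inr hc) (hT hc)
  rw [Set.mem_union, or_iff_left hc]
  have hc' : ‖μ‖ = 1 → ‖l‖ ≠ 1 := by simpa [circ] using hc
  rcases hd2.eq_or_lt with h2 | h2
  · exact hl μ l (lt_of_le_of_ne hd1 fun h => hc' h h2) h2
  rcases hd1.eq_or_lt with h1 | h1
  · exact hμ μ l h1 h2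
  rcases eq_or_ne μ 0 with rfl | hm
  · rcases eq_or_ne l 0 with rfl | hl'
    · exact h0
    · exact hμ0 l (norm_pos_iff.2 hl') h2
  rcases eq_or_ne l 0 with rfl | hl'
  · exact hl0 μ (norm_pos_iff.2 hm) h1
  have p1 := norm_pos_iff.2 hm
  have p2 := norm_pos_iff.2 hl'
  -- The exponent solving `‖l‖ = ‖μ‖ ^ t`; it is positive since both moduli lie strictly between `0`
  -- and `1`.
  refine hi μ l (Real.log ‖l‖ / Real.log ‖μ‖) p1 h1 h2
    (div_pos_of_neg_of_neg (Real.log_neg p2 h2) (Real.log_neg p1 h1)) ?_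
  rw [Real.rpow_def_of_pos p1, mul_div_cancel₀ _ (Real.log_neg p1 h1).ne, Real.exp_log p2]

/-- Converts the three surviving patterns into the complement of three intervals. The interior of
the middle one, `r₂ < t < d₁`, holds the exponents for which the formal eigenvector decays at both
ends. -/
theorem not_between_iff {α : Type*} [LinearOrder α] {t d₁ r₁ d₂ r₂ : α} (h₁ : d₁ ≤ r₁)
    (h₂ : d₂ ≤ r₂) : (t < d₂ ∧ (t < d₁ ∨ r₁ < t)) ∨ (r₁ < t ∧ r₂ < t) ↔
      ¬ (((d₁ ≤ t ∧ t ≤ r₁) ∨ (r₂ ≤ t ∧ t ≤ d₁)) ∨ (d₂ ≤ t ∧ t ≤ r₂)) := by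
  simp only [not_or, not_and_or, not_le]
  constructor
  · rintro (⟨h, h' | h'⟩ | ⟨h, h'⟩)
    · exact ⟨⟨Or.inl h', Or.inl (h.trans_le h₂)⟩, Or.inl h⟩
    · exact ⟨⟨Or.inr h', Or.inl (h.trans_le h₂)⟩, Or.inl h⟩
    · exact ⟨⟨Or.inr h, Or.inr (h₁.trans_lt h)⟩, Or.inr h'⟩
  · rintro ⟨⟨h | h, h'⟩, h'' | h''⟩
    · exact Or.inl ⟨h'', Or.inl h⟩
    · exact absurd h' (not_or.2 ⟨h''.not_gt, h.not_gt⟩)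
    · exact Or.inl ⟨h'', Or.inr h⟩
    · exact Or.inr ⟨h, h''⟩

theorem disc_prod_circ_subset : disc ×ˢ circ ⊆ disc ×ˢ disc :=
  Set.prod_mono_right Metric.sphere_subset_closedBall

theorem circ_prod_disc_subset : circ ×ˢ disc ⊆ disc ×ˢ disc :=
  Set.prod_mono_left Metric.sphere_subset_closedBall

theorem mem_disc_prod_circ {μ l : ℂ} : (μ, l) ∈ disc ×ˢ circ ↔ ‖μ‖ ≤ 1 ∧ ‖l‖ = 1 := by
  simp [disc, circ]

theorem mem_circ_prod_disc {μ l : ℂ} : (μ, l) ∈ circ ×ˢ disc ↔ ‖μ‖ = 1 ∧ ‖l‖ ≤ 1 := by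
  simp [disc, circ]

/-! ### The four cases, stratum by stratum -/

section Strata

variable {J : Set (ℤ × ℤ)} {H : Type*} [NormedAddCommGroup H] [InnerProductSpace ℂ H]
  [CompleteSpace H] {coef : H →ₗ[ℂ] (ℤ × ℤ → ℂ)} {T₁ T₂ : H →L[ℂ] H} {a b c : ℤ} {μ l : ℂ}

namespace IsShiftModel

theorem Gamma3_subset (h : IsShiftModel J coef T₁ T₂) : Gamma3 T₁ T₂ ⊆ disc ×ˢ disc := by
  rintro ⟨μ, l⟩ hp
  constructor
  · by_contra h1
    exact notMem_Gamma3_of_norm_gt h (by simpa [disc] using h1) hp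
  · by_contra h1
    exact notMem_Gamma3_of_norm_gt h.swap (by simpa [disc] using h1) ((Gamma3_swap _ _ _ _).1 hp)

theorem mem_Gamma3_iff_of_norm_fst_eq_one (h : IsShiftModel J coef T₁ T₂) (hJ : IsDiagram J)
    (hμ : ‖μ‖ = 1) (hl : ‖l‖ < 1) : (μ, l) ∈ Gamma3 T₁ T₂ ↔ HasLongHorizontal J := by
  rw [Gamma3_swap, h.swap.mem_Gamma3_iff_of_norm_snd_eq_one hJ.swap hl hμ, hasLongVertical_swap]

theorem mem_Gamma3_fst_zero_iff (h : IsShiftModel J coef T₁ T₂) (hJ : IsDiagram J)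
    (hl0 : 0 < ‖l‖) (hl : ‖l‖ < 1) : (0, l) ∈ Gamma3 T₁ T₂ ↔ HasLongVerticalEnd J := by
  rw [Gamma3_swap, h.swap.mem_Gamma3_snd_zero_iff hJ.swap (norm_pos_iff.1 hl0) hl,
    hasLongHorizontalEnd_swap]

theorem notMem_Gamma3_iff_parameters (h : IsShiftModel J coef T₁ T₂) (hJ : IsDiagram J)
    (ha : rowInf J a ≠ ⊥) (hb : rowInf J b ≠ ⊤) (hc : IsFin J c) {t : ℝ} (hμ0 : 0 < ‖μ‖)
    (hμ : ‖μ‖ < 1) (ht : 0 ≤ t) (hl : ‖l‖ = ‖μ‖ ^ t) :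
    (μ, l) ∉ Gamma3 T₁ T₂ ↔
      (t < deltaPlus J b ∧ (t < deltaMinus J a ∨ rhoMinus J a < t)) ∨
        (rhoMinus J a < t ∧ rhoPlus J b < t) := by
  rw [h.notMem_Gamma3_iff hJ hμ0 hμ ht hl hc, rhoMinus_lt_iff hJ ha hc, rhoPlus_lt_iff hJ hb hc,
    lt_deltaMinus_iff hJ ha hc, lt_deltaPlus_iff hJ hb hc]

/-- A full row makes every exponent lie below the upper slopes, a full column makes every `t > 0`
lie above the lower slopes, so no interior point with non-zero coordinates belongs to `Γ₃`. The
origin is adjoined on both sides because `J` may or may not have a corner. -/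
theorem Gamma3_eq_of_full_row_of_full_column (h : IsShiftModel J coef T₁ T₂) (hJ : IsDiagram J)
    (hne : J.Nonempty) (hns : ¬ IsSimple J) (hF : ∃ j, ∀ i, (i, j) ∈ J)
    (hC : ∃ i, ∀ j, (i, j) ∈ J) :
    Gamma3 T₁ T₂ ∪ {(0, 0)} ∪ circ ×ˢ circ = circ ×ˢ disc ∪ disc ×ˢ circ ∪ {(0, 0)} := by
  obtain ⟨c, hc⟩ := exists_isFin hJ hne hns
  have hzero : {((0 : ℂ), (0 : ℂ))} ⊆ disc ×ˢ disc := by simp [disc]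
  refine union_circ_eq_of_strata (Set.union_subset h.Gamma3_subset hzero)
    (Set.union_subset (Set.union_subset circ_prod_disc_subset disc_prod_circ_subset) hzero)
    (fun p hp => Or.inl (Or.inl ⟨hp.1, Metric.sphere_subset_closedBall hp.2⟩)) (by simp) ?_ ?_ ?_ ?_ ?_
  · intro μ l h1 h2
    refine iff_of_true (Or.inl ?_) (Or.inl (Or.inr (mem_disc_prod_circ.2 ⟨h1.le, h2⟩)))
    exact (h.mem_Gamma3_iff_of_norm_snd_eq_one hJ h1 h2).2
      (hasLongVertical_of_full_column hJ hne hns hC)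
  · intro μ l h1 h2
    refine iff_of_true (Or.inl ?_) (Or.inl (Or.inl (mem_circ_prod_disc.2 ⟨h1, h2.le⟩)))
    exact (h.mem_Gamma3_iff_of_norm_fst_eq_one hJ h1 h2).2
      (hasLongHorizontal_of_full_row hJ hne hns hF)
  · intro μ h0 h1
    have hL : ¬ HasLongHorizontalEnd J := by
      rw [hasLongHorizontalEnd_iff hJ hc]
      rintro (h2 | ⟨h2, -⟩)
      · exact h2 1 (lowerSlopeLT_of_full_column hJ hc hC one_pos)
      · obtain ⟨j, hj⟩ := hF
        obtain ⟨i, hi⟩ := h2 j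
        exact hi (hj i)
    simp [disc, circ, h1.ne, norm_pos_iff.1 h0,
      h.mem_Gamma3_snd_zero_iff hJ (norm_pos_iff.1 h0) h1, hL]
  · intro l h0 h1
    have hL : ¬ HasLongVerticalEnd J := by
      rw [hasLongVerticalEnd_iff hJ hns hc]
      rintro (h2 | ⟨h2, -⟩)
      · exact h2 (Or.inl hF)
      · obtain ⟨i, hi⟩ := hC
        obtain ⟨j, hj⟩ := h2 i
        exact hj (hi j)
    simp [disc, circ, h1.ne, norm_pos_iff.1 h0,
      h.mem_Gamma3_fst_zero_iff hJ h0 h1, hL]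
  · intro μ l t h0 h1 h2 ht hl
    have h3 := (h.notMem_Gamma3_iff hJ h0 h1 ht.le hl hc).2
      (Or.inl ⟨Or.inl hF, Or.inr (lowerSlopeLT_of_full_column hJ hc hC ht)⟩)
    simp [disc, circ, h1.ne, h2.ne, h3]

/-- With a full column every `t > 0` exceeds `ρ₋`, so the lower part of the boundary imposes nothing
and only the upper parameters survive; the full column supplies the long vertical segments for `|λ|
= 1`. -/
theorem Gamma3_eq_of_full_column (h : IsShiftModel J coef T₁ T₂) (hJ : IsDiagram J)
    (hne : J.Nonempty) (hns : ¬ IsSimple J) (ha : rowInf J a ≠ ⊥) (hb : rowInf J b ≠ ⊤)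
    (hF : ∀ j, ∃ i, (i, j) ∉ J) (hC : ∃ i, ∀ j, (i, j) ∈ J) :
    Gamma3 T₁ T₂ ∪ circ ×ˢ circ =
      annularSet (rhoPlus J b) (deltaPlus J b) ∪ disc ×ˢ circ := by
  obtain ⟨c, hc⟩ := exists_isFin hJ hne hns
  have hd := deltaPlus_nonneg hJ hb hc
  have hr := hd.trans (deltaPlus_le_rhoPlus hJ hb hc)
  have hρ : ∀ t : ℝ, 0 < t → rhoMinus J a < t := fun t ht =>
    (rhoMinus_lt_iff hJ ha hc t).2 (lowerSlopeLT_of_full_column hJ hc hC ht)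
  have hρtop : rhoMinus J a ≠ ⊤ := ((hρ 1 one_pos).trans_le le_top).ne
  have hH := hasLongHorizontalEnd_iff_rho hJ ha hb hc
  have hV := hasLongVerticalEnd_iff_delta hJ hns ha hb hc
  have hC' : ¬ ∀ i, ∃ j, (i, j) ∉ J := by
    push Not
    exact hC
  simp only [hρtop, hF, false_or, implies_true, true_and] at hH
  simp only [hC', false_and, or_false] at hV
  obtain ⟨i, j, c1, c2, c3⟩ := exists_corner hJ hne hns (Or.inr hF)
  refine union_circ_eq_of_strata h.Gamma3_subset
    (Set.union_subset annularSet_subset disc_prod_circ_subset)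
    (fun p hp => Or.inr ⟨Metric.sphere_subset_closedBall hp.1, hp.2⟩)
    (iff_of_true (h.zero_mem_Gamma3 c1 c2 c3) (Or.inl (zero_mem_annularSet hr))) ?_ ?_ ?_ ?_ ?_
  · intro μ l h1 h2
    exact iff_of_true ((h.mem_Gamma3_iff_of_norm_snd_eq_one hJ h1 h2).2
      (hasLongVertical_of_full_column hJ hne hns hC)) (Or.inr (mem_disc_prod_circ.2 ⟨h1.le, h2⟩))
  · intro μ l h1 h2
    rw [h.mem_Gamma3_iff_of_norm_fst_eq_one hJ h1 h2, hasLongHorizontal_iff_of_no_full_row hF, hH,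
      Set.mem_union, mem_annularSet_fst_norm_one_iff h1 h2, mem_disc_prod_circ]
    simp [h2.ne]
  · intro μ h0 h1
    rw [h.mem_Gamma3_snd_zero_iff hJ (norm_pos_iff.1 h0) h1, hH, Set.mem_union,
      mem_annularSet_snd_zero_iff h0 h1, mem_disc_prod_circ]
    simp
  · intro l h0 h1
    rw [h.mem_Gamma3_fst_zero_iff hJ h0 h1, hV, Set.mem_union,
      mem_annularSet_fst_zero_iff h0 h1.le hr hd, mem_disc_prod_circ]
    simp [h1.ne]
  · intro μ l t h0 h1 h2 ht hl
    rw [← not_iff_not, h.notMem_Gamma3_iff_parameters hJ ha hb hc h0 h1 ht.le hl, Set.mem_union,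
      mem_annularSet_iff h0 h1 ht.le hl hr hd, mem_disc_prod_circ]
    simp only [hρ t ht, h2.ne, and_false, or_false, or_true, and_true, true_and, not_and_or,
      not_le]

/-- With a full row `δ₊ = ρ₊ = ∞`, so the condition on the upper part always holds and only the
lower parameters survive. -/
theorem Gamma3_eq_of_full_row (h : IsShiftModel J coef T₁ T₂) (hJ : IsDiagram J)
    (hne : J.Nonempty) (hns : ¬ IsSimple J) (ha : rowInf J a ≠ ⊥) (hb : rowInf J b ≠ ⊤)
    (hF : ∃ j, ∀ i, (i, j) ∈ J) (hC : ∀ i, ∃ j, (i, j) ∉ J) :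
    Gamma3 T₁ T₂ ∪ circ ×ˢ circ =
      annularSet (rhoMinus J a) (deltaMinus J a) ∪ circ ×ˢ disc := by
  obtain ⟨c, hc⟩ := exists_isFin hJ hne hns
  have hd := deltaMinus_nonneg hJ ha hc
  have hr := hd.trans (deltaMinus_le_rhoMinus hJ ha hc)
  have hδ : deltaPlus J b = ⊤ := if_pos (hF.imp fun j hj => (rowInf_eq_bot_iff hJ).2 hj)
  have hρ : rhoPlus J b = ⊤ := top_le_iff.1 (hδ ▸ deltaPlus_le_rhoPlus hJ hb hc)
  have hH := hasLongHorizontalEnd_iff_rho hJ ha hb hc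
  have hV := hasLongVerticalEnd_iff_delta hJ hns ha hb hc
  have hF' : ¬ ∀ j, ∃ i, (i, j) ∉ J := by
    push Not
    exact hF
  simp only [hF', false_and, or_false] at hH
  simp only [hδ, hC, implies_true, true_and, EReal.top_ne_zero, false_or] at hV
  obtain ⟨i, j, c1, c2, c3⟩ := exists_corner hJ hne hns (Or.inl hC)
  refine union_circ_eq_of_strata h.Gamma3_subset
    (Set.union_subset annularSet_subset circ_prod_disc_subset)
    (fun p hp => Or.inr ⟨hp.1, Metric.sphere_subset_closedBall hp.2⟩)
    (iff_of_true (h.zero_mem_Gamma3 c1 c2 c3) (Or.inl (zero_mem_annularSet hr))) ?_ ?_ ?_ ?_ ?_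
  · intro μ l h1 h2
    rw [h.mem_Gamma3_iff_of_norm_snd_eq_one hJ h1 h2, hasLongVertical_iff_of_no_full_column hC, hV,
      Set.mem_union, mem_circ_prod_disc]
    rcases (norm_nonneg μ).eq_or_lt with h0 | h0
    · rw [norm_eq_zero.1 h0.symm, mem_annularSet_fst_zero_iff (by rw [h2]; exact one_pos) h2.le hr hd]
      simp
    · rw [mem_annularSet_iff h0 h1 le_rfl (by rw [h2, Real.rpow_zero]) hr hd]
      simp only [EReal.coe_zero, hr, and_true, h1.ne, false_and, or_false, hd.ge_iff_eq']
  · intro μ l h1 h2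
    exact iff_of_true ((h.mem_Gamma3_iff_of_norm_fst_eq_one hJ h1 h2).2
      (hasLongHorizontal_of_full_row hJ hne hns hF)) (Or.inr (mem_circ_prod_disc.2 ⟨h1, h2.le⟩))
  · intro μ h0 h1
    rw [h.mem_Gamma3_snd_zero_iff hJ (norm_pos_iff.1 h0) h1, hH, Set.mem_union,
      mem_annularSet_snd_zero_iff h0 h1, mem_circ_prod_disc]
    simp [h1.ne]
  · intro l h0 h1
    rw [h.mem_Gamma3_fst_zero_iff hJ h0 h1, hV, Set.mem_union,
      mem_annularSet_fst_zero_iff h0 h1.le hr hd, mem_circ_prod_disc]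
    simp
  · intro μ l t h0 h1 h2 ht hl
    rw [← not_iff_not, h.notMem_Gamma3_iff_parameters hJ ha hb hc h0 h1 ht.le hl, Set.mem_union,
      mem_annularSet_iff h0 h1 ht.le hl hr hd, mem_circ_prod_disc]
    simp only [hδ, hρ, EReal.coe_lt_top, not_top_lt, h1.ne, false_and, and_false, or_false,
      true_and, not_and_or, not_le]

theorem Gamma3_eq_of_no_full_row_of_no_full_column (h : IsShiftModel J coef T₁ T₂)
    (hJ : IsDiagram J) (hne : J.Nonempty) (hns : ¬ IsSimple J) (ha : rowInf J a ≠ ⊥)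
    (hb : rowInf J b ≠ ⊤) (hF : ∀ j, ∃ i, (i, j) ∉ J) (hC : ∀ i, ∃ j, (i, j) ∉ J) :
    Gamma3 T₁ T₂ ∪ circ ×ˢ circ =
      annularSet (rhoMinus J a) (deltaMinus J a) ∪ annularSet (deltaMinus J a) (rhoPlus J b) ∪
        annularSet (rhoPlus J b) (deltaPlus J b) := by
  obtain ⟨c, hc⟩ := exists_isFin hJ hne hns
  have d₁ := deltaMinus_nonneg hJ ha hc
  have e₁ := deltaMinus_le_rhoMinus hJ ha hc
  have r₁ := d₁.trans e₁
  have d₂ := deltaPlus_nonneg hJ hb hc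
  have e₂ := deltaPlus_le_rhoPlus hJ hb hc
  have r₂ := d₂.trans e₂
  have hH := hasLongHorizontalEnd_iff_rho hJ ha hb hc
  have hV := hasLongVerticalEnd_iff_delta hJ hns ha hb hc
  simp only [hF, implies_true, true_and] at hH
  simp only [hC, implies_true, true_and] at hV
  -- The middle set contributes the redundant alternatives `δ₋ = ∞` here and `ρ₊ = 0` in `zero₁`;
  -- they are inserted to match the union of three sets.
  have top₁ : rhoMinus J a = ⊤ ∨ rhoPlus J b = ⊤ ↔
      (rhoMinus J a = ⊤ ∨ deltaMinus J a = ⊤) ∨ rhoPlus J b = ⊤ := by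
    have : deltaMinus J a = ⊤ → rhoMinus J a = ⊤ := fun h1 => top_le_iff.1 (h1 ▸ e₁)
    exact ⟨fun h1 => h1.imp_left Or.inl, fun h1 => h1.imp_left (Or.elim · id this)⟩
  have zero₁ : deltaPlus J b = 0 ∨ deltaMinus J a = 0 ↔
      (deltaMinus J a = 0 ∨ rhoPlus J b = 0) ∨ deltaPlus J b = 0 := by
    have : rhoPlus J b = 0 → deltaPlus J b = 0 := fun h1 => le_antisymm (h1 ▸ e₂) d₂
    exact ⟨fun h1 => h1.symm.imp_left Or.inl,
      fun h1 => h1.elim (Or.elim · Or.inr fun h2 => Or.inl (this h2)) Or.inl⟩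
  obtain ⟨i, j, c1, c2, c3⟩ := exists_corner hJ hne hns (Or.inl hC)
  refine union_circ_eq_of_strata h.Gamma3_subset
    (Set.union_subset (Set.union_subset annularSet_subset annularSet_subset) annularSet_subset)
    (fun p hp => Or.inr (mem_annularSet_of_fst_norm_one (by simpa [circ] using hp.1)
      (by simpa [circ] using hp.2)))
    (iff_of_true (h.zero_mem_Gamma3 c1 c2 c3) (Or.inr (zero_mem_annularSet r₂))) ?_ ?_ ?_ ?_ ?_
  · intro μ l h1 h2
    rw [h.mem_Gamma3_iff_of_norm_snd_eq_one hJ h1 h2, hasLongVertical_iff_of_no_full_column hC, hV,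
      Set.mem_union, Set.mem_union, zero₁]
    rcases (norm_nonneg μ).eq_or_lt with h0 | h0
    · have h3 : 0 < ‖l‖ := by rw [h2]; exact one_pos
      rw [norm_eq_zero.1 h0.symm, mem_annularSet_fst_zero_iff h3 h2.le r₁ d₁,
        mem_annularSet_fst_zero_iff h3 h2.le d₁ r₂, mem_annularSet_fst_zero_iff h3 h2.le r₂ d₂]
    · have h3 : ‖l‖ = ‖μ‖ ^ (0 : ℝ) := by rw [h2, Real.rpow_zero]
      rw [mem_annularSet_iff h0 h1 le_rfl h3 r₁ d₁, mem_annularSet_iff h0 h1 le_rfl h3 d₁ r₂,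
        mem_annularSet_iff h0 h1 le_rfl h3 r₂ d₂]
      simp only [EReal.coe_zero, r₁, r₂, d₁, and_true, d₁.ge_iff_eq', d₂.ge_iff_eq', r₂.ge_iff_eq']
  · intro μ l h1 h2
    rw [h.mem_Gamma3_iff_of_norm_fst_eq_one hJ h1 h2, hasLongHorizontal_iff_of_no_full_row hF, hH,
      Set.mem_union, Set.mem_union, mem_annularSet_fst_norm_one_iff h1 h2,
      mem_annularSet_fst_norm_one_iff h1 h2, mem_annularSet_fst_norm_one_iff h1 h2, top₁]
  · intro μ h0 h1
    rw [h.mem_Gamma3_snd_zero_iff hJ (norm_pos_iff.1 h0) h1, hH, Set.mem_union, Set.mem_union,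
      mem_annularSet_snd_zero_iff h0 h1, mem_annularSet_snd_zero_iff h0 h1,
      mem_annularSet_snd_zero_iff h0 h1, top₁]
  · intro l h0 h1
    rw [h.mem_Gamma3_fst_zero_iff hJ h0 h1, hV, Set.mem_union, Set.mem_union,
      mem_annularSet_fst_zero_iff h0 h1.le r₁ d₁, mem_annularSet_fst_zero_iff h0 h1.le d₁ r₂,
      mem_annularSet_fst_zero_iff h0 h1.le r₂ d₂, zero₁]
  · intro μ l t h0 h1 h2 ht hl
    rw [← not_iff_not, h.notMem_Gamma3_iff_parameters hJ ha hb hc h0 h1 ht.le hl, Set.mem_union,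
      Set.mem_union, mem_annularSet_iff h0 h1 ht.le hl r₁ d₁,
      mem_annularSet_iff h0 h1 ht.le hl d₁ r₂, mem_annularSet_iff h0 h1 ht.le hl r₂ d₂]
    exact not_between_iff e₁ e₂

end IsShiftModel

end Strata

end DiagramPair
end

open DiagramPair in
theorem mainTheorem2 (J : Set (ℤ × ℤ)) (hJ : IsDiagram J) (hne : J.Nonempty)
    (hns : ¬ IsSimple J) (a b : ℤ) (ha : rowInf J a ≠ ⊥) (hb : rowInf J b ≠ ⊤) :
    ((HasNontrivialWold (Mw hJ) ∨ IsUnilateralShift (Mw hJ)) ∧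
      (HasNontrivialWold (Mz hJ) ∨ IsUnilateralShift (Mz hJ))) ∧
    (HasNontrivialWold (Mw hJ) → HasNontrivialWold (Mz hJ) →
      Gamma3 (Mw hJ) (Mz hJ) ∪ {(0, 0)} ∪ circ ×ˢ circ =
        circ ×ˢ disc ∪ disc ×ˢ circ ∪ {(0, 0)}) ∧
    (HasNontrivialWold (Mz hJ) → IsUnilateralShift (Mw hJ) →
      Gamma3 (Mw hJ) (Mz hJ) ∪ circ ×ˢ circ =
        annularSet (rhoPlus J b) (deltaPlus J b) ∪ disc ×ˢ circ) ∧
    (HasNontrivialWold (Mw hJ) → IsUnilateralShift (Mz hJ) →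
      Gamma3 (Mw hJ) (Mz hJ) ∪ circ ×ˢ circ =
        annularSet (rhoMinus J a) (deltaMinus J a) ∪ circ ×ˢ disc) ∧
    (IsUnilateralShift (Mw hJ) → IsUnilateralShift (Mz hJ) →
      Gamma3 (Mw hJ) (Mz hJ) ∪ circ ×ˢ circ =
        annularSet (rhoMinus J a) (deltaMinus J a) ∪
        annularSet (deltaMinus J a) (rhoPlus J b) ∪
        annularSet (rhoPlus J b) (deltaPlus J b)) := by
  have h := isShiftModel_HJ hJ
  obtain ⟨c, hc⟩ := exists_isFin hJ hne hns
  obtain ⟨c', hc'⟩ := exists_isFin hJ.swap (hne.preimage Prod.swap_surjective)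
    fun h1 => hns h1.of_swap
  have w₁ : HasNontrivialWold (Mw hJ) ↔ ∃ j, ∀ i, (i, j) ∈ J := h.hasNontrivialWold_iff hJ hc
  have w₂ : HasNontrivialWold (Mz hJ) ↔ ∃ i, ∀ j, (i, j) ∈ J :=
    h.swap.hasNontrivialWold_iff hJ.swap hc'
  have u₁ : IsUnilateralShift (Mw hJ) ↔ ∀ j, ∃ i, (i, j) ∉ J := h.isUnilateralShift_iff hJ
  have u₂ : IsUnilateralShift (Mz hJ) ↔ ∀ i, ∃ j, (i, j) ∉ J :=
    h.swap.isUnilateralShift_iff hJ.swap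
  rw [w₁, w₂, u₁, u₂]
  refine ⟨⟨?_, ?_⟩, fun hF hC => h.Gamma3_eq_of_full_row_of_full_column hJ hne hns hF hC,
    fun hC hF => h.Gamma3_eq_of_full_column hJ hne hns ha hb hF hC,
    fun hF hC => h.Gamma3_eq_of_full_row hJ hne hns ha hb hF hC,
    fun hF hC => h.Gamma3_eq_of_no_full_row_of_no_full_column hJ hne hns ha hb hF hC⟩
  · by_contra! h1
    obtain ⟨h2, j, h3⟩ := h1
    obtain ⟨i, hi⟩ := h2 j
    exact hi (h3 i)
  · by_contra! h1
    obtain ⟨h2, i, h3⟩ := h1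
    obtain ⟨j, hj⟩ := h2 i
    exact hj (h3 j)
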